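/- Let $\alpha\in(0,1/2)$ be irrational and let $\mathbb A_{2\alpha}$ be the noncommutative torus, i.e. the universal unital $C^*$-algebra generated by two unitaries $U,V$ with $UV=e^{4\pi i\alpha}VU$. Put $W(m,n):=e^{-2\pi i\alpha mn}U^mV^n$ for $(m,n)\in\mathbb Z^2$, and let $\tau$ be the canonical tracial state, determined by $\tau(W(m,n))=\delta_{m,0}\delta_{n,0}$. An element $A\in\mathbb A_{2\alpha}$ is determined by its Fourier coefficients $f(m,n):=\tau(W(-m,-n)A)$, and one writes $A=W(f)$. For $n\in\mathbb Z$ let $\check f^{(n)}\in C(\mathbb T)$ be the continuous function on the unit circle $\mathbb T$ with Fourier series $\sum_{m\in\mathbb Z}f(m,n)z^m$. Let $R_\beta$ denote the rotation of $\mathbb T$ by the angle $2\pi\beta$, and $R:=R_\alpha$. Let $\mathsf f$ be an orientation preserving $C^\infty$-diffeomorphism of $\mathbb T$ that is conjugate to $R_{2\alpha}$ by a homeomorphism $\mathsf h$ of $\mathbb T$ with $\mathsf h(1)=1$, that is, $\mathsf f=\mathsf h\circ R_{2\alpha}\circ\mathsf h^{-1}$. (By Denjoy's theorem such an $\mathsf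 h$ exists, and it is unique, for each orientation preserving $C^\infty$-diffeomorphism $\mathsf f$ with rotation number $2\alpha$.) Let $D=\frac{d}{dz}=\frac{1}{iz}\frac{d}{d\theta}$, $z=e^{i\theta}$, denote the derivative on $C^1(\mathbb T)$. For $k\in\mathbb N=\{0,1,2,\dots\}$ and $l\in\{0,1\}$ put $$\rho_{k,l}(W(f)):=\sup_{n\in\mathbb Z}\Big\{(|n|+1)^k\,\big\|D^l\big(\check f^{(n)}\circ R^{-n}\circ\mathsf h^{-1}\big)\big\|_\infty\Big\}$$ for those $W(f)\in\mathbb A_{2\alpha}$ such that $\check f^{(n)}\circ R^{-n}\circ\mathsf h^{-1}\in C^1(\mathbb T)$ for all $n\in\mathbb Z$, and let $\mathbb A^o_{2\alpha}$ be the set of all such $W(f)$ for which $\rho_{k,l}(W(f))<+\infty$ for all $k\in\mathbb N$ and $l\in\{0,1\}$. Then $\mathbb A^o_{2\alpha}$ is a (unital) $*$-subalgebra of $\mathbb A_{2\alpha}$, it is dense in $\mathbb A_{2\alpha}$ in norm, and it is closed under the entire functional calculus: for each entire function $F(w)=\sum_{r\ge0}F_rw^r$ and each $A\in\mathbb A^o_{2\alpha}$,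 the series $\sum_{r\ge0}F_rA^r$ converges in $\mathbb A_{2\alpha}$ and its sum $F(A)$ belongs to $\mathbb A^o_{2\alpha}$. -/

import Mathlib

open scoped ENNReal Manifold ContDiff

noncomputable section

/-! ## The noncommutative torus -/

/-- A representation of the relations of the noncommutative torus `𝔸_{2α}`: two unitaries `u, v` of
a (nonzero) unital C*-algebra with `u v = e^{4πiα} v u`. -/
structure TorusRep (α : ℝ) : Type 1 where
  carrier : Type
  [cstar : CStarAlgebra carrier]
  [nontriv : Nontrivial carrier]
  u : unitary carrier
  v : unitary carrier
  comm : (u : carrier) * (v : carrier) =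
    Complex.exp (4 * Real.pi * Complex.I * α) • ((v : carrier) * (u : carrier))

attribute [instance] TorusRep.cstar TorusRep.nontriv

/-- The C*-algebra of bounded families `(x_ρ)_ρ`, `x_ρ ∈ ρ.carrier`, indexed by all
representations `ρ` of the relations, with the supremum norm. -/
abbrev TorusProd (α : ℝ) : Type 1 := lp (fun ρ : TorusRep α => ρ.carrier) ∞

instance (α : ℝ) : CStarAlgebra (TorusProd α) where

theorem TorusProd.memlp_unitary {α : ℝ} (w : ∀ ρ : TorusRep α, unitary ρ.carrier) :
    Memℓp (fun ρ : TorusRep α => (w ρ : ρ.carrier)) ∞ := by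
  refine memℓp_infty ⟨1, ?_⟩
  rintro _ ⟨ρ, rfl⟩
  exact (CStarRing.norm_coe_unitary (w ρ)).le

/-- A family of unitaries, as a unitary of the product. -/
def TorusProd.mkUnitary {α : ℝ} (w : ∀ ρ : TorusRep α, unitary ρ.carrier) :
    unitary (TorusProd α) :=
  ⟨⟨fun ρ => (w ρ : ρ.carrier), TorusProd.memlp_unitary w⟩, by
    rw [Unitary.mem_iff]
    constructor
    · ext ρ
      simp [lp.infty_coeFn_mul, lp.coeFn_star, lp.infty_coeFn_one]
    · ext ρ
      simp [lp.infty_coeFn_mul, lp.coeFn_star, lp.infty_coeFn_one]⟩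

/-- The two generating unitaries in the product over all representations. -/
def TorusProd.U (α : ℝ) : unitary (TorusProd α) := TorusProd.mkUnitary fun ρ => ρ.u

/-- See `TorusProd.U`. -/
def TorusProd.V (α : ℝ) : unitary (TorusProd α) := TorusProd.mkUnitary fun ρ => ρ.v

/-- The universal unital C*-algebra generated by two unitaries `U, V` with `U V = e^{4πiα} V U`, as
a star subalgebra: the closed *-algebra generated by `(ρ.u)_ρ` and `(ρ.v)_ρ` in the product over
all representations `ρ`. Equivalently, the completion of the *-algebra generated by the relations
in the norm `‖x‖ = sup_ρ ‖ρ(x)‖`. -/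
def torusSubalgebra (α : ℝ) : StarSubalgebra ℂ (TorusProd α) :=
  (StarAlgebra.adjoin ℂ
    ({(TorusProd.U α : TorusProd α), (TorusProd.V α : TorusProd α)} : Set (TorusProd α))
    ).topologicalClosure

/-- The noncommutative torus `𝔸_{2α}`. -/
abbrev NCTorus (α : ℝ) : Type 1 := torusSubalgebra α

instance (α : ℝ) : IsClosed (torusSubalgebra α : Set (TorusProd α)) :=
  StarSubalgebra.isClosed_topologicalClosure _

instance (α : ℝ) : CStarAlgebra (NCTorus α) := StarSubalgebra.cstarAlgebra _

namespace NCTorus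

theorem coe_U_mem (α : ℝ) : (TorusProd.U α : TorusProd α) ∈ torusSubalgebra α :=
  StarSubalgebra.le_topologicalClosure _ (StarAlgebra.subset_adjoin ℂ _ (by simp))

theorem coe_V_mem (α : ℝ) : (TorusProd.V α : TorusProd α) ∈ torusSubalgebra α :=
  StarSubalgebra.le_topologicalClosure _ (StarAlgebra.subset_adjoin ℂ _ (by simp))

/-- The generator `U` of `𝔸_{2α}`. -/
def U (α : ℝ) : unitary (NCTorus α) :=
  ⟨⟨(TorusProd.U α : TorusProd α), coe_U_mem α⟩, by
    rw [Unitary.mem_iff]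
    exact ⟨Subtype.ext (Unitary.coe_star_mul_self (TorusProd.U α)),
      Subtype.ext (Unitary.coe_mul_star_self (TorusProd.U α))⟩⟩

/-- The generator `V` of `𝔸_{2α}`. -/
def V (α : ℝ) : unitary (NCTorus α) :=
  ⟨⟨(TorusProd.V α : TorusProd α), coe_V_mem α⟩, by
    rw [Unitary.mem_iff]
    exact ⟨Subtype.ext (Unitary.coe_star_mul_self (TorusProd.V α)),
      Subtype.ext (Unitary.coe_mul_star_self (TorusProd.V α))⟩⟩

/-- The component of `a ∈ 𝔸_{2α}` in the representation `ρ`, i.e. `ρ(a)`. -/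
def evalRep {α : ℝ} (ρ : TorusRep α) : NCTorus α →⋆ₐ[ℂ] ρ.carrier where
  toFun a := (a : TorusProd α) ρ
  map_one' := rfl
  map_mul' _ _ := rfl
  map_zero' := rfl
  map_add' _ _ := rfl
  commutes' _ := rfl
  map_star' _ := rfl

theorem U_mul_V (α : ℝ) : (U α : NCTorus α) * (V α : NCTorus α) =
    Complex.exp (4 * Real.pi * Complex.I * α) • ((V α : NCTorus α) * (U α : NCTorus α)) := by
  apply Subtype.ext
  ext ρ
  exact ρ.comm

/-- Universal property, existence. -/
theorem exists_lift {α : ℝ} {B : Type} [CStarAlgebra B] (u v : unitary B)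
    (huv : (u : B) * (v : B) = Complex.exp (4 * Real.pi * Complex.I * α) • ((v : B) * (u : B))) :
    ∃ φ : NCTorus α →⋆ₐ[ℂ] B, φ (U α) = u ∧ φ (V α) = v := by
  rcases subsingleton_or_nontrivial B with hB | hB
  · exact ⟨{ toFun := fun _ => 0, map_one' := Subsingleton.elim _ _,
             map_mul' := fun _ _ => Subsingleton.elim _ _, map_zero' := rfl,
             map_add' := fun _ _ => Subsingleton.elim _ _,
             commutes' := fun _ => Subsingleton.elim _ _,
             map_star' := fun _ => Subsingleton.elim _ _ },
      Subsingleton.elim _ _, Subsingleton.elim _ _⟩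
  · exact ⟨evalRep ⟨B, u, v, huv⟩, rfl, rfl⟩

/-- Universal property, uniqueness. -/
theorem lift_unique {α : ℝ} {B : Type} [CStarAlgebra B] (φ ψ : NCTorus α →⋆ₐ[ℂ] B)
    (hU : φ (U α) = ψ (U α)) (hV : φ (V α) = ψ (V α)) : φ = ψ := by
  have hφ : Continuous φ :=
    (NonUnitalStarAlgHom.instContinuousLinearMapClassComplex (A := NCTorus α) (B := B)
      (F := NCTorus α →⋆ₐ[ℂ] B)).map_continuous φ
  have hψ : Continuous ψ :=
    (NonUnitalStarAlgHom.instContinuousLinearMapClassComplex (A := NCTorus α) (B := B)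
      (F := NCTorus α →⋆ₐ[ℂ] B)).map_continuous ψ
  refine StarAlgHom.ext_topologicalClosure hφ hψ ?_
  refine StarAlgHom.ext_adjoin ?_
  rintro ⟨x, hx⟩ (rfl | rfl)
  · exact hU
  · exact hV

/-- The Weyl elements `W(m, n) = e^{-2πiαmn} U^m V^n`. -/
def weyl (α : ℝ) (a : ℤ × ℤ) : NCTorus α :=
  Complex.exp (-2 * Real.pi * Complex.I * α * a.1 * a.2) •
    (((U α ^ a.1 : unitary (NCTorus α)) : NCTorus α) *
      ((V α ^ a.2 : unitary (NCTorus α)) : NCTorus α))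

/-! ### The canonical trace -/

/-- The Hilbert space `ℓ²(ℤ²)`. -/
abbrev RegSpace : Type := lp (fun _ : ℤ × ℤ => ℂ) 2

/-- The isometry `(S ξ)(b) = c(b) ξ(σ b)` of `ℓ²(ℤ²)`, for a permutation `σ` of `ℤ²` and a
function `c` on `ℤ²` with values in the unit circle. -/
def weightedShift (σ : Equiv.Perm (ℤ × ℤ)) (c : ℤ × ℤ → Circle) : RegSpace ≃ₗᵢ[ℂ] RegSpace := by
  have key : ∀ (σ : Equiv.Perm (ℤ × ℤ)) (c : ℤ × ℤ → Circle) (ξ : RegSpace),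
      Memℓp (fun b => (c b : ℂ) * ξ (σ b)) 2 := by
    intro σ c ξ
    have h := (memℓp_gen_iff (by norm_num)).1 (lp.memℓp ξ)
    refine (memℓp_gen_iff (by norm_num)).2 ?_
    have h2 := (Equiv.summable_iff σ).2 h
    simpa [Function.comp_def, Circle.norm_coe] using h2
  refine
    { toFun := fun ξ => ⟨fun b => (c b : ℂ) * ξ (σ b), key σ c ξ⟩
      invFun := fun ξ => ⟨fun b => ((c (σ.symm b))⁻¹ : Circle) * ξ (σ.symm b),
        key σ.symm (fun b => (c (σ.symm b))⁻¹) ξ⟩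
      map_add' := ?_
      map_smul' := ?_
      left_inv := ?_
      right_inv := ?_
      norm_map' := ?_ }
  · intro ξ η
    ext b
    exact mul_add _ _ _
  · intro r ξ
    ext b
    exact mul_left_comm _ _ _
  · intro ξ
    ext b
    simp
  · intro ξ
    ext b
    simp
  · intro ξ
    rw [lp.norm_eq_tsum_rpow (by norm_num), lp.norm_eq_tsum_rpow (by norm_num)]
    congr 1
    simpa [Circle.norm_coe] using Equiv.tsum_eq σ (fun b => ‖ξ b‖ ^ (2 : ℝ≥0∞).toReal)

instance : Nontrivial RegSpace :=
  ⟨lp.single 2 (0 : ℤ × ℤ) (1 : ℂ), 0, fun h => by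
    have := congrArg (fun ξ : RegSpace => ξ 0) h
    simp at this⟩

/-- The unitary `(u ξ)(p, q) = ξ(p - 1, q)` of `ℓ²(ℤ²)`. -/
def regU : unitary (RegSpace →L[ℂ] RegSpace) :=
  Unitary.linearIsometryEquiv.symm (weightedShift
    ((Equiv.subRight (1 : ℤ)).prodCongr (Equiv.refl ℤ)) 1)

/-- The unitary `(v ξ)(p, q) = e^{-4πiαp} ξ(p, q - 1)` of `ℓ²(ℤ²)`. -/
def regV (α : ℝ) : unitary (RegSpace →L[ℂ] RegSpace) :=
  Unitary.linearIsometryEquiv.symm (weightedShift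
    ((Equiv.refl ℤ).prodCongr (Equiv.subRight (1 : ℤ)))
      (fun b => Circle.exp (-4 * Real.pi * α * b.1)))

theorem regU_apply (ξ : RegSpace) (p q : ℤ) :
    (regU : RegSpace →L[ℂ] RegSpace) ξ (p, q) = ξ (p - 1, q) :=
  one_mul _

theorem regV_apply (α : ℝ) (ξ : RegSpace) (p q : ℤ) :
    (regV α : RegSpace →L[ℂ] RegSpace) ξ (p, q) =
      Complex.exp (-4 * Real.pi * α * p * Complex.I) * ξ (p, q - 1) := by
  change ((Circle.exp (-4 * Real.pi * α * p) : Circle) : ℂ) * ξ (p, q - 1) = _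
  rw [Circle.coe_exp]
  push_cast
  rfl

/-- The representation of the relations on `ℓ²(ℤ²)` by `regU` and `regV α`. -/
def regRep (α : ℝ) : TorusRep α where
  carrier := RegSpace →L[ℂ] RegSpace
  u := regU
  v := regV α
  comm := by
    ext ξ b
    obtain ⟨p, q⟩ := b
    change (regU : RegSpace →L[ℂ] RegSpace) ((regV α : RegSpace →L[ℂ] RegSpace) ξ) (p, q) =
      Complex.exp (4 * Real.pi * Complex.I * α) *
        (regV α : RegSpace →L[ℂ] RegSpace) ((regU : RegSpace →L[ℂ] RegSpace) ξ) (p, q)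
    rw [regU_apply, regV_apply, regV_apply, regU_apply, ← mul_assoc, ← Complex.exp_add]
    congr 2
    push_cast
    ring

/-- The canonical trace of `𝔸_{2α}`, as the vector state of `δ_0` in `regRep α`. It is determined
by `τ(W(a)) = δ_{a,0}`, see `trace_weyl`; for irrational `α` it is the unique tracial state. -/
def trace {α : ℝ} (a : NCTorus α) : ℂ :=
  let T : RegSpace →L[ℂ] RegSpace := evalRep (regRep α) a
  T (lp.single 2 (0 : ℤ × ℤ) (1 : ℂ)) 0

theorem regU_zpow_apply (ξ : RegSpace) (m p q : ℤ) :
    ((regU ^ m : unitary (RegSpace →L[ℂ] RegSpace)) : RegSpace →L[ℂ] RegSpace) ξ (p, q) =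
      ξ (p - m, q) := by
  have h1 : ∀ (n : ℕ) (ξ : RegSpace) (p : ℤ),
      ((regU ^ n : unitary (RegSpace →L[ℂ] RegSpace)) : RegSpace →L[ℂ] RegSpace) ξ (p, q) =
        ξ (p - n, q) := by
    intro n
    induction n with
    | zero => intro ξ p; simp
    | succ n ih =>
      intro ξ p
      rw [pow_succ]
      change ((regU ^ n : unitary (RegSpace →L[ℂ] RegSpace)) : RegSpace →L[ℂ] RegSpace)
        ((regU : RegSpace →L[ℂ] RegSpace) ξ) (p, q) = _
      rw [ih, regU_apply]
      push_cast
      ring_nf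
  obtain ⟨n, rfl | rfl⟩ := m.eq_nat_or_neg
  · simpa using h1 n ξ p
  · have h2 := h1 n (((regU ^ (-(n : ℤ)) : unitary (RegSpace →L[ℂ] RegSpace)) :
      RegSpace →L[ℂ] RegSpace) ξ) (p + n)
    have h3 : (regU ^ n : unitary (RegSpace →L[ℂ] RegSpace)) * regU ^ (-(n : ℤ)) = 1 := by
      simp
    have h4 : ((regU ^ n : unitary (RegSpace →L[ℂ] RegSpace)) : RegSpace →L[ℂ] RegSpace)
      (((regU ^ (-(n : ℤ)) : unitary (RegSpace →L[ℂ] RegSpace)) :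
      RegSpace →L[ℂ] RegSpace) ξ) = ξ :=
      congrArg (fun w : unitary (RegSpace →L[ℂ] RegSpace) => (w : RegSpace →L[ℂ] RegSpace) ξ) h3
    rw [h4] at h2
    rw [sub_neg_eq_add, h2, add_sub_cancel_right]

theorem regV_zpow_apply (α : ℝ) (ξ : RegSpace) (m p q : ℤ) :
    ((regV α ^ m : unitary (RegSpace →L[ℂ] RegSpace)) : RegSpace →L[ℂ] RegSpace) ξ (p, q) =
      Complex.exp (-4 * Real.pi * α * p * m * Complex.I) * ξ (p, q - m) := by
  have h1 : ∀ (n : ℕ) (ξ : RegSpace) (q : ℤ),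
      ((regV α ^ n : unitary (RegSpace →L[ℂ] RegSpace)) : RegSpace →L[ℂ] RegSpace) ξ (p, q) =
        Complex.exp (-4 * Real.pi * α * p * n * Complex.I) * ξ (p, q - n) := by
    intro n
    induction n with
    | zero => intro ξ p; simp
    | succ n ih =>
      intro ξ q
      rw [pow_succ]
      change ((regV α ^ n : unitary (RegSpace →L[ℂ] RegSpace)) : RegSpace →L[ℂ] RegSpace)
        ((regV α : RegSpace →L[ℂ] RegSpace) ξ) (p, q) = _
      rw [ih, regV_apply, ← mul_assoc, ← Complex.exp_add]
      push_cast
      ring_nf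
  obtain ⟨n, rfl | rfl⟩ := m.eq_nat_or_neg
  · simpa using h1 n ξ q
  · have h2 := h1 n (((regV α ^ (-(n : ℤ)) : unitary (RegSpace →L[ℂ] RegSpace)) :
      RegSpace →L[ℂ] RegSpace) ξ) (q + n)
    have h3 : (regV α ^ n : unitary (RegSpace →L[ℂ] RegSpace)) * regV α ^ (-(n : ℤ)) = 1 := by
      simp
    have h4 : ((regV α ^ n : unitary (RegSpace →L[ℂ] RegSpace)) : RegSpace →L[ℂ] RegSpace)
      (((regV α ^ (-(n : ℤ)) : unitary (RegSpace →L[ℂ] RegSpace)) :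
      RegSpace →L[ℂ] RegSpace) ξ) = ξ :=
      congrArg (fun w : unitary (RegSpace →L[ℂ] RegSpace) => (w : RegSpace →L[ℂ] RegSpace) ξ) h3
    rw [h4, add_sub_cancel_right] at h2
    rw [sub_neg_eq_add, h2, ← mul_assoc, ← Complex.exp_add]
    push_cast
    ring_nf
    simp

theorem trace_weyl (α : ℝ) (a : ℤ × ℤ) : trace (weyl α a) = if a = 0 then 1 else 0 := by
  obtain ⟨m, n⟩ := a
  let φ : NCTorus α →⋆* (regRep α).carrier :=
    { evalRep (regRep α) with }
  have hz : ∀ (w : unitary (NCTorus α)) (k : ℤ), evalRep (regRep α) ((w ^ k : unitary _) : NCTorus α)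
      = ((Unitary.map φ w ^ k : unitary _) : (regRep α).carrier) := by
    intro w k
    rw [← map_zpow]
    rfl
  have hU : Unitary.map φ (U α) = (regRep α).u := rfl
  have hV : Unitary.map φ (V α) = (regRep α).v := rfl
  have h : evalRep (regRep α) (weyl α (m, n)) =
      Complex.exp (-2 * Real.pi * Complex.I * α * m * n) •
      (((regRep α).u ^ m : unitary _) * ((regRep α).v ^ n : unitary _) : (regRep α).carrier) := by
    rw [weyl, map_smul, map_mul, hz, hz, hU, hV]
  have h5 : trace (weyl α (m, n)) = Complex.exp (-2 * Real.pi * Complex.I * α * m * n) *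
      ((regU ^ m : unitary (RegSpace →L[ℂ] RegSpace)) : RegSpace →L[ℂ] RegSpace)
      (((regV α ^ n : unitary (RegSpace →L[ℂ] RegSpace)) : RegSpace →L[ℂ] RegSpace)
        (lp.single 2 (0 : ℤ × ℤ) (1 : ℂ))) (0, 0) :=
    congrArg (fun T : RegSpace →L[ℂ] RegSpace => T (lp.single 2 (0 : ℤ × ℤ) (1 : ℂ)) (0, 0)) h
  rw [h5, regU_zpow_apply, regV_zpow_apply]
  by_cases hm : m = 0
  · subst hm
    by_cases hn : n = 0
    · subst hn
      simp only [Int.cast_zero, mul_zero, zero_mul, Complex.exp_zero, one_mul, sub_zero]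
      rw [if_pos (by rfl)]
      exact lp.single_apply_self (E := fun _ : ℤ × ℤ => ℂ) 2 0 1
    · simp [hn, lp.single_apply]
  · simp [hm, lp.single_apply]

/-- The Fourier coefficients `f(m, n) = τ(W(-m, -n) A)` of `A = W(f) ∈ 𝔸_{2α}`. -/
def coeff {α : ℝ} (A : NCTorus α) (m n : ℤ) : ℂ := trace (weyl α (-m, -n) * A)

end NCTorus

/-! ## Functions and maps on the circle -/

/-- The rotation `R_β` of the circle by the angle `2πβ`. -/
def circleRot (β : ℝ) (z : Circle) : Circle := Circle.exp (2 * Real.pi * β) * z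

/-- A self-map of the circle preserves the orientation if it has a continuous strictly increasing
lift to the universal cover `θ ↦ e^{iθ}`. -/
def OrientationPreserving (f : Circle → Circle) : Prop :=
  ∃ F : ℝ → ℝ, Continuous F ∧ StrictMono F ∧ ∀ θ : ℝ, f (Circle.exp θ) = Circle.exp (F θ)

/-- `g` is of class `C¹` on the circle, as a function of the angle. -/
def CircleC1 (g : Circle → ℂ) : Prop := ContDiff ℝ 1 fun θ : ℝ => g (Circle.exp θ)

/-- The derivative `D = d/dz = (iz)⁻¹ d/dθ` on the circle, `z = e^{iθ}`. -/
def circleD (g : Circle → ℂ) (z : Circle) : ℂ :=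
  (Complex.I * z)⁻¹ * deriv (fun θ : ℝ => g (Circle.exp θ)) (Complex.arg z)

/-- `g` is the Fourier anti-transform `∑_m c(m) z^m` of the sequence `c`, in the sense of Fourier
series of continuous functions: `g` is the (unique) continuous function on the circle with
`∫ g(z) z^{-m} dθ/2π = c(m)` for all `m`. -/
def IsAntitransform (c : ℤ → ℂ) (g : Circle → ℂ) : Prop :=
  Continuous g ∧ ∀ m : ℤ, (2 * Real.pi : ℂ)⁻¹ *
    ∫ θ in (0 : ℝ)..(2 * Real.pi), g (Circle.exp θ) * (((Circle.exp θ) ^ (-m) : Circle) : ℂ) = c m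

/-! ## The smooth algebra -/

/-- The function `g ∘ R^{-n} ∘ h⁻¹`, where `R = R_α`. -/
def straighten (α : ℝ) (h : Circle ≃ₜ Circle) (n : ℤ) (g : Circle → ℂ) : Circle → ℂ :=
  fun z => g (circleRot (-((n : ℝ) * α)) (h.symm z))

/-- The seminorm `ρ_{k,l}`, for the sequence `g_n` of the Fourier anti-transforms of `f(·, n)`:
`ρ_{k,l}(W(f)) = sup_n (|n| + 1)^k ‖D^l (g_n ∘ R^{-n} ∘ h⁻¹)‖_∞`, with values in `[0, ∞]`. -/
def seminormRho (α : ℝ) (h : Circle ≃ₜ Circle) (k l : ℕ) (g : ℤ → Circle → ℂ) : ℝ≥0∞ :=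
  ⨆ n : ℤ, ((n.natAbs : ℝ≥0∞) + 1) ^ k * ⨆ z : Circle, ‖circleD^[l] (straighten α h n (g n)) z‖ₑ

/-- The set `𝔸ᵒ_{2α}`, for the homeomorphism `h` of the circle. -/
def smoothPart (α : ℝ) (h : Circle ≃ₜ Circle) : Set (NCTorus α) :=
  {A | ∃ g : ℤ → Circle → ℂ,
    (∀ n, IsAntitransform (fun m => NCTorus.coeff A m n) (g n)) ∧
    (∀ n, CircleC1 (straighten α h n (g n))) ∧
    ∀ k l : ℕ, l ≤ 1 → seminormRho α h k l g < ⊤}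

end

open scoped ENNReal Manifold ContDiff

/-! ## Circle diffeomorphisms: growth of the derivatives of the iterates -/

/-! An element of the torus lies in `smoothPart` exactly when its Fourier coefficients are those of
a series `∑ (b n ∘ h)(U) V ^ n`, where the `b n` are `C¹` and both the `b n` and their derivatives
decrease rapidly (`mem_smoothPart_iff`). Since `V a(U) = (a ∘ R_{-2α})(U) V`, products and adjoints
become, in terms of `b`, a convolution and an involution twisted by the maps `h ∘ R_{2α}^{-k} ∘
h⁻¹`, that is by the iterates `f^{-k}`. Although `h` is only a homeomorphism, the twisting maps are
smooth. The price of differentiating a product is the chain rule factor `(f^{-k})'`, and rapidly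
decreasing sequences absorb it as soon as it grows at most polynomially in `|k|`.

That growth bound is the dynamical core (`CircleFlow.exists_polynomial_bound`). The order of an
orbit is that of the rotation, so suitable intervals have disjoint translates, and the Lipschitz
bound on `log (F 1)'` controls distortion along them. Let `q` be a best approximation denominator
and let `y i` be the orbit under `F q - p`. Neighbouring gaps are comparable (Denjoy), and the gaps,
normalized by a window between two orbit points of the previous scale, satisfy `u (i+2) * u i ≤ exp
(C₁ * u (i+1)) * u (i+1) ^ 2`. This discrete form of `(log u)'' ≤ C₁ u` forces at most quadratic
growth (`seq_growth`), so `(F (b q))'` is at most `C' b²` as long as `q` remains best up to `b q`.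
Writing `n = b q + r` with `r < q` and inducting on `r` gives a power of `n`.

Weighted `ℓ¹` norms are submultiplicative for the twisted convolution, and the derivative of an
`r`-th power has norm at most `r M ^ r` with `M` independent of `r`; the Taylor series of an entire
function therefore converges in every such norm (`IsTempered.entire`). For density, `V` is smooth,
and `U` is a limit of elements `(p ∘ h)(U)` with trigonometric polynomials `p`. -/

/-- The iterates `F n`, `n ∈ ℤ`, of a lift of an orientation preserving circle diffeomorphism with
rotation number `τ`, such that `log (F 1)'` is Lipschitz with constant `C`. -/
structure CircleFlow (τ C : ℝ) where
  F : ℤ → ℝ → ℝ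
  φ : ℝ → ℝ
  map_zero : ∀ x, F 0 x = x
  map_add : ∀ m n x, F (m + n) x = F m (F n x)
  map_add_int : ∀ n x (s : ℤ), F n (x + s) = F n x + s
  strictMono : ∀ n, StrictMono (F n)
  lt_of_pos : ∀ (n s : ℤ) x, 0 < n * τ + s → x < F n x + s
  hasDerivAt : ∀ x, HasDerivAt (F 1) (Real.exp (φ x)) x
  lip : ∀ x y, |φ x - φ y| ≤ C * |x - y|

namespace CircleFlow

variable {τ C : ℝ} (Φ : CircleFlow τ C)

theorem nonneg_const (Φ : CircleFlow τ C) : 0 ≤ C := by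
  have := (abs_nonneg _).trans (Φ.lip 1 0)
  simpa using this

/-- The flow conjugated by `x ↦ -x`. -/
def reflect : CircleFlow (-τ) C where
  F n x := -Φ.F n (-x)
  φ x := Φ.φ (-x)
  map_zero x := by simp [Φ.map_zero]
  map_add m n x := by simp [Φ.map_add]
  map_add_int n x s := by
    have h := Φ.map_add_int n (-x) (-s)
    push_cast at h
    rw [neg_add, h]; ring
  strictMono n x y hxy := neg_lt_neg (Φ.strictMono n (neg_lt_neg hxy))
  lt_of_pos n s x h := by
    have h1 := Φ.lt_of_pos (-n) (s) (Φ.F n (-x)) (by push_cast; linarith)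
    rw [← Φ.map_add] at h1
    simp only [neg_add_cancel, Φ.map_zero] at h1
    linarith
  hasDerivAt x := by
    have h : HasDerivAt (fun x => -Φ.F 1 (-x)) (-(Real.exp (Φ.φ (-x)) * -1)) x :=
      ((Φ.hasDerivAt (-x)).comp x (hasDerivAt_neg x)).neg
    simpa only [mul_neg, mul_one, neg_neg] using h
  lip x y := by
    have h := Φ.lip (-x) (-y)
    rwa [neg_sub_neg, abs_sub_comm y x] at h

/-- Applying `lt_of_pos` at the point `F n x` compares any two orbit points: they are ordered on the
line as the numbers `n τ + s`. -/
theorem orb_lt {n s n' s' : ℤ} (x : ℝ) (h : n * τ + s < n' * τ + s') :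
    Φ.F n x + s < Φ.F n' x + s' := by
  have h1 := Φ.lt_of_pos (n' - n) (s' - s) (Φ.F n x) (by push_cast; linarith)
  rw [← Φ.map_add, sub_add_cancel] at h1
  push_cast at h1
  linarith

theorem strictMono_comb {τ : ℝ} (hτ : Irrational τ) {n s n' s' : ℤ}
    (h : n * τ + s = n' * τ + s') : n = n' ∧ s = s' := by
  have hn : n = n' := by
    by_contra hne
    have h0 : ((n - n' : ℤ) : ℝ) ≠ 0 := by exact_mod_cast sub_ne_zero.2 hne
    apply hτ
    refine ⟨((s' - s : ℤ) : ℚ) / ((n - n' : ℤ) : ℚ), ?_⟩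
    push_cast at h0 ⊢
    rw [div_eq_iff h0]
    linarith
  subst hn
  exact ⟨rfl, by exact_mod_cast add_left_cancel h⟩

theorem orb_le (hτ : Irrational τ) {n s n' s' : ℤ} (x : ℝ) (h : n * τ + s ≤ n' * τ + s') :
    Φ.F n x + s ≤ Φ.F n' x + s' := by
  rcases h.lt_or_eq with h | h
  · exact (Φ.orb_lt x h).le
  · obtain ⟨rfl, rfl⟩ := strictMono_comb hτ h
    rfl

theorem lt_of_orb_lt (hτ : Irrational τ) {n s n' s' : ℤ} (x : ℝ)
    (h : Φ.F n x + s < Φ.F n' x + s') : n * τ + s < n' * τ + s' := by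
  by_contra h'
  exact absurd h (not_lt.2 (Φ.orb_le hτ x (not_lt.1 h')))

/-- Intervals with pairwise disjoint translates have total length at most one. -/
theorem sum_length_le_one (hτ : Irrational τ) (x : ℝ) (N : ℕ) (m s : ℤ)
    (h0 : 0 < m * τ + s) (h1 : m * τ + s ≤ 1)
    (h : ∀ r : ℕ, 1 ≤ r → r < N → ∀ k : ℤ, m * τ + s ≤ |r * τ + k|) :
    ∑ i ∈ Finset.range N, (Φ.F (m + i) x + s - Φ.F i x) ≤ 1 := by
  -- The integer `k i` moves the left endpoint of the `i`-th interval into `[x, x + 1)`. All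
  -- translated intervals will lie in `(x, x + 1]` and be disjoint, so measure gives the bound.
  let k : ℕ → ℤ := fun i => -⌊Φ.F i x - x⌋
  let a : ℕ → ℝ := fun i => Φ.F i x + k i
  let b : ℕ → ℝ := fun i => Φ.F (m + i) x + ((s + k i : ℤ) : ℝ)
  have ha0 : ∀ i, x ≤ a i := fun i => by
    have := Int.floor_le (Φ.F i x - x)
    simp only [a, k]; push_cast; linarith
  have ha1 : ∀ i, a i < x + 1 := fun i => by
    have := Int.lt_floor_add_one (Φ.F i x - x)
    simp only [a, k]; push_cast; linarith
  have hb1 : ∀ i < N, b i ≤ x + 1 := by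
    intro i hi
    have key : ((m + i : ℤ) : ℝ) * τ + ((s + k i : ℤ) : ℝ) ≤ ((0 : ℤ) : ℝ) * τ + ((1 : ℤ) : ℝ) := by
      rcases Nat.eq_zero_or_pos i with rfl | hi0
      · have : k 0 = 0 := by simp [k, Φ.map_zero]
        rw [this]; push_cast; linarith
      · have h2 := Φ.lt_of_orb_lt hτ x (n := i) (s := k i) (n' := 0) (s' := 1)
          (by rw [Φ.map_zero]; push_cast; exact ha1 i)
        -- The left endpoint lies strictly below `x + 1`, so `i τ + k i - 1` is negative; the
        -- separation hypothesis then leaves room for a full step `m τ + s` before `x + 1`.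
        have h3 := h i hi0 hi (k i - 1)
        push_cast at h2 h3 ⊢
        rw [abs_of_nonpos (by linarith)] at h3
        linarith
    have := Φ.orb_le hτ x key
    rw [Φ.map_zero] at this
    simpa [b] using this
  have hdisj : ∀ i < N, ∀ j < N, i < j → Disjoint (Set.Ioc (a i) (b i)) (Set.Ioc (a j) (b j)) := by
    intro i _ j hj hij
    have h3 := h (j - i) (by omega) (by omega) (k j - k i)
    have hc : ((j - i : ℕ) : ℝ) = (j : ℝ) - i := by rw [Nat.cast_sub hij.le]
    rw [hc] at h3
    push_cast at h3
    rcases le_total 0 (((j : ℝ) - i) * τ + (k j - k i)) with hp | hp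
    · rw [abs_of_nonneg hp] at h3
      have : b i ≤ a j := Φ.orb_le hτ x (by push_cast; linarith)
      exact Set.disjoint_left.2 fun y hy hy' => absurd hy'.1 (not_lt.2 (hy.2.trans this))
    · rw [abs_of_nonpos hp] at h3
      have : b j ≤ a i := Φ.orb_le hτ x (by push_cast; linarith)
      exact Set.disjoint_left.2 fun y hy hy' => absurd hy.1 (not_lt.2 (hy'.2.trans this))
  have hab : ∀ i, a i ≤ b i := fun i => Φ.orb_le hτ x (by push_cast; linarith)
  have hvol : MeasureTheory.volume (⋃ i ∈ Finset.range N, Set.Ioc (a i) (b i)) =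
      ∑ i ∈ Finset.range N, MeasureTheory.volume (Set.Ioc (a i) (b i)) := by
    apply MeasureTheory.measure_biUnion_finset
    · intro i hi j hj hij
      have hi' := Finset.mem_range.1 hi
      have hj' := Finset.mem_range.1 hj
      rcases lt_or_gt_of_ne hij with hlt | hlt
      · exact hdisj i hi' j hj' hlt
      · exact (hdisj j hj' i hi' hlt).symm
    · exact fun _ _ => measurableSet_Ioc
  have hle : MeasureTheory.volume (⋃ i ∈ Finset.range N, Set.Ioc (a i) (b i)) ≤
      MeasureTheory.volume (Set.Ioc x (x + 1)) := by
    apply MeasureTheory.measure_mono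
    refine Set.iUnion₂_subset fun i hi => Set.Ioc_subset_Ioc (ha0 i) (hb1 i (Finset.mem_range.1 hi))
  rw [hvol] at hle
  simp only [Real.volume_Ioc, add_sub_cancel_left, ENNReal.ofReal_one] at hle
  rw [← ENNReal.ofReal_sum_of_nonneg (fun i _ => sub_nonneg.2 (hab i)),
    ENNReal.ofReal_le_one] at hle
  refine le_of_eq_of_le (Finset.sum_congr rfl fun i _ => ?_) hle
  simp only [a, b]
  push_cast
  ring

/-! ### Distortion -/

/-- The logarithmic derivative cocycle `log (F n)'`. -/
def logDeriv (n : ℕ) (x : ℝ) : ℝ := ∑ i ∈ Finset.range n, Φ.φ (Φ.F i x)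

theorem hasDerivAt_natCast (n : ℕ) (x : ℝ) :
    HasDerivAt (Φ.F n) (Real.exp (Φ.logDeriv n x)) x := by
  induction n with
  | zero =>
    have : Φ.F ((0 : ℕ) : ℤ) = id := funext fun y => Φ.map_zero y
    rw [this]
    simpa [logDeriv] using hasDerivAt_id x
  | succ n ih =>
    have : Φ.F ((n + 1 : ℕ) : ℤ) = Φ.F 1 ∘ Φ.F n := funext fun y => by
      rw [Function.comp_apply, ← Φ.map_add]; push_cast; rw [add_comm]
    rw [this, logDeriv, Finset.sum_range_succ, add_comm, Real.exp_add]
    exact (Φ.hasDerivAt _).comp x ih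

theorem logDeriv_add (m n : ℕ) (x : ℝ) :
    Φ.logDeriv (m + n) x = Φ.logDeriv m x + Φ.logDeriv n (Φ.F m x) := by
  rw [logDeriv, Finset.sum_range_add]
  congr 1
  refine Finset.sum_congr rfl fun i _ => ?_
  rw [← Φ.map_add]
  push_cast
  rw [add_comm]

/-- The Lipschitz bound on `φ` is summed along the orbit: the `i`-th terms differ by at most `C`
times the length of the `i`-th image of `[A, D]`. -/
theorem logDeriv_sub_le {n : ℕ} {A D M ξ η : ℝ} (hξ : ξ ∈ Set.Icc A D) (hη : η ∈ Set.Icc A D)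
    (h : ∑ i ∈ Finset.range n, (Φ.F i D - Φ.F i A) ≤ M) :
    Φ.logDeriv n ξ - Φ.logDeriv n η ≤ C * M := by
  have hC := Φ.nonneg_const
  rw [logDeriv, logDeriv, ← Finset.sum_sub_distrib]
  calc _ ≤ ∑ i ∈ Finset.range n, C * (Φ.F i D - Φ.F i A) := by
        refine Finset.sum_le_sum fun i _ => ?_
        refine (le_abs_self _).trans ((Φ.lip _ _).trans (mul_le_mul_of_nonneg_left ?_ hC))
        have h1 := (Φ.strictMono i).monotone hξ.1
        have h2 := (Φ.strictMono i).monotone hξ.2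
        have h3 := (Φ.strictMono i).monotone hη.1
        have h4 := (Φ.strictMono i).monotone hη.2
        rw [abs_le]
        constructor <;> linarith
    _ ≤ C * M := by
        rw [← Finset.mul_sum]
        exact mul_le_mul_of_nonneg_left h hC

theorem exists_image_length (n : ℕ) {B B' : ℝ} (h : B < B') :
    ∃ ξ ∈ Set.Icc B B', Φ.F n B' - Φ.F n B = Real.exp (Φ.logDeriv n ξ) * (B' - B) := by
  obtain ⟨ξ, hξ, h1⟩ := exists_hasDerivAt_eq_slope (Φ.F n) (fun x => Real.exp (Φ.logDeriv n x)) h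
    (fun x _ => (Φ.hasDerivAt_natCast n x).continuousAt.continuousWithinAt)
    (fun x _ => Φ.hasDerivAt_natCast n x)
  refine ⟨ξ, Set.Ioo_subset_Icc_self hξ, ?_⟩
  rw [h1, div_mul_cancel₀ _ (sub_pos.2 h).ne']

theorem distortion {n : ℕ} {A D M B B' E E' : ℝ} (hB : B < B') (hE : E < E')
    (h1 : A ≤ B) (h2 : B' ≤ D) (h3 : A ≤ E) (h4 : E' ≤ D)
    (h : ∑ i ∈ Finset.range n, (Φ.F i D - Φ.F i A) ≤ M) :
    (Φ.F n B' - Φ.F n B) * (E' - E) ≤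
      Real.exp (C * M) * ((Φ.F n E' - Φ.F n E) * (B' - B)) := by
  obtain ⟨ξ, hξ, e1⟩ := Φ.exists_image_length n hB
  obtain ⟨η, hη, e2⟩ := Φ.exists_image_length n hE
  have h5 := Φ.logDeriv_sub_le (n := n) (ξ := ξ) (η := η) ⟨h1.trans hξ.1, hξ.2.trans h2⟩
    ⟨h3.trans hη.1, hη.2.trans h4⟩ h
  rw [e1, e2]
  have h6 : Real.exp (Φ.logDeriv n ξ) ≤ Real.exp (C * M) * Real.exp (Φ.logDeriv n η) := by
    rw [← Real.exp_add]
    exact Real.exp_le_exp.2 (by linarith)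
  have h7 : 0 ≤ (B' - B) * (E' - E) := mul_nonneg (sub_pos.2 hB).le (sub_pos.2 hE).le
  nlinarith [mul_le_mul_of_nonneg_right h6 h7]

/-! ### Denjoy's inequality -/

theorem exists_closer {τ δ : ℝ} (hδ : 0 < δ) : ∃ N : ℕ, 1 ≤ N ∧ ∃ M : ℤ, |N * τ - M| < δ := by
  obtain ⟨n, hn⟩ := exists_nat_one_div_lt hδ
  obtain ⟨k, hk, _, h⟩ := Real.exists_nat_abs_mul_sub_round_le τ (Nat.succ_pos n)
  refine ⟨k, hk, round (k * τ), h.trans_lt (lt_of_le_of_lt ?_ hn)⟩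
  push_cast
  apply one_div_le_one_div_of_le <;> linarith [(Nat.cast_nonneg n : (0 : ℝ) ≤ n)]

/-- The length of `F j` of the interval between `x` and `F q x - p`. -/
def len (q : ℕ) (p : ℤ) (x : ℝ) (j : ℕ) : ℝ := Φ.F (q + j) x - p - Φ.F j x

/-- Integrality replaces a covering argument. With `N = q + e`, closing the chain of the first `e`
intervals by the `q` gaps `t j` telescopes to the integer `q M - N p`, which is positive and hence
at least one. Each gap has rotation length below `2 (q τ - p)` and is covered by two further
consecutive intervals; this accounts for the indices from `e` to `e + 2 q = N + q`. -/
theorem len_sum_lower (hτ : Irrational τ) {q N : ℕ} {p M : ℤ} (hq : 1 ≤ q) (hqN : q ≤ N)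
    (hN : |N * τ - M| < q * τ - p) (x : ℝ) :
    1 ≤ ∑ j ∈ Finset.range (N + q), Φ.len q p x j := by
  obtain ⟨e, rfl⟩ := Nat.exists_eq_add_of_le hqN
  push_cast at hN
  obtain ⟨hN1, hN2⟩ := abs_lt.1 hN
  have hfst : ∀ j : ℕ, 0 < Φ.len q p x j := by
    intro j
    have := Φ.orb_lt x (n := j) (s := 0) (n' := q + j) (s' := -p)
      (by push_cast; nlinarith [abs_nonneg ((q + e : ℝ) * τ - M)])
    push_cast at this
    rw [len]; linarith
  let t : ℕ → ℝ := fun j => Φ.F j x - p + M - Φ.F (e + j : ℕ) x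
  have ht : ∀ j, 0 < t j := by
    intro j
    have := Φ.orb_lt x (n := (e + j : ℕ)) (s := 0) (n' := j) (s' := -p + M)
      (by push_cast; linarith)
    push_cast at this
    simp only [t]; push_cast; linarith
  have ht' : ∀ j, t j ≤ Φ.len q p x (e + j) + Φ.len q p x (q + e + j) := by
    intro j
    have := Φ.orb_le hτ x (n := j) (s := -p + M) (n' := (q + (q + e + j) : ℕ)) (s' := -2 * p)
      (by push_cast; linarith)
    have e1 : ((q : ℤ) + ((e + j : ℕ) : ℤ)) = ((q + e + j : ℕ) : ℤ) := by push_cast; ring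
    have e2 : ((q : ℤ) + ((q + e + j : ℕ) : ℤ)) = ((q + (q + e + j) : ℕ) : ℤ) := by push_cast; ring
    simp only [len, t, e1, e2]
    push_cast at this ⊢
    linarith
  have htot : ∑ j ∈ Finset.range e, Φ.len q p x j + ∑ j ∈ Finset.range q, t j =
      ((q * M - (q + e) * p : ℤ) : ℝ) := by
    have h1 := Finset.sum_range_add (fun i : ℕ => Φ.F i x) q e
    have h2 := Finset.sum_range_add (fun i : ℕ => Φ.F i x) e q
    rw [add_comm e q] at h2
    simp only [len, t, Finset.sum_sub_distrib, Finset.sum_add_distrib, Finset.sum_const,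
      Finset.card_range, nsmul_eq_mul]
    push_cast at h1 h2 ⊢
    linarith
  have hpos : 0 < ((q * M - (q + e) * p : ℤ) : ℝ) := by
    rw [← htot]
    exact add_pos_of_nonneg_of_pos (Finset.sum_nonneg fun j _ => (hfst j).le)
      (Finset.sum_pos (fun j _ => ht j) ⟨0, Finset.mem_range.2 hq⟩)
  have hone : (1 : ℝ) ≤ ((q * M - (q + e) * p : ℤ) : ℝ) := by exact_mod_cast (Int.cast_pos.1 hpos)
  have hs : q + e + q = e + q + q := by ring
  rw [hs, Finset.sum_range_add, Finset.sum_range_add]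
  have h3 := Finset.sum_le_sum fun j (_ : j ∈ Finset.range q) => ht' j
  rw [Finset.sum_add_distrib] at h3
  rw [add_comm e q]
  linarith

theorem len_sum_upper (hτ : Irrational τ) {q N : ℕ} {p : ℤ} (h0 : 0 < q * τ - p)
    (h1 : q * τ - p ≤ 1) (h : ∀ r : ℕ, 1 ≤ r → r < N → ∀ k : ℤ, q * τ - p ≤ |r * τ + k|) (x : ℝ) :
    ∑ j ∈ Finset.range N, Φ.len q p x j ≤ 1 := by
  have := Φ.sum_length_le_one hτ x N q (-p) (by push_cast; linarith) (by push_cast; linarith)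
    (fun r hr hr' k => by push_cast; linarith [h r hr hr' k])
  refine le_of_eq_of_le (Finset.sum_congr rfl fun i _ => ?_) this
  rw [len]; push_cast; ring

theorem len_pos {q : ℕ} {p : ℤ} (h0 : 0 < q * τ - p) (x : ℝ) (j : ℕ) : 0 < Φ.len q p x j := by
  have := Φ.orb_lt x (n := j) (s := 0) (n' := q + j) (s' := -p) (by push_cast; linarith)
  push_cast at this
  rw [len]; linarith

theorem len_le_one_of_best {τ : ℝ} {q : ℕ} {p : ℤ}
    (h : ∀ k : ℤ, |q * τ - p| ≤ |q * τ + k|) : |q * τ - p| ≤ 1 := by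
  refine (h (-round (q * τ))).trans ?_
  have := abs_sub_round (q * τ)
  push_cast
  rw [← sub_eq_add_neg]
  linarith

theorem map_sub_int (n : ℤ) (x : ℝ) (s : ℤ) : Φ.F n (x - s) = Φ.F n x - s := by
  have := Φ.map_add_int n x (-s)
  push_cast at this
  rw [sub_eq_add_neg, this]; ring

theorem len_eq (q : ℕ) (p : ℤ) (x : ℝ) (j : ℕ) :
    Φ.len q p x j = Φ.F j (Φ.F q x - p) - Φ.F j x := by
  rw [len, Φ.map_sub_int j, ← Φ.map_add j q, add_comm (q : ℤ) j]

/-- Let `N` be the first time at which an orbit returns closer than `q τ - p`. The first `N + q`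
images of either neighbouring interval have total length between `1` and `2`, so some time exists at
which the images are comparable up to a factor `2`. Bounded distortion on the union, of total length
at most `4`, transfers this back to time `0`; in the proof the comparison is summed over all times.
-/
theorem denjoy_of_pos (hτ : Irrational τ) {q : ℕ} {p : ℤ} (hq : 1 ≤ q) (h0 : 0 < q * τ - p)
    (h : ∀ r : ℕ, 1 ≤ r → r ≤ q → ∀ k : ℤ, |q * τ - p| ≤ |r * τ + k|) (x : ℝ) :
    Φ.len q p (Φ.F q x - p) 0 ≤ 2 * Real.exp (C * 4) * Φ.len q p x 0 ∧
    Φ.len q p x 0 ≤ 2 * Real.exp (C * 4) * Φ.len q p (Φ.F q x - p) 0 := by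
  classical
  have hle1 := len_le_one_of_best (h q hq le_rfl)
  rw [abs_of_pos h0] at hle1 h
  have hex := exists_closer (τ := τ) h0
  obtain ⟨hN1, M, hM⟩ := Nat.find_spec hex
  have hmin := fun r (hr : r < Nat.find hex) => Nat.find_min hex hr
  set N := Nat.find hex
  have hbest : ∀ r : ℕ, 1 ≤ r → r < N → ∀ k : ℤ, q * τ - p ≤ |r * τ + k| := by
    intro r hr hrN k
    by_contra hlt
    exact hmin r hrN ⟨hr, -k, by push_cast; rw [sub_neg_eq_add]; exact not_le.1 hlt⟩
  have hqN : q ≤ N := by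
    by_contra hlt
    have := h N hN1 (by omega) (-M)
    push_cast at this
    rw [← sub_eq_add_neg] at this
    linarith
  -- Only `N` consecutive images are disjoint modulo one; since `q ≤ N`, the `N + q` images split
  -- into two such blocks, whence the bound `2`.
  have hup : ∀ y, ∑ j ∈ Finset.range (N + q), Φ.len q p y j ≤ 2 := by
    intro y
    rw [Finset.sum_range_add]
    have h1 := Φ.len_sum_upper hτ h0 hle1 hbest y
    have h2 := Φ.len_sum_upper (N := q) hτ h0 hle1
      (fun r hr hr' => hbest r hr (hr'.trans_le hqN)) (Φ.F N y)
    have h3 : ∀ j, Φ.len q p (Φ.F N y) j = Φ.len q p y (N + j) := by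
      intro j
      simp only [len, ← Φ.map_add]
      push_cast
      rw [add_comm (N : ℤ) j, add_assoc]
    simp only [h3] at h2
    linarith
  have hlow := fun y => Φ.len_sum_lower hτ hq hqN hM y
  set y := Φ.F q x - p
  have hpx := Φ.len_pos h0 x
  have hpy := Φ.len_pos h0 y
  have ex0 : Φ.len q p x 0 = y - x := by simp [len_eq, Φ.map_zero, y]
  have ey0 : Φ.len q p y 0 = (Φ.F q y - p) - y := by simp [len_eq, Φ.map_zero]
  have hxy : x < y := by linarith [hpx 0]
  have hyz : y < Φ.F q y - p := by linarith [hpy 0]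
  have hwin : ∀ n ≤ N + q,
      ∑ i ∈ Finset.range n, (Φ.F i (Φ.F q y - p) - Φ.F i x) ≤ 4 := by
    intro n hn
    calc _ ≤ ∑ i ∈ Finset.range (N + q), (Φ.F i (Φ.F q y - p) - Φ.F i x) := by
          refine Finset.sum_le_sum_of_subset_of_nonneg (Finset.range_mono hn) fun i _ _ => ?_
          exact sub_nonneg.2 ((Φ.strictMono i).monotone (hxy.le.trans hyz.le))
      _ = ∑ i ∈ Finset.range (N + q), (Φ.len q p x i + Φ.len q p y i) := by
          refine Finset.sum_congr rfl fun i _ => ?_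
          rw [len_eq, len_eq]; ring
      _ ≤ 4 := by
          rw [Finset.sum_add_distrib]
          linarith [hup x, hup y]
  have hE := Real.exp_pos (C * 4)
  constructor
  · have h1 : ∀ j ∈ Finset.range (N + q), Φ.len q p x j * Φ.len q p y 0 ≤
        Real.exp (C * 4) * (Φ.len q p y j * Φ.len q p x 0) := by
      intro j hj
      rw [ex0, ey0, len_eq, len_eq]
      exact Φ.distortion hxy hyz le_rfl hyz.le hxy.le le_rfl (hwin j (Finset.mem_range.1 hj).le)
    have h2 := Finset.sum_le_sum h1
    rw [← Finset.sum_mul, ← Finset.mul_sum, ← Finset.sum_mul] at h2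
    nlinarith [mul_le_mul_of_nonneg_right (hlow x) (hpy 0).le,
      mul_le_mul_of_nonneg_left (mul_le_mul_of_nonneg_right (hup y) (hpx 0).le) hE.le]
  · have h1 : ∀ j ∈ Finset.range (N + q), Φ.len q p y j * Φ.len q p x 0 ≤
        Real.exp (C * 4) * (Φ.len q p x j * Φ.len q p y 0) := by
      intro j hj
      rw [ex0, ey0, len_eq, len_eq]
      exact Φ.distortion hyz hxy hxy.le le_rfl le_rfl hyz.le (hwin j (Finset.mem_range.1 hj).le)
    have h2 := Finset.sum_le_sum h1
    rw [← Finset.sum_mul, ← Finset.mul_sum, ← Finset.sum_mul] at h2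
    nlinarith [mul_le_mul_of_nonneg_right (hlow y) (hpx 0).le,
      mul_le_mul_of_nonneg_left (mul_le_mul_of_nonneg_right (hup x) (hpy 0).le) hE.le]

end CircleFlow

/-! ### Growth of sequences with a discrete bound on the second logarithmic difference -/

/-- If `(log u)'' ≤ C₁ u` and `u` has mass at least `c` to the left of `0`, then the logarithmic
slope `p` of `u` at `0` satisfies `p ^ 2 ≤ D u 0`. -/
theorem seq_slope (C₁ Λ c : ℝ) (hC₁ : 0 ≤ C₁) (hΛ : 0 ≤ Λ) (hc : 0 < c) (a : ℕ) (u r : ℤ → ℝ)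
    (ha : 1 ≤ a) (hu : ∀ i, 0 < u i) (hr : ∀ i, u (i + 1) = u i * Real.exp (r i))
    (hrstep : ∀ i : ℤ, -a ≤ i → i + 2 ≤ a → r (i + 1) ≤ r i + C₁ * u (i + 1))
    (hleft : c ≤ ∑ j ∈ Finset.range (a + 1), u (-j)) (hp0 : 0 < r 0) (hpΛ : r 0 ≤ Λ) :
    r 0 ^ 2 ≤ (2 * C₁ * (2 + Λ) + Λ * (2 + Λ) / c) * u 0 := by
  set p := r 0 with hp
  by_contra hcon
  push Not at hcon
  -- The two summands of the constant are used separately: the first keeps the slope above `p / 2`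
  -- on the way to the left, the second contradicts the lower bound `c` for the mass.
  have hA : 2 * C₁ * (2 + Λ) * u 0 < p ^ 2 := by
    refine lt_of_le_of_lt (mul_le_mul_of_nonneg_right ?_ (hu 0).le) hcon
    have : 0 ≤ Λ * (2 + Λ) / c := by positivity
    linarith
  have hB : Λ * (2 + Λ) * u 0 < c * p ^ 2 := by
    have h1 : Λ * (2 + Λ) / c * u 0 < p ^ 2 := by
      refine lt_of_le_of_lt (mul_le_mul_of_nonneg_right ?_ (hu 0).le) hcon
      have : 0 ≤ 2 * C₁ * (2 + Λ) := by positivity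
      linarith
    rw [div_mul_eq_mul_div, div_lt_iff₀ hc] at h1
    linarith
  let S : ℕ → ℝ := fun k => ∑ j ∈ Finset.range k, u (-j)
  have hexp : (2 + p) * Real.exp (-(p / 2)) ≤ 2 := by
    have h1 := Real.add_one_le_exp (p / 2)
    have h2 : Real.exp (p / 2) * Real.exp (-(p / 2)) = 1 := by
      rw [← Real.exp_add]; simp
    have h3 := mul_le_mul_of_nonneg_right h1 (Real.exp_pos (-(p / 2))).le
    rw [h2] at h3
    linarith
  -- Going left, the slope drops by at most `C₁` times the mass passed. While it stays above `p /
  -- 2`, the sequence decays by the factor `exp (-(p / 2)) ≤ 2 / (2 + p)` per step, and the mass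
  -- passed stays below `(2 + p) / p * u 0`, which by `hA` is too small to lower the slope below `p
  -- / 2`.
  have hinv : ∀ k : ℕ, k ≤ a → p * S k ≤ (2 + p) * (u 0 - u (-k)) ∧ p - C₁ * S k ≤ r (-k) := by
    intro k
    induction k with
    | zero => intro _; simp [S, hp]
    | succ k ih =>
      intro hk
      obtain ⟨h1, h2⟩ := ih (by omega)
      have hSk : S (k + 1) = S k + u (-k) := Finset.sum_range_succ _ _
      have hstep := hrstep (-(k + 1 : ℕ)) (by push_cast; omega) (by push_cast; omega)
      have e : (-((k + 1 : ℕ) : ℤ)) + 1 = -k := by push_cast; ring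
      have h7 := hr (-(k + 1 : ℕ))
      rw [e] at hstep h7
      have huk := hu (-k)
      have huk1 := hu (-(k + 1 : ℕ))
      generalize u (-(k + 1 : ℕ)) = w' at *
      generalize u (-k) = w at *
      generalize r (-(k + 1 : ℕ)) = r' at *
      rw [hSk]
      have hS1 : p * (S k + w) ≤ (2 + p) * u 0 - 2 * w := by linarith
      have h3 : p - C₁ * (S k + w) ≤ r' := by linarith
      refine ⟨?_, h3⟩
      have h4 : p / 2 ≤ r' := by
        refine le_trans ?_ h3
        have h5 : p * (C₁ * (S k + w)) ≤ p * (p / 2) := by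
          have h6 : C₁ * (p * (S k + w)) ≤ C₁ * ((2 + Λ) * u 0) := by
            refine mul_le_mul_of_nonneg_left (hS1.trans ?_) hC₁
            have := mul_le_mul_of_nonneg_right hpΛ (hu 0).le
            linarith
          linarith
        have := le_of_mul_le_mul_left h5 hp0
        linarith
      have h6 : w' ≤ w * Real.exp (-(p / 2)) := by
        rw [h7, mul_assoc, ← Real.exp_add]
        exact le_mul_of_one_le_right huk1.le (Real.one_le_exp (by linarith))
      have h8 : (2 + p) * w' ≤ 2 * w := by
        have h9 := mul_le_mul_of_nonneg_left h6 (by linarith : 0 ≤ 2 + p)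
        have h10 := mul_le_mul_of_nonneg_left hexp huk.le
        linarith
      linarith
  have h1 := (hinv a le_rfl).1
  have h2 : c ≤ S a + u (-a) := by
    have := hleft
    rwa [Finset.sum_range_succ] at this
  have h3 : p * c ≤ (2 + Λ) * u 0 := by
    have h4 := mul_le_mul_of_nonneg_left h2 hp0.le
    have h5 := mul_le_mul_of_nonneg_right hpΛ (hu 0).le
    have h6 := hu (-a)
    linarith
  have h4 := mul_le_mul_of_nonneg_left h3 hΛ
  have h5 := mul_le_mul_of_nonneg_right hpΛ (mul_nonneg hp0.le hc.le)
  linarith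

/-- A positive sequence with `(log u)'' ≤ C u`, which has mass bounded below to the left of `0`,
grows at most quadratically. -/
theorem seq_growth (C₁ Λ c K : ℝ) (hC₁ : 0 ≤ C₁) (hΛ : 0 ≤ Λ) (hc : 0 < c) (hK : 0 ≤ K) :
    ∃ C₂ : ℝ, 0 < C₂ ∧ ∀ (a b : ℕ) (u : ℤ → ℝ), 1 ≤ b → b ≤ a → (∀ i, 0 < u i) →
      (∀ i : ℤ, -a ≤ i → i + 2 ≤ a →
        u (i + 2) * u i ≤ Real.exp (C₁ * u (i + 1)) * u (i + 1) ^ 2) →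
      c ≤ ∑ j ∈ Finset.range (a + 1), u (-j) → (∀ i, u (i + 1) ≤ Real.exp Λ * u i) →
      u b ≤ K → u b ≤ C₂ * b ^ 2 * u 0 := by
  let D := 2 * C₁ * (2 + Λ) + Λ * (2 + Λ) / c
  have hD : 0 ≤ D := by positivity
  let C₆ := Real.exp Λ * (√D + C₁)
  have hC₆ : 0 ≤ C₆ := by positivity
  let C₇ := 1 + C₆
  have hC₇ : 1 ≤ C₇ := by simp only [C₇]; linarith
  refine ⟨4 * C₇ + 16 * K * C₇ ^ 2, by positivity, ?_⟩
  intro a b u hb hba hu hconv hleft hratio hub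
  let r : ℤ → ℝ := fun i => Real.log (u (i + 1)) - Real.log (u i)
  have hr : ∀ i, u (i + 1) = u i * Real.exp (r i) := by
    intro i
    simp only [r]
    rw [Real.exp_sub, Real.exp_log (hu _), Real.exp_log (hu _), mul_div_cancel₀ _ (hu i).ne']
  have hrΛ : ∀ i, r i ≤ Λ := by
    intro i
    have := hratio i
    rw [hr i, mul_comm] at this
    exact Real.exp_le_exp.1 (le_of_mul_le_mul_right this (hu i))
  have hrstep : ∀ i : ℤ, -a ≤ i → i + 2 ≤ a → r (i + 1) ≤ r i + C₁ * u (i + 1) := by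
    intro i h1 h2
    have h := Real.log_le_log (mul_pos (hu _) (hu _)) (hconv i h1 h2)
    rw [Real.log_mul (hu _).ne' (hu _).ne', Real.log_mul (Real.exp_pos _).ne' (pow_pos (hu _) 2).ne',
      Real.log_exp, Real.log_pow] at h
    simp only [r]
    have e : i + 1 + 1 = i + 2 := by ring
    rw [e]
    push_cast at h
    linarith
  set p := r 0 with hp
  set s := √(u 0) with hs
  have hs0 : 0 < s := Real.sqrt_pos.2 (hu 0)
  have hs2 : s ^ 2 = u 0 := Real.sq_sqrt (hu 0).le
  -- The initial slope is at most of order `√(u 0)`, by the lower bound on the mass to the left.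
  have hslope : p ≤ √D * s := by
    rcases le_or_gt p 0 with hp0 | hp0
    · exact hp0.trans (by positivity)
    rw [hs, ← Real.sqrt_mul hD]
    exact Real.le_sqrt_of_sq_le
      (seq_slope C₁ Λ c hC₁ hΛ hc a u r (by omega) hu hr hrstep hleft hp0 (hrΛ 0))
  let S : ℕ → ℝ := fun n => ∑ j ∈ Finset.range n, u j
  have hSs : ∀ n, S (n + 1) = S n + u n := fun n => Finset.sum_range_succ _ _
  have hS0 : ∀ n, 0 ≤ S n := fun n => Finset.sum_nonneg fun j _ => (hu j).le
  have hrS : ∀ i : ℕ, i + 1 ≤ a → r i ≤ p + C₁ * S (i + 1) := by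
    intro i
    induction i with
    | zero =>
      intro _
      have := mul_nonneg hC₁ (hS0 (0 + 1))
      simp only [Nat.cast_zero]
      linarith
    | succ i ih =>
      intro hi
      have h1 := hrstep i (by omega) (by omega)
      have h2 := ih (by omega)
      rw [hSs (i + 1)]
      push_cast
      linarith
  have hstep : ∀ i : ℕ, i + 1 ≤ a → u (i + 1 : ℕ) ≤ u i + C₆ * (s + S (i + 1)) * u i := by
    intro i hi
    push_cast
    rw [hr i]
    have hR : r i ≤ √D * s + C₁ * S (i + 1) := (hrS i hi).trans (by linarith)
    have hR0 : 0 ≤ √D * s + C₁ * S (i + 1) :=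
      add_nonneg (by positivity) (mul_nonneg hC₁ (hS0 _))
    have h1 : Real.exp (r i) - 1 ≤ Real.exp Λ * (√D * s + C₁ * S (i + 1)) := by
      rcases le_or_gt (r i) 0 with h0 | h0
      · have := Real.exp_le_one_iff.2 h0
        have := mul_nonneg (Real.exp_pos Λ).le hR0
        linarith
      · have h2 := Real.add_one_le_exp (-(r i))
        have h3 : Real.exp (r i) * Real.exp (-(r i)) = 1 := by rw [← Real.exp_add]; simp
        have h4 : Real.exp (r i) - 1 ≤ Real.exp (r i) * r i := by
          nlinarith [Real.exp_pos (r i)]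
        exact h4.trans (mul_le_mul (Real.exp_le_exp.2 (hrΛ i)) hR h0.le (Real.exp_pos _).le)
    have h2 : Real.exp Λ * (√D * s + C₁ * S (i + 1)) ≤ C₆ * (s + S (i + 1)) := by
      simp only [C₆]
      have h3 : √D * s + C₁ * S (i + 1) ≤ (√D + C₁) * (s + S (i + 1)) := by
        nlinarith [mul_nonneg (Real.sqrt_nonneg D) (hS0 (i + 1)), mul_nonneg hC₁ hs0.le]
      calc _ ≤ Real.exp Λ * ((√D + C₁) * (s + S (i + 1))) :=
            mul_le_mul_of_nonneg_left h3 (Real.exp_pos _).le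
        _ = _ := by ring
    nlinarith [mul_le_mul_of_nonneg_left (h1.trans h2) (hu i).le]
  -- Summing `hstep` with the increasing factor `s + S n` is a discrete integration. It yields the
  -- Riccati-type inequality `S (n+1) - S n ≤ C₇ (s + S n) ^ 2`, whose solutions stay below `s` for
  -- about `1 / (C₇ s)` steps.
  have hquad : ∀ n : ℕ, n ≤ a → u n ≤ u 0 + C₆ * (s + S n) * S n := by
    intro n
    induction n with
    | zero => intro _; simp [S]
    | succ n ih =>
      intro hn
      have h1 := hstep n hn
      have h2 := ih (by omega)
      have h3 : C₆ * (s + S n) * S n ≤ C₆ * (s + S (n + 1)) * S n := by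
        refine mul_le_mul_of_nonneg_right (mul_le_mul_of_nonneg_left ?_ hC₆) (hS0 n)
        rw [hSs]; linarith [hu n]
      have h4 : C₆ * (s + S (n + 1)) * S (n + 1) =
          C₆ * (s + S (n + 1)) * S n + C₆ * (s + S (n + 1)) * u n := by
        conv_lhs => rw [hSs n, mul_add, ← hSs n]
      linarith
  have hquad' : ∀ n : ℕ, n ≤ a → u n ≤ C₇ * (s + S n) ^ 2 := by
    intro n hn
    refine (hquad n hn).trans ?_
    simp only [C₇]
    rw [← hs2]
    nlinarith [hS0 n, mul_nonneg hs0.le (hS0 n), mul_nonneg hC₆ hs0.le,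
      mul_nonneg (mul_nonneg hC₆ hs0.le) (hS0 n), mul_nonneg hC₆ (sq_nonneg s)]
  have hb1 : (1 : ℝ) ≤ b := by exact_mod_cast hb
  have hb2 : (1 : ℝ) ≤ (b : ℝ) ^ 2 := one_le_pow₀ hb1
  -- For `b` below the Riccati time, `S ≤ s` persists and `u b` is at most a constant times `u 0`.
  -- Beyond that time `b ^ 2 * u 0` is bounded below, so the a priori bound `u b ≤ K` suffices.
  rcases le_or_gt (4 * C₇ * b * s) 1 with hsmall | hlarge
  · have hSk : ∀ k : ℕ, k ≤ b → S k ≤ 4 * k * C₇ * s ^ 2 := by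
      intro k
      induction k with
      | zero => intro _; simp [S]
      | succ k ih =>
        intro hk
        have h1 := ih (by omega)
        have hkb : (k : ℝ) ≤ b := by exact_mod_cast (by omega : k ≤ b)
        have h2 : 4 * k * C₇ * s ^ 2 ≤ s := by
          have h3 : 4 * C₇ * k * s ≤ 4 * C₇ * b * s := by gcongr
          nlinarith
        have h4 := hquad' k (by omega)
        have h5 : (s + S k) ^ 2 ≤ (2 * s) ^ 2 := by
          have := hS0 k
          gcongr; linarith
        rw [hSs]
        push_cast
        nlinarith
    have h1 := hSk b le_rfl
    have h2 : 4 * b * C₇ * s ^ 2 ≤ s := by nlinarith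
    have h3 : (s + S b) ^ 2 ≤ (2 * s) ^ 2 := by
      have := hS0 b
      gcongr; linarith
    have h4 := hquad' b hba
    calc u b ≤ 4 * C₇ * u 0 := by rw [← hs2]; nlinarith
      _ ≤ (4 * C₇ + 16 * K * C₇ ^ 2) * b ^ 2 * u 0 := by
        refine mul_le_mul_of_nonneg_right ?_ (hu 0).le
        have : 0 ≤ 16 * K * C₇ ^ 2 := by positivity
        nlinarith
  · have h1 : 1 ≤ 16 * C₇ ^ 2 * b ^ 2 * u 0 := by
      rw [← hs2]
      nlinarith
    calc u b ≤ K * 1 := by linarith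
      _ ≤ K * (16 * C₇ ^ 2 * b ^ 2 * u 0) := mul_le_mul_of_nonneg_left h1 hK
      _ = 16 * K * C₇ ^ 2 * b ^ 2 * u 0 := by ring
      _ ≤ (4 * C₇ + 16 * K * C₇ ^ 2) * b ^ 2 * u 0 := by
        have h2 : 0 ≤ C₇ := by linarith
        have := hu 0
        gcongr
        linarith

/-! ### Comparison of consecutive scales of best approximation -/

namespace CircleFlow

variable {τ C : ℝ} (Φ : CircleFlow τ C)

/-- Shifting `r τ + k` towards `0` by steps `q τ - p` cannot bring it closer to `0` than one step
while the index stays within `b q`. Hence each of the first `b` steps adds one more multiple to the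
lower bound. On the positive side the only exception, landing exactly at a multiple, is excluded by
irrationality and `r < q`. -/
theorem mul_best_le {τ : ℝ} (hτ : Irrational τ) {q b : ℕ} {p : ℤ} (hq : 1 ≤ q) (hb : 1 ≤ b)
    (h0 : 0 < q * τ - p)
    (h : ∀ r : ℕ, 1 ≤ r → r ≤ b * q → ∀ k : ℤ, q * τ - p ≤ |r * τ + k|)
    (r : ℕ) (k : ℤ) (hr : r < q) (hrk : r ≠ 0 ∨ k ≠ 0) : b * (q * τ - p) ≤ |r * τ + k| := by
  have hy : (r : ℝ) * τ + k ≠ 0 := by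
    intro hy
    have := strictMono_comb hτ (n := r) (s := k) (n' := 0) (s' := 0) (by push_cast; linarith)
    omega
  have hqb : q ≤ b * q := Nat.le_mul_of_pos_left q hb
  have hδ1 : q * τ - p ≤ 1 := by
    have h1 := len_le_one_of_best (τ := τ) (q := q) (p := p)
      (fun k => by rw [abs_of_pos h0]; exact h q hq hqb k)
    rwa [abs_of_pos h0] at h1
  suffices H : ∀ j : ℕ, j ≤ b → j * (q * τ - p) ≤ |r * τ + k| from H b le_rfl
  intro j
  induction j with
  | zero => intro _; simp
  | succ j ih =>
    intro hj
    have ihj := ih (by omega)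
    push_cast
    rcases lt_or_gt_of_ne hy with hneg | hpos
    · rw [abs_of_neg hneg] at ihj ⊢
      rcases Nat.eq_zero_or_pos (r + j * q) with hz | hz
      · have hr0 : r = 0 := by omega
        have hj0 : j = 0 := by
          rcases Nat.eq_zero_or_pos j with h | h
          · exact h
          · have := Nat.mul_pos h hq
            omega
        subst hr0 hj0
        simp only [Nat.cast_zero, zero_mul, zero_add] at hneg ⊢
        have : (k : ℝ) ≤ -1 := by exact_mod_cast Int.le_sub_one_of_lt (Int.cast_lt_zero.1 hneg)
        linarith
      · have h1 : r + j * q ≤ b * q := by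
          have : (j + 1) * q ≤ b * q := Nat.mul_le_mul_right q hj
          have e : (j + 1) * q = j * q + q := by ring
          omega
        have h2 := h (r + j * q) hz h1 (k - j * p)
        push_cast at h2
        have e : ((r : ℝ) + j * q) * τ + (k - j * p) = (r * τ + k) + j * (q * τ - p) := by ring
        rw [e, abs_of_nonpos (by linarith)] at h2
        linarith
    · rw [abs_of_pos hpos] at ihj ⊢
      have h1 : (j + 1) * q ≤ b * q := Nat.mul_le_mul_right q hj
      have e1 : (j + 1) * q = j * q + q := by ring
      have h2 := h ((j + 1) * q - r) (by omega) (by omega) (-k - (j + 1) * p)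
      rw [Nat.cast_sub (by omega)] at h2
      push_cast at h2
      have e : (((j : ℝ) + 1) * q - r) * τ + (-k - (j + 1) * p) =
        (j + 1) * (q * τ - p) - (r * τ + k) := by ring
      rw [e] at h2
      rcases le_abs.1 h2 with h3 | h3
      · have heq : ((j * q : ℤ) : ℝ) * τ + ((-j * p : ℤ) : ℝ) = (r : ℤ) * τ + k := by
          push_cast; linarith
        obtain ⟨h4, h5⟩ := strictMono_comb hτ heq
        have hj0 : j = 0 := by
          rcases Nat.eq_zero_or_pos j with h | h
          · exact h
          · have h6 : j * q = r := by exact_mod_cast h4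
            have := Nat.le_mul_of_pos_left q h
            omega
        subst hj0
        simp at h4 h5
        omega
      · linarith

/-- The next larger scale: a positive element `m τ + s` of `ℤ τ + ℤ` that is not larger than
`|r τ + k|`, `1 ≤ r < q`, with the corresponding form of Denjoy's inequality. -/
theorem exists_previous (hτ : Irrational τ) {q : ℕ} (hq : 1 ≤ q) :
    ∃ m s : ℤ, 0 < m * τ + s ∧ m * τ + s ≤ 1 ∧
      (∀ r : ℕ, 1 ≤ r → r < q → ∀ k : ℤ, m * τ + s ≤ |r * τ + k|) ∧
      (∃ (r : ℕ) (k : ℤ), r < q ∧ (r ≠ 0 ∨ k ≠ 0) ∧ m * τ + s = |r * τ + k|) ∧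
      ∀ x, Φ.F m x + s - x ≤ 2 * Real.exp (C * 4) * (x - (Φ.F (-m) x - s)) := by
  have hC := Φ.nonneg_const
  -- For `q = 1` no index `r` with `1 ≤ r < q` exists, and the unit translation `(m, s) = (0, 1)`
  -- serves as the larger scale.
  rcases hq.eq_or_lt with rfl | hq1
  · refine ⟨0, 1, by simp, by simp, fun r h1 h2 => by omega, ⟨0, 1, by simp, by simp, by simp⟩, ?_⟩
    intro x
    have : 1 ≤ Real.exp (C * 4) := Real.one_le_exp (by positivity)
    simp only [neg_zero, Φ.map_zero]
    push_cast
    linarith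
  obtain ⟨r₀, hr₀, hmin⟩ := Finset.exists_min_image (Finset.Ico 1 q)
    (fun r : ℕ => |(r : ℝ) * τ - round ((r : ℝ) * τ)|) ⟨1, by simp [hq1]⟩
  simp only [Finset.mem_Ico] at hr₀ hmin
  set p₀ := round ((r₀ : ℝ) * τ) with hp₀
  have hbest : ∀ r : ℕ, 1 ≤ r → r < q → ∀ k : ℤ, |(r₀ : ℝ) * τ - p₀| ≤ |r * τ + k| := by
    intro r h1 h2 k
    refine (hmin r ⟨h1, h2⟩).trans ?_
    have := round_le ((r : ℝ) * τ) (-k)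
    push_cast at this
    rwa [sub_neg_eq_add] at this
  have hne : (r₀ : ℝ) * τ - p₀ ≠ 0 := by
    intro h
    have := strictMono_comb hτ (n := r₀) (s := -p₀) (n' := 0) (s' := 0) (by push_cast; linarith)
    omega
  have hle1 := len_le_one_of_best (hbest r₀ hr₀.1 hr₀.2)
  -- A best approximation from below makes `-r₀ τ + p₀` the positive step; Denjoy's inequality is
  -- then taken from the reflected flow.
  rcases lt_or_gt_of_ne hne with hneg | hpos
  · have habs := abs_of_neg hneg
    refine ⟨-r₀, p₀, by push_cast; linarith, by push_cast; linarith, fun r h1 h2 k => ?_,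
      ⟨r₀, -p₀, hr₀.2, Or.inl (by omega), ?_⟩, fun x => ?_⟩
    · have := hbest r h1 h2 k
      push_cast; linarith
    · push_cast; rw [← sub_eq_add_neg, habs]; ring
    · have hd := (Φ.reflect.denjoy_of_pos hτ.neg (q := r₀) (p := -p₀) hr₀.1
        (by push_cast; linarith) (fun r h1 h2 k => by
          have := hbest r h1 (by omega) (-k)
          rw [← abs_neg] at this
          push_cast at this ⊢
          rw [← abs_neg (r * -τ + k : ℝ)]
          convert this using 2 <;> ring) (-(Φ.F (-r₀) x + p₀))).2
      have e1 : Φ.F r₀ (Φ.F (-r₀) x + p₀) = x + p₀ := by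
        rw [Φ.map_add_int, ← Φ.map_add]; simp [Φ.map_zero]
      simp only [len_eq, reflect, neg_neg, Nat.cast_zero, Φ.map_zero, e1] at hd
      push_cast at hd
      simp only [sub_neg_eq_add, neg_add_rev, neg_neg] at hd ⊢
      have e2 : -(p₀ : ℝ) + (x + p₀) = x := by ring
      rw [e2] at hd
      linarith
  · have habs := abs_of_pos hpos
    refine ⟨r₀, -p₀, by push_cast; linarith, by push_cast; linarith, fun r h1 h2 k => ?_,
      ⟨r₀, -p₀, hr₀.2, Or.inl (by omega), ?_⟩, fun x => ?_⟩
    · have := hbest r h1 h2 k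
      push_cast; linarith
    · push_cast; rw [← sub_eq_add_neg, habs]
    · have hd := (Φ.denjoy_of_pos hτ (q := r₀) (p := p₀) hr₀.1 hpos
        (fun r h1 h2 k => hbest r h1 (by omega) k) (Φ.F (-r₀) x + p₀)).1
      have e1 : Φ.F r₀ (Φ.F (-r₀) x + p₀) = x + p₀ := by
        rw [Φ.map_add_int, ← Φ.map_add]; simp [Φ.map_zero]
      simp only [len_eq, Nat.cast_zero, Φ.map_zero, e1] at hd
      push_cast
      rw [add_sub_cancel_right] at hd
      linarith

end CircleFlow

/-! ### Polynomial growth of the derivatives of the iterates -/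

namespace CircleFlow

variable {τ C : ℝ} (Φ : CircleFlow τ C)

/-- The point `F (i q) x - i p`. -/
def pt (q : ℕ) (p : ℤ) (x : ℝ) (i : ℤ) : ℝ := Φ.F (i * q) x - i * p

theorem map_pt (q : ℕ) (p : ℤ) (x : ℝ) (i n : ℤ) :
    Φ.F n (Φ.pt q p x i) = Φ.F (i * q + n) x - i * p := by
  have := Φ.map_sub_int n (Φ.F (i * q) x) (i * p)
  push_cast at this
  rw [pt, this, ← Φ.map_add, add_comm]

theorem pt_succ (q : ℕ) (p : ℤ) (x : ℝ) (i : ℤ) :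
    Φ.F q (Φ.pt q p x i) - p = Φ.pt q p x (i + 1) := by
  rw [map_pt, pt]
  push_cast
  have : (i + 1) * (q : ℤ) = i * q + q := by ring
  rw [this]; ring

theorem pt_lt {q : ℕ} {p : ℤ} (h0 : 0 < q * τ - p) (x : ℝ) (i : ℤ) :
    Φ.pt q p x i < Φ.pt q p x (i + 1) := by
  have := Φ.orb_lt x (n := i * q) (s := -(i * p)) (n' := (i + 1) * q) (s' := -((i + 1) * p))
    (by push_cast; linarith)
  rw [pt, pt]; push_cast at this ⊢; linarith

theorem denjoy_pt (hτ : Irrational τ) {q : ℕ} {p : ℤ} (hq : 1 ≤ q) (h0 : 0 < q * τ - p)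
    (h : ∀ r : ℕ, 1 ≤ r → r ≤ q → ∀ k : ℤ, |q * τ - p| ≤ |r * τ + k|) (x : ℝ) (i : ℤ) :
    Φ.pt q p x (i + 2) - Φ.pt q p x (i + 1) ≤
      2 * Real.exp (C * 4) * (Φ.pt q p x (i + 1) - Φ.pt q p x i) ∧
    Φ.pt q p x (i + 1) - Φ.pt q p x i ≤
      2 * Real.exp (C * 4) * (Φ.pt q p x (i + 2) - Φ.pt q p x (i + 1)) := by
  have := Φ.denjoy_of_pos hτ hq h0 h (Φ.pt q p x i)
  simp only [len_eq, Nat.cast_zero, Φ.map_zero, pt_succ] at this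
  have e : i + 1 + 1 = i + 2 := by ring
  rwa [e] at this

/-- A window around `x` on which the first `q` iterates have bounded total length: log-convexity
of the lengths of the intervals between consecutive points. -/
theorem length_convex {q : ℕ} {p : ℤ} (h0 : 0 < q * τ - p) {x A D : ℝ} (i : ℤ)
    (hwin : ∀ n ≤ q, ∑ j ∈ Finset.range n, (Φ.F j D - Φ.F j A) ≤ 2)
    (hA : A ≤ Φ.pt q p x i) (hD : Φ.pt q p x (i + 2) ≤ D) :
    (Φ.pt q p x (i + 3) - Φ.pt q p x (i + 2)) * (Φ.pt q p x (i + 1) - Φ.pt q p x i) ≤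
      Real.exp (C * (2 * Real.exp (C * 2) * (Φ.pt q p x (i + 2) - Φ.pt q p x i) / (D - A))) *
        (Φ.pt q p x (i + 2) - Φ.pt q p x (i + 1)) ^ 2 := by
  have h1 := Φ.pt_lt h0 x i
  have h2 := Φ.pt_lt h0 x (i + 1)
  have e3 : i + 2 + 1 = i + 3 := by ring
  have e2 : i + 1 + 1 = i + 2 := by ring
  have s1 := Φ.pt_succ q p x i
  have s2 := Φ.pt_succ q p x (i + 1)
  have s3 := Φ.pt_succ q p x (i + 2)
  rw [e2] at h2 s2
  rw [e3] at s3
  set y0 := Φ.pt q p x i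
  set y1 := Φ.pt q p x (i + 1)
  set y2 := Φ.pt q p x (i + 2)
  have hAD : A < D := by linarith
  -- Bounded distortion on the window: the images of `[y0, y2]` occupy about the same proportion of
  -- the images of `[A, D]` as at time `0`. Their total length, and with it the distortion of `F q`
  -- on `[y0, y2]`, is thus proportional to the relative length.
  have hsmall : ∑ j ∈ Finset.range q, (Φ.F j y2 - Φ.F j y0) ≤
      2 * Real.exp (C * 2) * (y2 - y0) / (D - A) := by
    rw [le_div_iff₀ (sub_pos.2 hAD), Finset.sum_mul]
    calc _ ≤ ∑ j ∈ Finset.range q, Real.exp (C * 2) * ((Φ.F j D - Φ.F j A) * (y2 - y0)) := by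
          refine Finset.sum_le_sum fun j hj => ?_
          exact Φ.distortion (h1.trans h2) hAD hA hD le_rfl le_rfl
            (hwin j (Finset.mem_range.1 hj).le)
      _ = Real.exp (C * 2) * ((∑ j ∈ Finset.range q, (Φ.F j D - Φ.F j A)) * (y2 - y0)) := by
          rw [← Finset.mul_sum, ← Finset.sum_mul]
      _ ≤ Real.exp (C * 2) * (2 * (y2 - y0)) := by
          refine mul_le_mul_of_nonneg_left ?_ (Real.exp_pos _).le
          exact mul_le_mul_of_nonneg_right (hwin q le_rfl) (by linarith)
      _ = _ := by ring
  have h3 := Φ.distortion h2 h1 h1.le le_rfl le_rfl h2.le hsmall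
  have e4 : Φ.F q y2 - Φ.F q y1 = Φ.pt q p x (i + 3) - y2 := by linarith
  have e5 : Φ.F q y1 - Φ.F q y0 = y2 - y1 := by linarith
  rw [e4, e5] at h3
  rwa [sq]

/-- The derivative at `x` is compared with the mean slope on `[x, F q x - p]`; the first `N` images
of this interval have total length at most one, which costs a factor `exp C`. -/
theorem exp_logDeriv_le (hτ : Irrational τ) {N : ℕ} {q : ℕ} {p : ℤ} (h0 : 0 < q * τ - p)
    (h1 : q * τ - p ≤ 1)
    (h : ∀ r : ℕ, 1 ≤ r → r < N → ∀ k : ℤ, q * τ - p ≤ |r * τ + k|) (x : ℝ) :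
    Real.exp (Φ.logDeriv N x) * (Φ.F q x - p - x) ≤
      Real.exp C * (Φ.F N (Φ.F q x - p) - Φ.F N x) := by
  have hx : x < Φ.F q x - p := by
    have := Φ.len_pos h0 x 0
    rw [len_eq, Nat.cast_zero, Φ.map_zero, Φ.map_zero] at this
    linarith
  obtain ⟨ξ, hξ, e⟩ := Φ.exists_image_length N hx
  rw [e]
  have h2 := Φ.logDeriv_sub_le (n := N) (A := x) (D := Φ.F q x - p) (ξ := x) (η := ξ) (M := 1)
    ⟨le_rfl, hx.le⟩ hξ (by
      have := Φ.len_sum_upper hτ h0 h1 h x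
      simpa only [len_eq] using this)
  rw [← mul_assoc, ← Real.exp_add]
  exact mul_le_mul_of_nonneg_right (Real.exp_le_exp.2 (by linarith)) (sub_pos.2 hx).le

/-- The iterate `F (b q)` carries the gap `[Y 0, Y 1]` onto an integer translate of `[Y b, Y (b +
1)]`. By `exp_logDeriv_le` its derivative is controlled by the ratio of these gaps, to which
`seq_growth` applies after normalization. The constant depends on `C` alone, so it also serves the
reflected flow and every `q` in the induction. -/
theorem exists_quadratic_bound (C : ℝ) (hC : 0 ≤ C) : ∃ C' : ℝ, 0 < C' ∧
    ∀ (τ : ℝ) (Φ : CircleFlow τ C), Irrational τ → ∀ (q b : ℕ) (p : ℤ), 1 ≤ q → 1 ≤ b →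
      0 < q * τ - p → (∀ r : ℕ, 1 ≤ r → r ≤ b * q → ∀ k : ℤ, q * τ - p ≤ |r * τ + k|) →
      ∀ x, Real.exp (Φ.logDeriv (b * q) x) ≤ C' * b ^ 2 := by
  let K := 2 * Real.exp (C * 4)
  have hK : 0 < K := by positivity
  have hK1 : 1 ≤ K := by
    have : 1 ≤ Real.exp (C * 4) := Real.one_le_exp (by positivity)
    simp only [K]; linarith
  obtain ⟨C₂, hC₂, hseq⟩ := seq_growth (C * (2 * Real.exp (C * 2) * (1 + K))) (Real.log K)
    (1 / (1 + K) ^ 2) K (by positivity) (Real.log_nonneg hK1) (by positivity) hK.le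
  refine ⟨Real.exp C * C₂, by positivity, ?_⟩
  intro τ Φ hτ q b p hq hb h0 h x
  have hqb : q ≤ b * q := Nat.le_mul_of_pos_left q hb
  have hbest : ∀ r : ℕ, 1 ≤ r → r ≤ q → ∀ k : ℤ, |q * τ - p| ≤ |r * τ + k| :=
    fun r h1 h2 k => by rw [abs_of_pos h0]; exact h r h1 (h2.trans hqb) k
  have hle1 : q * τ - p ≤ 1 := by
    have := len_le_one_of_best (hbest q hq le_rfl)
    rwa [abs_of_pos h0] at this
  obtain ⟨m, s, hw0, hw1, hwbest, ⟨r₀, k₀, hr₀, hrk, hw⟩, hwd⟩ := Φ.exists_previous hτ hq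
  have hbw : b * (q * τ - p) ≤ m * τ + s := by
    rw [hw]; exact mul_best_le hτ hq hb h0 h r₀ k₀ hr₀ hrk
  set w := m * τ + s with hwdef
  set A := Φ.F (-m) x - s with hA
  set D := Φ.F m x + s with hD
  -- The number `a` counts the steps `q τ - p` that fit into the larger scale `w`; by `mul_best_le`
  -- there are at least `b` of them.
  obtain ⟨a, haw, haw'⟩ : ∃ a : ℕ, a * (q * τ - p) ≤ w ∧ w < (a + 1) * (q * τ - p) :=
    ⟨⌊w / (q * τ - p)⌋₊, (le_div_iff₀ h0).1 (Nat.floor_le (by positivity)),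
      (div_lt_iff₀ h0).1 (Nat.lt_floor_add_one _)⟩
  have hba : b ≤ a := by
    by_contra hlt
    have : ((a : ℝ) + 1) ≤ b := by exact_mod_cast (by omega : a + 1 ≤ b)
    have := mul_le_mul_of_nonneg_right this h0.le
    linarith
  let Y := Φ.pt q p x
  have hY0 : Y 0 = x := by simp [Y, pt, Φ.map_zero]
  have hYlt : ∀ i, Y i < Y (i + 1) := Φ.pt_lt h0 x
  have hYmono : StrictMono Y := strictMono_int_of_lt_succ hYlt
  have hAx : A < x := by
    have := Φ.orb_lt x (n := -m) (s := -s) (n' := 0) (s' := 0) (by push_cast; linarith)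
    rw [Φ.map_zero] at this
    push_cast at this
    rw [hA]; linarith
  have hxD : x < D := Φ.lt_of_pos m s x hw0
  have hAY : ∀ i : ℤ, -a ≤ i → A ≤ Y i := by
    intro i hi
    have hi' : (-a : ℝ) ≤ i := by exact_mod_cast hi
    have := Φ.orb_le hτ x (n := -m) (s := -s) (n' := i * q) (s' := -(i * p))
      (by push_cast; nlinarith)
    push_cast at this
    simp only [A, Y, pt]; linarith
  have hYD : ∀ i : ℤ, i ≤ a → Y i ≤ D := by
    intro i hi
    have hi' : (i : ℝ) ≤ a := by exact_mod_cast hi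
    have := Φ.orb_le hτ x (n := i * q) (s := -(i * p)) (n' := m) (s' := s)
      (by push_cast; nlinarith)
    push_cast at this
    simp only [D, Y, pt]; linarith
  have hYA : Y (-a - 1) ≤ A := by
    have := Φ.orb_le hτ x (n := (-a - 1) * q) (s := -((-a - 1) * p)) (n' := -m) (s' := -s)
      (by push_cast; nlinarith)
    push_cast at this
    simp only [A, Y, pt]; push_cast; linarith
  -- The window consists of `[A, x]` and `[x, D]`, each a single step of the larger scale, based at
  -- `A` and at `x`; each contributes total length at most one.
  have hwin : ∀ n ≤ q, ∑ j ∈ Finset.range n, (Φ.F j D - Φ.F j A) ≤ 2 := by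
    intro n hn
    have h1 := Φ.sum_length_le_one hτ x n m s hw0 hw1 (fun r h1 h2 k => hwbest r h1 (by omega) k)
    have h2 := Φ.sum_length_le_one hτ A n m s hw0 hw1 (fun r h1 h2 k => hwbest r h1 (by omega) k)
    have h3 := add_le_add h1 h2
    rw [← Finset.sum_add_distrib] at h3
    refine le_of_eq_of_le (Finset.sum_congr rfl fun j _ => ?_) (h3.trans (by norm_num))
    have e1 : Φ.F j D = Φ.F (m + j) x + s := by
      rw [hD, Φ.map_add_int, ← Φ.map_add, add_comm (j : ℤ)]
    have e2 : Φ.F (m + j) A + s = Φ.F j x := by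
      rw [hA, Φ.map_sub_int, ← Φ.map_add]; simp
    rw [e1, e2]; ring
  have hden := fun i => Φ.denjoy_pt hτ hq h0 hbest x i
  have hAD : 0 < D - A := by linarith
  let u : ℤ → ℝ := fun i => (Y (i + 1) - Y i) / (D - A)
  have e2 : ∀ i : ℤ, i + 1 + 1 = i + 2 := fun i => by ring
  have e3 : ∀ i : ℤ, i + 2 + 1 = i + 3 := fun i => by ring
  have hratio : ∀ i, u (i + 1) ≤ K * u i := by
    intro i
    simp only [u, e2]
    rw [← mul_div_assoc, div_le_div_iff_of_pos_right hAD]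
    exact (hden i).1
  have hratio' : ∀ i, Y (i + 1) - Y i ≤ K * (Y (i + 2) - Y (i + 1)) := fun i => (hden i).2
  have hmain := hseq a b u hb hba (fun i => div_pos (sub_pos.2 (hYlt i)) hAD) ?_ ?_
    (fun i => by rw [Real.exp_log hK]; exact hratio i) ?_
  · have h1 := Φ.exp_logDeriv_le hτ (N := b * q) h0 hle1 (fun r h1 h2 k => h r h1 h2.le k) x
    have e4 : Φ.F q x - p = Y 1 := by
      have := Φ.pt_succ q p x 0
      rw [← hY0]; exact this
    have e5 : ∀ i : ℤ, Φ.F (b * q : ℕ) (Y i) = Y (b + i) + b * p := by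
      intro i
      simp only [Y]
      rw [map_pt, pt]
      push_cast
      have : i * (q : ℤ) + b * q = (b + i) * q := by ring
      rw [this]; ring
    have e6 : Φ.F (b * q : ℕ) x = Y b + b * p := by
      have := e5 0
      rwa [hY0, add_zero] at this
    have e7 := hYlt 0
    rw [zero_add, hY0] at e7
    rw [e4, e5, e6] at h1
    simp only [u, zero_add, hY0] at hmain
    rw [← mul_div_assoc, div_le_div_iff_of_pos_right hAD] at hmain
    have h2 : Real.exp (Φ.logDeriv (b * q) x) * (Y 1 - x) ≤
        Real.exp C * C₂ * b ^ 2 * (Y 1 - x) := by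
      refine h1.trans ?_
      have := mul_le_mul_of_nonneg_left hmain (Real.exp_pos C).le
      linarith
    exact le_of_mul_le_mul_right h2 (by linarith)
  -- Only `Y i` and `Y (i + 2)` must lie in the window, not `Y (i + 3)`, so the range `i + 2 ≤ a`
  -- suffices. The factor `1 + K` arises from bounding `Y (i + 2) - Y i` by the gap `Y (i + 2) - Y
  -- (i + 1)`.
  · intro i hi1 hi2
    have h1 := Φ.length_convex h0 (x := x) i hwin (hAY i hi1) (hYD _ hi2)
    have h2 := hratio' i
    simp only [u, e2, e3]
    rw [div_mul_div_comm, div_pow, ← mul_div_assoc, sq (D - A),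
      div_le_div_iff_of_pos_right (mul_pos hAD hAD)]
    refine h1.trans (mul_le_mul_of_nonneg_right (Real.exp_le_exp.2 ?_) (sq_nonneg _))
    rw [mul_assoc C]
    refine mul_le_mul_of_nonneg_left ?_ hC
    rw [← mul_div_assoc, div_le_div_iff_of_pos_right hAD, mul_assoc (2 * Real.exp (C * 2))]
    refine mul_le_mul_of_nonneg_left ?_ (by positivity)
    simp only [Y] at h2
    linarith
  -- The mass on the left is at least `1 / (1 + K) ^ 2`: one factor compares `[x, D]` with `[A, x]`,
  -- the other absorbs the gap from `Y (-a - 1)` to `Y (-a)`, which may contain `A`.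
  · have hsum : ∑ j ∈ Finset.range (a + 1), u (-j) = (Y 1 - Y (-a)) / (D - A) := by
      simp only [u]
      rw [← Finset.sum_div]
      congr 1
      have h1 := Finset.sum_range_sub' (fun j : ℕ => Y (1 - j)) (a + 1)
      have e : (1 : ℤ) - ((a + 1 : ℕ) : ℤ) = -a := by push_cast; ring
      simp only [e, Nat.cast_zero, sub_zero] at h1
      rw [← h1]
      refine Finset.sum_congr rfl fun j _ => ?_
      congr 2
      · ring
      · push_cast; ring
    rw [hsum, le_div_iff₀ hAD, div_mul_eq_mul_div, one_mul, div_le_iff₀ (by positivity)]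
    have h1 := hwd x
    have h2 := hratio' (-a - 1)
    have e4 : (-a - 1 + 1 : ℤ) = -a := by ring
    have e5 : (-a - 1 + 2 : ℤ) = -a + 1 := by ring
    rw [e4, e5] at h2
    have h3 : Y (-a + 1) ≤ Y 1 := hYmono.monotone (by omega)
    have h4 : x < Y 1 := by rw [← hY0]; exact hYmono (by omega)
    have h5 : x - A ≤ (1 + K) * (Y 1 - Y (-a)) := by
      have := mul_le_mul_of_nonneg_left (sub_le_sub_right h3 (Y (-a))) hK.le
      linarith
    have h6 : D - A ≤ (1 + K) * (x - A) := by
      have : D - x ≤ K * (x - A) := h1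
      linarith
    calc D - A ≤ (1 + K) * (x - A) := h6
      _ ≤ (1 + K) * ((1 + K) * (Y 1 - Y (-a))) := mul_le_mul_of_nonneg_left h5 (by positivity)
      _ = _ := by ring
  -- The gap preceding `Y b` lies in the window and has relative length at most one; Denjoy's
  -- inequality extends this to the next gap at the cost of `K`.
  · have h1 := hratio (b - 1)
    have e4 : (b - 1 + 1 : ℤ) = b := by ring
    rw [e4] at h1
    refine h1.trans (mul_le_of_le_one_right hK.le ?_)
    simp only [u, e4]
    rw [div_le_one hAD]
    have h2 := hYD b (by omega)
    have h3 := hAY (b - 1) (by omega)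
    linarith

theorem logDeriv_reflect (n : ℕ) (x : ℝ) : Φ.reflect.logDeriv n x = Φ.logDeriv n (-x) := by
  simp [logDeriv, reflect]

/-- The derivatives of the iterates grow at most polynomially. -/
theorem exists_polynomial_bound (hτ : Irrational τ) :
    ∃ (K : ℝ) (t : ℕ), 0 < K ∧ ∀ (n : ℕ) (x : ℝ),
      Real.exp (Φ.logDeriv n x) ≤ K * ((n : ℝ) + 1) ^ t := by
  obtain ⟨C', hC', hquad⟩ := exists_quadratic_bound C Φ.nonneg_const
  -- Each stage of the induction costs a factor `C'`, which is paid by the halving `2 r ≤ n` raised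
  -- to the power `T`.
  obtain ⟨T, hT⟩ := pow_unbounded_of_one_lt C' (one_lt_two : (1 : ℝ) < 2)
  suffices H : ∀ (n : ℕ), 1 ≤ n → ∀ x, Real.exp (Φ.logDeriv n x) ≤ C' * (n : ℝ) ^ (T + 2) by
    refine ⟨C' + 1, T + 2, by positivity, fun n x => ?_⟩
    rcases Nat.eq_zero_or_pos n with rfl | hn
    · simp [logDeriv, hC'.le]
    · refine (H n hn x).trans ?_
      gcongr <;> linarith
  intro n
  induction n using Nat.strong_induction_on with
  | _ n ih =>
  intro hn x
  -- Minimizing over all indices up to `n` makes `q` best up to `b q ≤ n`, as the quadratic bound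
  -- requires.
  obtain ⟨q, hq, hmin⟩ := Finset.exists_min_image (Finset.Icc 1 n)
    (fun r : ℕ => |(r : ℝ) * τ - round ((r : ℝ) * τ)|) ⟨1, by simp [hn]⟩
  simp only [Finset.mem_Icc] at hq hmin
  set p := round ((q : ℝ) * τ) with hp
  have hbest : ∀ r : ℕ, 1 ≤ r → r ≤ n → ∀ k : ℤ, |(q : ℝ) * τ - p| ≤ |r * τ + k| := by
    intro r h1 h2 k
    refine (hmin r ⟨h1, h2⟩).trans ?_
    have := round_le ((r : ℝ) * τ) (-k)
    push_cast at this
    rwa [sub_neg_eq_add] at this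
  have hne : (q : ℝ) * τ - p ≠ 0 := by
    intro h
    have := strictMono_comb hτ (n := q) (s := -p) (n' := 0) (s' := 0) (by push_cast; linarith)
    omega
  obtain ⟨b, r, hnb, hrq⟩ : ∃ b r, n = b * q + r ∧ r < q :=
    ⟨n / q, n % q, (Nat.div_add_mod' n q).symm, Nat.mod_lt _ hq.1⟩
  have hb : 1 ≤ b := by
    rcases Nat.eq_zero_or_pos b with h | h
    · subst h; omega
    · exact h
  have hbq : Real.exp (Φ.logDeriv (b * q) x) ≤ C' * b ^ 2 := by
    rcases lt_or_gt_of_ne hne with hneg | hpos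
    · have h1 := hquad (-τ) Φ.reflect hτ.neg q b (-p) hq.1 hb (by push_cast; linarith)
        (fun r h1 h2 k => by
          have := hbest r h1 (by omega) (-k)
          rw [abs_of_neg hneg, ← abs_neg] at this
          push_cast at this ⊢
          convert this using 2 <;> ring) (-x)
      rwa [logDeriv_reflect, neg_neg] at h1
    · exact hquad τ Φ hτ q b p hq.1 hb hpos (fun r h1 h2 k => by
          have := hbest r h1 (by omega) k
          rwa [abs_of_pos hpos] at this) x
  have hbqle : q ≤ b * q := Nat.le_mul_of_pos_left q hb
  have hbqb : b ≤ b * q := Nat.le_mul_of_pos_right b hq.1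
  rw [hnb, logDeriv_add, Real.exp_add]
  rcases Nat.eq_zero_or_pos r with hr0 | hr0
  · subst hr0
    simp only [logDeriv, Finset.range_zero, Finset.sum_empty, Real.exp_zero, mul_one, add_zero]
    refine hbq.trans (mul_le_mul_of_nonneg_left ?_ hC'.le)
    have h1 : (b : ℝ) ≤ ((b * q : ℕ) : ℝ) := by exact_mod_cast hbqb
    have h2 : (1 : ℝ) ≤ ((b * q : ℕ) : ℝ) := by exact_mod_cast hb.trans hbqb
    calc (b : ℝ) ^ 2 ≤ ((b * q : ℕ) : ℝ) ^ 2 := by gcongr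
      _ ≤ ((b * q : ℕ) : ℝ) ^ (T + 2) := pow_le_pow_right₀ h2 (by omega)
  · have h1 := ih r (by omega) hr0 (Φ.F (b * q : ℕ) x)
    have h2 : 2 * (r : ℝ) ≤ ((b * q + r : ℕ) : ℝ) := by exact_mod_cast (by omega : 2 * r ≤ b * q + r)
    have h3 : (b : ℝ) * r ≤ ((b * q + r : ℕ) : ℝ) := by
      have : b * r ≤ b * q := Nat.mul_le_mul_left b hrq.le
      exact_mod_cast (by omega : b * r ≤ b * q + r)
    -- The exponent `T + 2` splits: two powers of `r` combine with `b ^ 2` through `b r ≤ n`, and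
    -- `T` powers absorb the extra `C'` through `2 r ≤ n`.
    calc _ ≤ (C' * b ^ 2) * (C' * (r : ℝ) ^ (T + 2)) :=
          mul_le_mul hbq h1 (Real.exp_pos _).le (by positivity)
      _ = C' * (C' * ((r : ℝ) ^ T * (b * r) ^ 2)) := by ring
      _ ≤ C' * (2 ^ T * ((r : ℝ) ^ T * (b * r) ^ 2)) := by gcongr
      _ = C' * ((2 * r) ^ T * (b * r) ^ 2) := by ring
      _ ≤ C' * (((b * q + r : ℕ) : ℝ) ^ T * ((b * q + r : ℕ) : ℝ) ^ 2) := by gcongr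
      _ = _ := by ring

end CircleFlow

noncomputable section

/-! ## Lifts of circle diffeomorphisms -/

/-- Near `θ₀` the lift is `F θ₀` plus the argument of `exp (i (F θ - F θ₀))`. Continuity keeps this
difference in `(-π, π)`, where the principal logarithm recovers it smoothly. -/
theorem contDiff_lift {f : Circle → Circle} (hf : ContMDiff (𝓡 1) (𝓡 1) ∞ f) {F : ℝ → ℝ}
    (hF : Continuous F) (h : ∀ θ, f (Circle.exp θ) = Circle.exp (F θ)) : ContDiff ℝ ∞ F := by
  have hfact : Fact (Module.finrank ℝ ℂ = 1 + 1) := ⟨Complex.finrank_real_complex⟩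
  have hE : ContDiff ℝ ∞ fun θ : ℝ => ((Circle.exp (F θ) : Circle) : ℂ) := by
    have h1 : ContMDiff 𝓘(ℝ) (𝓡 1) ∞ fun θ : ℝ => f (Circle.exp θ) :=
      hf.comp contMDiff_circleExp
    have h2 : ContMDiff (𝓡 1) 𝓘(ℝ, ℂ) ∞ (fun z : Circle => (z : ℂ)) :=
      contMDiff_coe_sphere (E := ℂ) (n := 1)
    have h3 := h2.comp h1
    rw [contMDiff_iff_contDiff] at h3
    convert h3 using 1
    funext θ
    simp [h]
  rw [contDiff_iff_contDiffAt]
  intro θ₀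
  have h1 : ContDiffAt ℝ ∞ (fun θ : ℝ => Complex.log
      (((Circle.exp (F θ) : Circle) : ℂ) * ((Circle.exp (-F θ₀) : Circle) : ℂ))) θ₀ := by
    have h2 : ((Circle.exp (F θ₀) : Circle) : ℂ) * ((Circle.exp (-F θ₀) : Circle) : ℂ) = 1 := by
      rw [← Circle.coe_mul, ← Circle.exp_add]; simp
    refine ContDiffAt.comp θ₀ (g := Complex.log) ?_ (hE.contDiffAt.mul contDiffAt_const)
    rw [h2]
    exact (Complex.contDiffAt_log Complex.one_mem_slitPlane).restrict_scalars ℝ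
  have h3 : ContDiffAt ℝ ∞ (fun θ : ℝ => F θ₀ + (Complex.log
      (((Circle.exp (F θ) : Circle) : ℂ) * ((Circle.exp (-F θ₀) : Circle) : ℂ))).im) θ₀ :=
    contDiffAt_const.add (Complex.imCLM.contDiff.contDiffAt.comp θ₀ h1)
  refine h3.congr_of_eventuallyEq ?_
  have h4 : ∀ᶠ θ in nhds θ₀, F θ ∈ Set.Ioo (F θ₀ - Real.pi) (F θ₀ + Real.pi) :=
    hF.continuousAt.eventually (Ioo_mem_nhds (by linarith [Real.pi_pos]) (by linarith [Real.pi_pos]))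
  filter_upwards [h4] with θ hθ
  rw [← Circle.coe_mul, ← Circle.exp_add, Circle.coe_exp, Complex.log_im, Complex.arg_exp_mul_I,
    (toIocMod_eq_self Real.two_pi_pos).2 ⟨by linarith [hθ.1], by linarith [hθ.2]⟩]
  ring

/-- The increment over a period is `2 π m` with `m ≥ 1` by monotonicity. If `m ≥ 2`, the value `F θ
+ 2 π` is attained strictly inside the period, against injectivity of `f`. -/
theorem lift_add_two_pi {f : Circle → Circle} (hf : Function.Injective f) {F : ℝ → ℝ}
    (hF : Continuous F) (hmono : StrictMono F) (h : ∀ θ, f (Circle.exp θ) = Circle.exp (F θ))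
    (θ : ℝ) : F (θ + 2 * Real.pi) = F θ + 2 * Real.pi := by
  have hpi := Real.two_pi_pos
  have h1 : Circle.exp (F (θ + 2 * Real.pi)) = Circle.exp (F θ) := by
    rw [← h, ← h, Circle.periodic_exp]
  obtain ⟨m, hm⟩ := Circle.exp_eq_exp.1 h1
  have hlt : F θ < F (θ + 2 * Real.pi) := hmono (by linarith)
  have hm0 : 0 < m := by
    by_contra hle
    have : (m : ℝ) ≤ 0 := by exact_mod_cast not_lt.1 hle
    nlinarith
  have hm1 : m = 1 := by
    by_contra hne
    have hm2 : (2 : ℝ) ≤ m := by exact_mod_cast (by omega : 2 ≤ m)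
    obtain ⟨t, ht, hFt⟩ := intermediate_value_Ioo (by linarith : θ ≤ θ + 2 * Real.pi)
      hF.continuousOn (show F θ + 2 * Real.pi ∈ Set.Ioo (F θ) (F (θ + 2 * Real.pi)) from
        ⟨by linarith, by rw [hm]; nlinarith⟩)
    have h2 : Circle.exp t = Circle.exp θ := hf (by rw [h, h, hFt, Circle.periodic_exp])
    obtain ⟨k, hk⟩ := Circle.exp_eq_exp.1 h2
    have hk0 : 0 < k := by
      by_contra hle
      have : (k : ℝ) ≤ 0 := by exact_mod_cast not_lt.1 hle
      nlinarith [ht.1]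
    have : (1 : ℝ) ≤ k := by exact_mod_cast hk0
    nlinarith [ht.2]
  rw [hm, hm1]; simp

/-- An orientation preserving diffeomorphism of the circle has a smooth lift with smooth inverse,
here with respect to the covering `x ↦ e^{2πix}`. -/
theorem exists_units_lift (f : Circle ≃ₘ^∞⟮𝓡 1, 𝓡 1⟯ Circle) (hf : OrientationPreserving f) :
    ∃ U : CircleDeg1Liftˣ, ContDiff ℝ ∞ (U : ℝ → ℝ) ∧ ContDiff ℝ ∞ ((U⁻¹ : CircleDeg1Liftˣ) : ℝ → ℝ) ∧
      ∀ x, f (Circle.exp (2 * Real.pi * x)) = Circle.exp (2 * Real.pi * U x) := by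
  obtain ⟨F, hFc, hFm, hF⟩ := hf
  have hpi := Real.two_pi_pos
  have hper := lift_add_two_pi f.injective hFc hFm hF
  let L : CircleDeg1Lift :=
    { toFun := fun x => F (2 * Real.pi * x) / (2 * Real.pi)
      monotone' := fun x y hxy => by
        have := hFm.monotone (mul_le_mul_of_nonneg_left hxy hpi.le)
        exact div_le_div_of_nonneg_right this hpi.le
      map_add_one' := fun x => by
        rw [mul_add, mul_one, hper, add_div, div_self hpi.ne'] }
  have hL : ∀ x, L x = F (2 * Real.pi * x) / (2 * Real.pi) := fun x => rfl
  have hLc : Continuous L := by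
    have : Continuous fun x => F (2 * Real.pi * x) / (2 * Real.pi) := by fun_prop
    exact this
  have hLi : Function.Injective L := fun x y hxy => by
    simp only [hL] at hxy
    have := hFm.injective ((div_left_inj' hpi.ne').1 hxy)
    exact mul_left_cancel₀ hpi.ne' this
  obtain ⟨U, hU⟩ := CircleDeg1Lift.isUnit_iff_bijective.2
    ⟨hLi, (CircleDeg1Lift.continuous_iff_surjective L).1 hLc⟩
  have hUF : ∀ x, F (2 * Real.pi * x) = 2 * Real.pi * U x := fun x => by
    rw [hU, hL, mul_div_cancel₀ _ hpi.ne']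
  have hFs : ContDiff ℝ ∞ F := contDiff_lift f.contMDiff hFc hF
  have hlift : ∀ x, f (Circle.exp (2 * Real.pi * x)) = Circle.exp (2 * Real.pi * U x) := fun x => by
    rw [hF, hUF]
  refine ⟨U, ?_, ?_, hlift⟩
  · have h1 : ContDiff ℝ ∞ fun x => F (2 * Real.pi * x) / (2 * Real.pi) :=
      (hFs.comp (contDiff_const.mul contDiff_id)).div_const _
    rw [hU]
    exact h1
  · have hc : Continuous ((U⁻¹ : CircleDeg1Liftˣ) : ℝ → ℝ) := by
      rw [← CircleDeg1Lift.coe_toOrderIso_inv]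
      exact (CircleDeg1Lift.toOrderIso U)⁻¹.continuous
    let G : ℝ → ℝ := fun θ => 2 * Real.pi * (U⁻¹ : CircleDeg1Liftˣ) (θ / (2 * Real.pi))
    have hG : ContDiff ℝ ∞ G := by
      refine contDiff_lift f.symm.contMDiff (by fun_prop) fun θ => ?_
      apply f.injective
      have h2 := hlift ((U⁻¹ : CircleDeg1Liftˣ) (θ / (2 * Real.pi)))
      rw [CircleDeg1Lift.units_apply_inv_apply, mul_div_cancel₀ _ hpi.ne'] at h2
      exact (f.apply_symm_apply _).trans h2.symm
    have h1 : ContDiff ℝ ∞ fun x => G (2 * Real.pi * x) / (2 * Real.pi) :=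
      (hG.comp (contDiff_const.mul contDiff_id)).div_const _
    convert h1 using 1
    funext x
    simp only [G]
    rw [mul_div_cancel_left₀ _ hpi.ne', mul_div_cancel_left₀ _ hpi.ne']

/-- A continuous function of period one has a bounded absolute value. -/
theorem exists_bound_of_periodic {g : ℝ → ℝ} (hg : Continuous g) (hper : Function.Periodic g 1) :
    ∃ C : ℝ, 0 ≤ C ∧ ∀ x, |g x| ≤ C := by
  obtain ⟨C, hC⟩ := isCompact_Icc.exists_bound_of_continuousOn (s := Set.Icc (0 : ℝ) 1)
    hg.continuousOn
  refine ⟨C, (norm_nonneg _).trans (hC 0 (by simp)), fun x => ?_⟩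
  obtain ⟨y, hy, hxy⟩ := hper.exists_mem_Ico₀ one_pos x
  rw [hxy]
  exact hC y ⟨hy.1, hy.2.le⟩

theorem CircleDeg1Lift.deriv_periodic (U : CircleDeg1Lift) :
    Function.Periodic (deriv (U : ℝ → ℝ)) 1 := by
  intro x
  rw [← deriv_comp_add_const]
  have : (fun x => U (x + 1)) = fun x => U x + 1 := funext fun y => U.map_add_one y
  rw [this, deriv_add_const]

theorem CircleDeg1Lift.deriv_pos (U : CircleDeg1Liftˣ) (h1 : ContDiff ℝ ∞ (U : ℝ → ℝ))
    (h2 : ContDiff ℝ ∞ ((U⁻¹ : CircleDeg1Liftˣ) : ℝ → ℝ)) (x : ℝ) : 0 < deriv (U : ℝ → ℝ) x := by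
  refine lt_of_le_of_ne (CircleDeg1Lift.monotone (U : CircleDeg1Lift)).deriv_nonneg fun h0 => ?_
  have h3 := ((h2.differentiable (by simp)).differentiableAt (x := U x)).hasDerivAt.comp x
    ((h1.differentiable (by simp)).differentiableAt (x := x)).hasDerivAt
  rw [← h0, mul_zero] at h3
  have h4 : ((U⁻¹ : CircleDeg1Liftˣ) : ℝ → ℝ) ∘ (U : ℝ → ℝ) = id :=
    funext fun y => CircleDeg1Lift.units_inv_apply_apply U y
  rw [h4] at h3
  exact zero_ne_one (h3.unique (hasDerivAt_id x))

theorem exists_circleFlow (U : CircleDeg1Liftˣ) (h1 : ContDiff ℝ ∞ (U : ℝ → ℝ))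
    (h2 : ContDiff ℝ ∞ ((U⁻¹ : CircleDeg1Liftˣ) : ℝ → ℝ)) :
    ∃ (C : ℝ) (Φ : CircleFlow (CircleDeg1Lift.translationNumber U) C),
      ∀ n x, Φ.F n x = (U ^ n : CircleDeg1Liftˣ) x := by
  have hpos := CircleDeg1Lift.deriv_pos U h1 h2
  have hd : ContDiff ℝ ∞ (deriv (U : ℝ → ℝ)) := (contDiff_infty_iff_deriv.1 h1).2
  have hφ : ContDiff ℝ ∞ fun x => Real.log (deriv (U : ℝ → ℝ) x) :=
    hd.log fun x => (hpos x).ne'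
  have hφd := contDiff_infty_iff_deriv.1 hφ
  have hper : Function.Periodic (fun x => Real.log (deriv (U : ℝ → ℝ) x)) 1 := fun x => by
    simp only [CircleDeg1Lift.deriv_periodic (U : CircleDeg1Lift) x]
  have hper' : Function.Periodic (deriv fun x => Real.log (deriv (U : ℝ → ℝ) x)) 1 := by
    intro x
    rw [← deriv_comp_add_const]
    congr 1
    exact funext hper
  obtain ⟨C, hC, hbd⟩ := exists_bound_of_periodic hφd.2.continuous hper'
  refine ⟨C, { F := fun n x => (U ^ n : CircleDeg1Liftˣ) x
               φ := fun x => Real.log (deriv (U : ℝ → ℝ) x)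
               map_zero := fun x => by simp
               map_add := fun m n x => by rw [zpow_add]; rfl
               map_add_int := fun n x s => CircleDeg1Lift.map_add_int _ _ _
               strictMono := fun n => (CircleDeg1Lift.toOrderIso (U ^ n)).strictMono
               lt_of_pos := fun n s x h => ?_
               hasDerivAt := fun x => ?_
               lip := fun x y => ?_ }, fun n x => rfl⟩
  · rw [← CircleDeg1Lift.translationNumber_zpow] at h
    have := CircleDeg1Lift.lt_map_of_int_lt_translationNumber
      ((U ^ n : CircleDeg1Liftˣ) : CircleDeg1Lift) (n := -s) (by push_cast; linarith) x
    push_cast at this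
    linarith
  · simp only [zpow_one]
    rw [Real.exp_log (hpos x)]
    exact ((h1.differentiable (by simp)) x).hasDerivAt
  · have := Convex.norm_image_sub_le_of_norm_deriv_le (𝕜 := ℝ)
      (f := fun x => Real.log (deriv (U : ℝ → ℝ) x)) (C := C) (s := Set.univ) (x := y) (y := x)
      (fun z _ => hφd.1 z) (fun z _ => hbd z) convex_univ trivial trivial
    simpa [Real.norm_eq_abs] using this

theorem exists_deriv_bound (U : CircleDeg1Liftˣ) (h1 : ContDiff ℝ ∞ (U : ℝ → ℝ))
    (h2 : ContDiff ℝ ∞ ((U⁻¹ : CircleDeg1Liftˣ) : ℝ → ℝ))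
    (hτ : Irrational (CircleDeg1Lift.translationNumber U)) :
    ∃ (K : ℝ) (t : ℕ), 0 < K ∧ ∀ (n : ℕ) (x : ℝ),
      |deriv ((U ^ (n : ℤ) : CircleDeg1Liftˣ) : ℝ → ℝ) x| ≤ K * ((n : ℝ) + 1) ^ t := by
  obtain ⟨C, Φ, hΦ⟩ := exists_circleFlow U h1 h2
  obtain ⟨K, t, hK, h⟩ := Φ.exists_polynomial_bound hτ
  refine ⟨K, t, hK, fun n x => ?_⟩
  have h3 : ((U ^ (n : ℤ) : CircleDeg1Liftˣ) : ℝ → ℝ) = Φ.F n := funext fun y => (hΦ n y).symm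
  rw [h3, (Φ.hasDerivAt_natCast n x).deriv, abs_of_pos (Real.exp_pos _)]
  exact h n x

theorem contDiff_zpow (U : CircleDeg1Liftˣ) (h1 : ContDiff ℝ ∞ (U : ℝ → ℝ))
    (h2 : ContDiff ℝ ∞ ((U⁻¹ : CircleDeg1Liftˣ) : ℝ → ℝ)) (n : ℤ) :
    ContDiff ℝ ∞ ((U ^ n : CircleDeg1Liftˣ) : ℝ → ℝ) := by
  have key : ∀ V : CircleDeg1Liftˣ, ContDiff ℝ ∞ (V : ℝ → ℝ) → ∀ n : ℕ,
      ContDiff ℝ ∞ ((V ^ n : CircleDeg1Liftˣ) : ℝ → ℝ) := by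
    intro V hV n
    induction n with
    | zero => simpa using contDiff_id
    | succ n ih =>
      rw [pow_succ]
      exact ih.comp hV
  obtain ⟨n, rfl | rfl⟩ := n.eq_nat_or_neg
  · simpa using key U h1 n
  · have := key U⁻¹ h2 n
    rwa [inv_pow, ← zpow_natCast, ← zpow_neg] at this

theorem exists_deriv_zpow_bound (U : CircleDeg1Liftˣ) (h1 : ContDiff ℝ ∞ (U : ℝ → ℝ))
    (h2 : ContDiff ℝ ∞ ((U⁻¹ : CircleDeg1Liftˣ) : ℝ → ℝ))
    (hτ : Irrational (CircleDeg1Lift.translationNumber U)) :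
    ∃ (K : ℝ) (t : ℕ), 0 < K ∧ ∀ (n : ℤ) (x : ℝ),
      |deriv ((U ^ n : CircleDeg1Liftˣ) : ℝ → ℝ) x| ≤ K * ((n.natAbs : ℝ) + 1) ^ t := by
  obtain ⟨K₁, t₁, hK₁, hb₁⟩ := exists_deriv_bound U h1 h2 hτ
  obtain ⟨K₂, t₂, hK₂, hb₂⟩ := exists_deriv_bound U⁻¹ h2 (by rwa [inv_inv])
    (by rw [CircleDeg1Lift.translationNumber_units_inv]; exact hτ.neg)
  refine ⟨K₁ + K₂, t₁ + t₂, by positivity, fun n x => ?_⟩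
  obtain ⟨n, rfl | rfl⟩ := n.eq_nat_or_neg
  · refine (hb₁ n x).trans ?_
    simp only [Int.natAbs_natCast]
    have : ((n : ℝ) + 1) ^ t₁ ≤ ((n : ℝ) + 1) ^ (t₁ + t₂) :=
      pow_le_pow_right₀ (by linarith [(Nat.cast_nonneg n : (0 : ℝ) ≤ n)]) (by omega)
    gcongr
    linarith
  · have := hb₂ n x
    rw [inv_zpow, ← zpow_neg] at this
    refine this.trans ?_
    simp only [Int.natAbs_neg, Int.natAbs_natCast]
    have : ((n : ℝ) + 1) ^ t₂ ≤ ((n : ℝ) + 1) ^ (t₁ + t₂) :=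
      pow_le_pow_right₀ (by linarith [(Nat.cast_nonneg n : (0 : ℝ) ≤ n)]) (by omega)
    gcongr
    linarith

/-! ## Functions on the circle with continuous derivative -/

/-- `d` is the derivative of `b` with respect to the angle. -/
def HasAngleDeriv (b d : Circle → ℂ) : Prop :=
  ∀ θ : ℝ, HasDerivAt (fun t : ℝ => b (Circle.exp t)) (d (Circle.exp θ)) θ

theorem exists_continuousMap_of_periodic {g : ℝ → ℂ} (hg : Continuous g)
    (hper : Function.Periodic g (2 * Real.pi)) :
    ∃ e : C(Circle, ℂ), ∀ θ, e (Circle.exp θ) = g θ := by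
  have hc : Continuous (hper.lift : AddCircle (2 * Real.pi) → ℂ) :=
    continuous_coinduced_dom.2 hg
  refine ⟨⟨fun z => hper.lift (AddCircle.homeomorphCircle'.symm z), by fun_prop⟩, fun θ => ?_⟩
  have : AddCircle.homeomorphCircle'.symm (Circle.exp θ) = (θ : AddCircle (2 * Real.pi)) := by
    rw [Homeomorph.symm_apply_eq, AddCircle.homeomorphCircle'_apply_mk]
  simp only [ContinuousMap.coe_mk, this]
  exact hper.lift_coe θ

theorem norm_le_of_forall_exp {e : C(Circle, ℂ)} {K : ℝ} (hK : 0 ≤ K)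
    (h : ∀ θ, ‖e (Circle.exp θ)‖ ≤ K) : ‖e‖ ≤ K :=
  (ContinuousMap.norm_le _ hK).2 fun z => by
    rw [← Circle.exp_arg z]; exact h _

/-! ### Rotations and their conjugates -/

theorem circleRot_add (β γ : ℝ) (z : Circle) :
    circleRot β (circleRot γ z) = circleRot (β + γ) z := by
  rw [circleRot, circleRot, circleRot, ← mul_assoc, ← Circle.exp_add]
  congr 2
  ring

theorem circleRot_zero (z : Circle) : circleRot 0 z = z := by simp [circleRot]

theorem continuous_circleRot (β : ℝ) : Continuous (circleRot β) := by
  unfold circleRot; fun_prop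

theorem circleRot_ne {β : ℝ} (hβ : Irrational β) {n : ℤ} (hn : n ≠ 0) (z : Circle) :
    circleRot (n * β) z ≠ z := by
  intro h
  rw [circleRot, mul_eq_right, ← Circle.exp_zero, Circle.exp_eq_exp] at h
  obtain ⟨m, hm⟩ := h
  refine (hβ.intCast_mul hn).ne_int m ?_
  have := Real.pi_pos
  field_simp at hm
  nlinarith

/-- The iterates of `h ∘ R_β ∘ h⁻¹`. -/
def conjRot (β : ℝ) (h : Circle ≃ₜ Circle) (n : ℤ) : C(Circle, Circle) where
  toFun z := h (circleRot (n * β) (h.symm z))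
  continuous_toFun := by
    have := continuous_circleRot (n * β)
    fun_prop

theorem conjRot_zero (β : ℝ) (h : Circle ≃ₜ Circle) (z : Circle) : conjRot β h 0 z = z := by
  simp [conjRot, circleRot_zero]

theorem conjRot_add (β : ℝ) (h : Circle ≃ₜ Circle) (m n : ℤ) (z : Circle) :
    conjRot β h m (conjRot β h n z) = conjRot β h (m + n) z := by
  simp only [conjRot, ContinuousMap.coe_mk, Homeomorph.symm_apply_apply, circleRot_add]
  push_cast
  ring_nf

theorem conjRot_lift {β : ℝ} {h : Circle ≃ₜ Circle} {U : CircleDeg1Liftˣ}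
    (hU : ∀ x, conjRot β h 1 (Circle.exp (2 * Real.pi * x)) = Circle.exp (2 * Real.pi * U x))
    (n : ℤ) (x : ℝ) : conjRot β h n (Circle.exp (2 * Real.pi * x)) =
      Circle.exp (2 * Real.pi * (U ^ n : CircleDeg1Liftˣ) x) := by
  have key : ∀ (n : ℕ) (x : ℝ), conjRot β h n (Circle.exp (2 * Real.pi * x)) =
      Circle.exp (2 * Real.pi * (U ^ n : CircleDeg1Liftˣ) x) := by
    intro n
    induction n with
    | zero => intro x; simp [conjRot_zero]
    | succ n ih =>
      intro x
      push_cast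
      rw [← conjRot_add, hU, ih, pow_succ]
      rfl
  obtain ⟨n, rfl | rfl⟩ := n.eq_nat_or_neg
  · simpa using key n x
  · have h1 := key n ((U ^ (-(n : ℤ)) : CircleDeg1Liftˣ) x)
    have h2 : (U ^ n : CircleDeg1Liftˣ) ((U ^ (-(n : ℤ)) : CircleDeg1Liftˣ) x) = x := by
      rw [zpow_neg, zpow_natCast, CircleDeg1Lift.units_apply_inv_apply]
    rw [h2] at h1
    rw [← h1, conjRot_add, neg_add_cancel, conjRot_zero]

/-- The derivatives of the iterates of a circle diffeomorphism which is conjugate to an irrational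
rotation are polynomially bounded. -/
theorem exists_conjRot_deriv {β : ℝ} (hβ : Irrational β)
    (f : Circle ≃ₘ^∞⟮𝓡 1, 𝓡 1⟯ Circle) (hf : OrientationPreserving f) (h : Circle ≃ₜ Circle)
    (h_conj : ∀ z : Circle, f z = h (circleRot β (h.symm z))) :
    ∃ (e : ℤ → C(Circle, ℂ)) (K : ℝ) (t : ℕ), 0 < K ∧
      (∀ n, ‖e n‖ ≤ K * ((n.natAbs : ℝ) + 1) ^ t) ∧
      ∀ (n : ℤ) (b d : Circle → ℂ), HasAngleDeriv b d →
        HasAngleDeriv (fun z => b (conjRot β h n z)) (fun z => e n z * d (conjRot β h n z)) := by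
  obtain ⟨U, hU1, hU2, hU⟩ := exists_units_lift f hf
  have hlift := conjRot_lift (β := β) (h := h) (U := U) fun x => by
    rw [← hU, h_conj]; simp [conjRot]
  have hcont : Continuous (U : ℝ → ℝ) := hU1.continuous
  have hpi := Real.two_pi_pos
  -- Only irrationality of the translation number is needed, not its value, so the orientation of
  -- `h` plays no role. A rational value would give a periodic point of `f`, hence under `h` one of
  -- an irrational rotation.
  have hτ : Irrational (CircleDeg1Lift.translationNumber U) := by
    rintro ⟨r, hr⟩
    have h1 : CircleDeg1Lift.translationNumber U = (r.num : ℝ) / (r.den : ℝ) := by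
      rw [← hr]; exact_mod_cast (Rat.num_div_den r).symm
    obtain ⟨x, hx⟩ := (CircleDeg1Lift.translationNumber_eq_rat_iff (U : CircleDeg1Lift) hcont
      r.den_pos).1 h1
    have h2 := hlift (r.den : ℤ) x
    have h3 : (U ^ (r.den : ℤ) : CircleDeg1Liftˣ) x = x + r.num := by
      rw [zpow_natCast]
      exact hx
    rw [h3] at h2
    have h4 : Circle.exp (2 * Real.pi * (x + r.num)) = Circle.exp (2 * Real.pi * x) :=
      Circle.exp_eq_exp.2 ⟨r.num, by ring⟩
    rw [h4] at h2
    have h5 := congrArg h.symm h2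
    simp only [conjRot, ContinuousMap.coe_mk, Homeomorph.symm_apply_apply] at h5
    exact circleRot_ne hβ (by exact_mod_cast r.den_nz) _ h5
  obtain ⟨K, t, hK, hbd⟩ := exists_deriv_zpow_bound U hU1 hU2 hτ
  have hsm := contDiff_zpow U hU1 hU2
  let D : ℤ → ℝ → ℝ := fun n => deriv ((U ^ n : CircleDeg1Liftˣ) : ℝ → ℝ)
  have hex : ∀ n, ∃ e : C(Circle, ℂ), ∀ θ, e (Circle.exp θ) = (D n (θ / (2 * Real.pi)) : ℂ) := by
    intro n
    refine exists_continuousMap_of_periodic ?_ fun θ => ?_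
    · have : Continuous (D n) := (contDiff_infty_iff_deriv.1 (hsm n)).2.continuous
      fun_prop
    · rw [add_div, div_self hpi.ne']
      simp only [D]
      rw [CircleDeg1Lift.deriv_periodic]
  choose e he using hex
  refine ⟨e, K, t, hK, fun n => ?_, fun n b d hbd' θ => ?_⟩
  · refine norm_le_of_forall_exp (by positivity) fun θ => ?_
    rw [he, Complex.norm_real]
    exact hbd n _
  · have e1 : ∀ θ : ℝ, conjRot β h n (Circle.exp θ) =
        Circle.exp (2 * Real.pi * (U ^ n : CircleDeg1Liftˣ) (θ / (2 * Real.pi))) := fun θ => by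
      rw [← hlift, mul_div_cancel₀ _ hpi.ne']
    simp only [e1, he]
    have h1 : HasDerivAt (fun θ : ℝ => 2 * Real.pi * (U ^ n : CircleDeg1Liftˣ) (θ / (2 * Real.pi)))
        (D n (θ / (2 * Real.pi))) θ := by
      have h2 := (((hsm n).differentiable (by simp)) (θ / (2 * Real.pi))).hasDerivAt
      have h3 := (h2.comp θ ((hasDerivAt_id θ).div_const (2 * Real.pi))).const_mul (2 * Real.pi)
      have e2 : 2 * Real.pi * (D n (θ / (2 * Real.pi)) * (1 / (2 * Real.pi))) =
          D n (θ / (2 * Real.pi)) := by field_simp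
      rw [← e2]
      exact h3
    have h4 := (hbd' _).scomp θ h1
    simpa [Function.comp_def] using h4

namespace NCTorus

variable {α : ℝ}

/-! ## The regular representation -/

/-- A star subalgebra that contains the generators is dense. -/
theorem dense_of_mem (S : StarSubalgebra ℂ (NCTorus α)) (hU : (U α : NCTorus α) ∈ S)
    (hV : (V α : NCTorus α) ∈ S) : Dense (S : Set (NCTorus α)) := by
  have h1 : StarAlgebra.adjoin ℂ
      ({(TorusProd.U α : TorusProd α), (TorusProd.V α : TorusProd α)} : Set (TorusProd α)) ≤
      S.map (torusSubalgebra α).subtype := by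
    refine StarAlgebra.adjoin_le ?_
    rintro x (rfl | rfl)
    · exact ⟨_, hU, rfl⟩
    · exact ⟨_, hV, rfl⟩
  intro x
  rw [closure_subtype]
  exact closure_mono (fun y hy => h1 hy) x.2

/-- The regular representation. -/
def toReg : NCTorus α →⋆ₐ[ℂ] (RegSpace →L[ℂ] RegSpace) := evalRep (regRep α)

theorem continuous_toReg : Continuous (toReg : NCTorus α →⋆ₐ[ℂ] (RegSpace →L[ℂ] RegSpace)) :=
  (NonUnitalStarAlgHom.instContinuousLinearMapClassComplex (A := NCTorus α)
    (B := RegSpace →L[ℂ] RegSpace)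
    (F := NCTorus α →⋆ₐ[ℂ] (RegSpace →L[ℂ] RegSpace))).map_continuous toReg

theorem toReg_U_zpow (k : ℤ) : toReg ((U α ^ k : unitary (NCTorus α)) : NCTorus α) =
    ((regU ^ k : unitary (RegSpace →L[ℂ] RegSpace)) : RegSpace →L[ℂ] RegSpace) := by
  let φ : NCTorus α →⋆* (RegSpace →L[ℂ] RegSpace) := { toReg (α := α) with }
  have h : Unitary.map φ (U α) = regU := rfl
  rw [← h, ← map_zpow]
  rfl

theorem toReg_V_zpow (k : ℤ) : toReg ((V α ^ k : unitary (NCTorus α)) : NCTorus α) =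
    ((regV α ^ k : unitary (RegSpace →L[ℂ] RegSpace)) : RegSpace →L[ℂ] RegSpace) := by
  let φ : NCTorus α →⋆* (RegSpace →L[ℂ] RegSpace) := { toReg (α := α) with }
  have h : Unitary.map φ (V α) = regV α := rfl
  rw [← h, ← map_zpow]
  rfl

/-- The basis vectors of `ℓ²(ℤ²)`. -/
def basisVec (b : ℤ × ℤ) : RegSpace := lp.single 2 b (1 : ℂ)

theorem basisVec_apply (b c : ℤ × ℤ) : basisVec b c = if c = b then 1 else 0 := by
  rw [basisVec, lp.single_apply, Pi.single_apply]

/-- Right multiplication by `U^k V^l` in the regular representation. -/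
def rightShift (α : ℝ) (k l : ℤ) : RegSpace →L[ℂ] RegSpace :=
  ((weightedShift (Equiv.subRight (k, l))
    (fun b => Circle.exp (-4 * Real.pi * α * (b.2 - l) * k))).toContinuousLinearEquiv :
    RegSpace →L[ℂ] RegSpace)

theorem rightShift_apply (k l p q : ℤ) (ξ : RegSpace) : rightShift α k l ξ (p, q) =
    Complex.exp (-4 * Real.pi * α * (q - l) * k * Complex.I) * ξ (p - k, q - l) := by
  change ((Circle.exp (-4 * Real.pi * α * (q - l) * k) : Circle) : ℂ) * ξ (p - k, q - l) = _
  rw [Circle.coe_exp]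
  push_cast
  rfl

theorem rightShift_basisVec (k l : ℤ) : rightShift α k l (basisVec 0) = basisVec (k, l) := by
  ext ⟨p, q⟩
  rw [rightShift_apply, basisVec_apply, basisVec_apply]
  by_cases h : (p, q) = (k, l)
  · rw [if_pos h]
    obtain ⟨rfl, rfl⟩ := Prod.mk.inj h
    simp
  · rw [if_neg h, if_neg, mul_zero]
    intro h'
    obtain ⟨h1, h2⟩ := Prod.mk.inj h'
    exact h (by rw [sub_eq_zero.1 h1, sub_eq_zero.1 h2])

theorem commute_regU_rightShift (k l : ℤ) :
    Commute (regU : RegSpace →L[ℂ] RegSpace) (rightShift α k l) := by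
  ext ξ ⟨p, q⟩
  change (regU : RegSpace →L[ℂ] RegSpace) (rightShift α k l ξ) (p, q) =
    rightShift α k l ((regU : RegSpace →L[ℂ] RegSpace) ξ) (p, q)
  rw [regU_apply, rightShift_apply, rightShift_apply, regU_apply, sub_right_comm]

theorem commute_regV_rightShift (k l : ℤ) :
    Commute (regV α : RegSpace →L[ℂ] RegSpace) (rightShift α k l) := by
  ext ξ ⟨p, q⟩
  change (regV α : RegSpace →L[ℂ] RegSpace) (rightShift α k l ξ) (p, q) =
    rightShift α k l ((regV α : RegSpace →L[ℂ] RegSpace) ξ) (p, q)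
  rw [regV_apply, rightShift_apply, rightShift_apply, regV_apply, sub_right_comm, ← mul_assoc,
    ← mul_assoc, ← Complex.exp_add, ← Complex.exp_add]
  congr 2
  push_cast
  ring

theorem commute_star_of_unitary {B : Type*} [CStarAlgebra B] (u : unitary B) {x : B}
    (h : Commute (u : B) x) : Commute (star (u : B)) x := by
  have h1 : star (u : B) * u = 1 := Unitary.coe_star_mul_self u
  have h2 : (u : B) * star (u : B) = 1 := Unitary.coe_mul_star_self u
  calc star (u : B) * x = star (u : B) * (x * u) * star (u : B) := by
        rw [mul_assoc, mul_assoc, h2, mul_one]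
    _ = star (u : B) * (u * x) * star (u : B) := by rw [h.eq]
    _ = x * star (u : B) := by rw [← mul_assoc, h1, one_mul]

/-- Left and right regular representations commute: this holds for the generators and their
adjoints, and passes to the closure by continuity. -/
theorem toReg_commute_rightShift (A : NCTorus α) (k l : ℤ) :
    Commute (toReg A) (rightShift α k l) := by
  let Z : StarSubalgebra ℂ (NCTorus α) :=
    (StarSubalgebra.centralizer ℂ {rightShift α k l}).comap toReg
  have hU : (U α : NCTorus α) ∈ Z := by
    rw [StarSubalgebra.mem_comap, StarSubalgebra.mem_centralizer_iff]
    rintro _ rfl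
    have h := commute_star_of_unitary regU (commute_regU_rightShift (α := α) k l)
    refine ⟨(commute_regU_rightShift k l).symm.eq, ?_⟩
    have h2 := congrArg star h.eq
    rw [star_mul, star_mul, star_star] at h2
    exact h2
  have hV : (V α : NCTorus α) ∈ Z := by
    rw [StarSubalgebra.mem_comap, StarSubalgebra.mem_centralizer_iff]
    rintro _ rfl
    have h := commute_star_of_unitary (regV α) (commute_regV_rightShift (α := α) k l)
    refine ⟨(commute_regV_rightShift k l).symm.eq, ?_⟩
    have h2 := congrArg star h.eq
    rw [star_mul, star_mul, star_star] at h2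
    exact h2
  have hcl : IsClosed {A : NCTorus α | toReg A * rightShift α k l = rightShift α k l * toReg A} :=
    isClosed_eq (continuous_toReg.mul continuous_const) (continuous_const.mul continuous_toReg)
  have hsub : (Z : Set (NCTorus α)) ⊆
      {A : NCTorus α | toReg A * rightShift α k l = rightShift α k l * toReg A} := by
    intro A hA
    have := ((StarSubalgebra.mem_centralizer_iff ℂ).1 ((StarSubalgebra.mem_comap _ _ _).1 hA) _ rfl).1
    exact this.symm
  have := hcl.closure_subset_iff.2 hsub
  exact this (dense_of_mem Z hU hV A)

/-- The coefficients of `A` with respect to the elements `U^m V^n`. -/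
def regCoeff (A : NCTorus α) (m n : ℤ) : ℂ := toReg A (basisVec 0) (m, n)

/-- The right shifts move `basisVec 0` to every basis vector and commute with `toReg A`, so the
value at `basisVec 0` determines the operator. This makes faithfulness of the regular representation
unnecessary. -/
theorem toReg_eq_of_regCoeff_eq {A B : NCTorus α} (h : ∀ m n, regCoeff A m n = regCoeff B m n) :
    toReg A = toReg B := by
  have h0 : toReg A (basisVec 0) = toReg B (basisVec 0) := by
    ext ⟨m, n⟩
    exact h m n
  refine lp.ext_continuousLinearMap (by norm_num) fun b => ?_
  ext
  obtain ⟨k, l⟩ := b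
  have h1 : ∀ C : NCTorus α, toReg C (basisVec (k, l)) = rightShift α k l (toReg C (basisVec 0)) := by
    intro C
    rw [← rightShift_basisVec (α := α)]
    exact congrArg (fun T : RegSpace →L[ℂ] RegSpace => T (basisVec 0))
      (toReg_commute_rightShift C k l).eq
  have h2 : toReg A (basisVec (k, l)) = toReg B (basisVec (k, l)) := by rw [h1, h1, h0]
  simpa [basisVec] using congrArg (fun ξ : RegSpace => ξ _) h2

theorem norm_regCoeff_apply_le (T : RegSpace →L[ℂ] RegSpace) (b : ℤ × ℤ) :
    ‖T (basisVec 0) b‖ ≤ ‖T‖ := by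
  refine (lp.norm_apply_le_norm (by norm_num) _ _).trans ((T.le_opNorm _).trans ?_)
  rw [basisVec, lp.norm_single (by norm_num), norm_one, mul_one]

/-- `regCoeff` as a continuous linear functional on the operators on `ℓ²(ℤ²)`. -/
def vecCoeff (b : ℤ × ℤ) : (RegSpace →L[ℂ] RegSpace) →L[ℂ] ℂ :=
  LinearMap.mkContinuous
    { toFun := fun T => T (basisVec 0) b
      map_add' := fun _ _ => rfl
      map_smul' := fun _ _ => rfl } 1
    fun T => by rw [one_mul]; exact norm_regCoeff_apply_le T b

/-- `regCoeff` as a continuous linear functional. -/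
def regCoeffCLM (m n : ℤ) : NCTorus α →L[ℂ] ℂ :=
  (vecCoeff (m, n)).comp ⟨(toReg (α := α)).toAlgHom.toLinearMap, continuous_toReg⟩

theorem regCoeff_U_mul_V (k l m n : ℤ) :
    regCoeff (((U α ^ k : unitary (NCTorus α)) : NCTorus α) *
      ((V α ^ l : unitary (NCTorus α)) : NCTorus α)) m n = if (m, n) = (k, l) then 1 else 0 := by
  rw [regCoeff, map_mul, toReg_U_zpow, toReg_V_zpow]
  change ((regU ^ k : unitary (RegSpace →L[ℂ] RegSpace)) : RegSpace →L[ℂ] RegSpace)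
    (((regV α ^ l : unitary (RegSpace →L[ℂ] RegSpace)) : RegSpace →L[ℂ] RegSpace) (basisVec 0))
    (m, n) = _
  rw [regU_zpow_apply, regV_zpow_apply, basisVec_apply]
  by_cases h : (m, n) = (k, l)
  · rw [if_pos h]
    obtain ⟨rfl, rfl⟩ := Prod.mk.inj h
    simp
  · rw [if_neg h, if_neg, mul_zero]
    intro h'
    obtain ⟨h1, h2⟩ := Prod.mk.inj h'
    exact h (by rw [sub_eq_zero.1 h1, sub_eq_zero.1 h2])

/-- The factor is the Weyl normalization. As a function of `m` it is the Fourier multiplier of the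
rotation by `n α`, and the composition with `R^{-n}` in `straighten` removes it. -/
theorem coeff_eq (A : NCTorus α) (m n : ℤ) :
    coeff A m n = Complex.exp (2 * Real.pi * Complex.I * α * m * n) * regCoeff A m n := by
  have h1 : trace (weyl α (-m, -n) * A) = toReg (weyl α (-m, -n) * A) (basisVec 0) (0, 0) := rfl
  have h2 : toReg (weyl α (-m, -n)) =
      Complex.exp (-2 * Real.pi * Complex.I * α * (-m : ℤ) * (-n : ℤ)) •
      (((regU ^ (-m) : unitary (RegSpace →L[ℂ] RegSpace)) : RegSpace →L[ℂ] RegSpace) *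
        ((regV α ^ (-n) : unitary (RegSpace →L[ℂ] RegSpace)) : RegSpace →L[ℂ] RegSpace)) := by
    rw [weyl, map_smul, map_mul, toReg_U_zpow, toReg_V_zpow]
  rw [coeff, h1, map_mul, h2]
  change Complex.exp (-2 * Real.pi * Complex.I * α * (-m : ℤ) * (-n : ℤ)) *
    ((regU ^ (-m) : unitary (RegSpace →L[ℂ] RegSpace)) : RegSpace →L[ℂ] RegSpace)
    (((regV α ^ (-n) : unitary (RegSpace →L[ℂ] RegSpace)) : RegSpace →L[ℂ] RegSpace)
      (toReg A (basisVec 0))) (0, 0) = _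
  rw [regU_zpow_apply, regV_zpow_apply, ← mul_assoc, ← Complex.exp_add, regCoeff]
  simp only [sub_neg_eq_add, zero_add]
  congr 2
  push_cast
  ring

end NCTorus

/-! ## Fourier coefficients of continuous functions on the circle -/

/-- The monomial `z ^ k`. -/
def circleMono (k : ℤ) : C(Circle, ℂ) where
  toFun z := ((z ^ k : Circle) : ℂ)
  continuous_toFun :=
    (by fun_prop : Continuous fun z : Circle => (z : ℂ)).comp (continuous_zpow k)

theorem circleMono_apply (k : ℤ) (z : Circle) : circleMono k z = ((z ^ k : Circle) : ℂ) := rfl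

theorem span_circleMono_closure :
    (Submodule.span ℂ (Set.range circleMono)).topologicalClosure = ⊤ := by
  have hT : Fact ((0 : ℝ) < 2 * Real.pi) := ⟨Real.two_pi_pos⟩
  let L : C(AddCircle (2 * Real.pi), ℂ) →L[ℂ] C(Circle, ℂ) :=
    ContinuousMap.compCLM ℂ ℂ (AddCircle.homeomorphCircle'.symm : C(Circle, AddCircle (2 * Real.pi)))
  have hL : ∀ k, L (fourier k) = circleMono k := by
    intro k
    ext z
    obtain ⟨x, rfl⟩ := AddCircle.homeomorphCircle'.surjective z
    change fourier k (AddCircle.homeomorphCircle'.symm (AddCircle.homeomorphCircle' x)) = _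
    rw [Homeomorph.symm_apply_apply, fourier_apply, AddCircle.toCircle_zsmul, circleMono_apply]
    congr 2
    induction x using QuotientAddGroup.induction_on with
    | H x =>
      rw [AddCircle.toCircle_apply_mk, AddCircle.homeomorphCircle'_apply_mk,
        div_self Real.two_pi_pos.ne', one_mul]
  rw [eq_top_iff]
  intro a _
  have ha : a = L (a.comp ⟨_, AddCircle.homeomorphCircle'.continuous⟩) := by
    ext z
    change a z = a (AddCircle.homeomorphCircle' (AddCircle.homeomorphCircle'.symm z))
    rw [Homeomorph.apply_symm_apply]
  rw [ha]
  have h1 : (a.comp ⟨_, AddCircle.homeomorphCircle'.continuous⟩ : C(AddCircle (2 * Real.pi), ℂ)) ∈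
      (Submodule.span ℂ (Set.range (@fourier (2 * Real.pi)))).topologicalClosure := by
    rw [span_fourier_closure_eq_top]; trivial
  rw [← SetLike.mem_coe, Submodule.topologicalClosure_coe] at h1 ⊢
  refine map_mem_closure L.continuous h1 fun b hb => ?_
  have h2 : L b ∈ (Submodule.span ℂ (Set.range (@fourier (2 * Real.pi)))).map L.toLinearMap :=
    ⟨b, hb, rfl⟩
  rw [Submodule.map_span, ← Set.range_comp] at h2
  have h3 : (L.toLinearMap : C(AddCircle (2 * Real.pi), ℂ) → C(Circle, ℂ)) ∘ @fourier (2 * Real.pi) =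
      circleMono := funext hL
  rw [h3] at h2
  exact h2

theorem continuousLinearMap_ext_circleMono {E : Type*} [NormedAddCommGroup E] [NormedSpace ℂ E]
    {f g : C(Circle, ℂ) →L[ℂ] E} (h : ∀ k, f (circleMono k) = g (circleMono k)) : f = g := by
  refine ContinuousLinearMap.ext_on ?_ (s := Set.range circleMono) ?_
  · rw [dense_iff_closure_eq, ← Submodule.topologicalClosure_coe, span_circleMono_closure]
    rfl
  · rintro _ ⟨k, rfl⟩
    exact h k

theorem intervalIntegrable_mul_circleMono (a : C(Circle, ℂ)) (k : ℤ) (x y : ℝ) :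
    IntervalIntegrable (fun θ => a (Circle.exp θ) * (((Circle.exp θ) ^ k : Circle) : ℂ))
      MeasureTheory.volume x y :=
  Continuous.intervalIntegrable ((a.continuous.comp Circle.exp.continuous).mul
    ((circleMono k).continuous.comp Circle.exp.continuous)) _ _

/-- The Fourier coefficient `∫ a(z) z^{-m} dθ/2π`. -/
def circleCoeff (m : ℤ) : C(Circle, ℂ) →L[ℂ] ℂ :=
  LinearMap.mkContinuous
    { toFun := fun a => (2 * Real.pi : ℂ)⁻¹ *
        ∫ θ in (0 : ℝ)..(2 * Real.pi), a (Circle.exp θ) * (((Circle.exp θ) ^ (-m) : Circle) : ℂ)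
      map_add' := fun a b => by
        rw [← mul_add, ← intervalIntegral.integral_add]
        · congr 1
          refine intervalIntegral.integral_congr fun θ _ => ?_
          simp only [ContinuousMap.add_apply]
          ring
        · exact intervalIntegrable_mul_circleMono a _ _ _
        · exact intervalIntegrable_mul_circleMono b _ _ _
      map_smul' := fun c a => by
        simp only [ContinuousMap.smul_apply, smul_eq_mul, mul_assoc, RingHom.id_apply]
        rw [intervalIntegral.integral_const_mul]
        ring } 1
    fun a => by
      have hpi := Real.two_pi_pos
      have h := intervalIntegral.norm_integral_le_of_norm_le_const (a := (0 : ℝ))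
        (b := 2 * Real.pi) (C := ‖a‖)
        (f := fun θ => a (Circle.exp θ) * (((Circle.exp θ) ^ (-m) : Circle) : ℂ))
        (fun θ _ => by
          rw [norm_mul, Circle.norm_coe, mul_one]
          exact a.norm_coe_le_norm _)
      rw [sub_zero, abs_of_pos hpi] at h
      change ‖(2 * Real.pi : ℂ)⁻¹ * _‖ ≤ _
      rw [norm_mul, norm_inv, one_mul]
      have h2 : ‖(2 * Real.pi : ℂ)‖ = 2 * Real.pi := by
        rw [← Complex.ofReal_ofNat, ← Complex.ofReal_mul, Complex.norm_real, Real.norm_eq_abs,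
          abs_of_pos hpi]
      rw [h2]
      calc _ ≤ (2 * Real.pi)⁻¹ * (‖a‖ * (2 * Real.pi)) :=
            mul_le_mul_of_nonneg_left h (by positivity)
        _ = ‖a‖ := by field_simp

theorem circleCoeff_apply (m : ℤ) (a : C(Circle, ℂ)) : circleCoeff m a = (2 * Real.pi : ℂ)⁻¹ *
    ∫ θ in (0 : ℝ)..(2 * Real.pi), a (Circle.exp θ) * (((Circle.exp θ) ^ (-m) : Circle) : ℂ) := rfl

theorem circleCoeff_circleMono (m k : ℤ) :
    circleCoeff m (circleMono k) = if m = k then 1 else 0 := by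
  have hpi : (Real.pi : ℂ) ≠ 0 := by exact_mod_cast Real.pi_ne_zero
  have h1 : ∀ θ : ℝ, circleMono k (Circle.exp θ) * (((Circle.exp θ) ^ (-m) : Circle) : ℂ) =
      Complex.exp (((k - m : ℤ) * Complex.I : ℂ) * θ) := by
    intro θ
    rw [circleMono_apply, ← Circle.coe_mul, ← zpow_add, Circle.coe_zpow, Circle.coe_exp,
      ← Complex.exp_int_mul]
    congr 1
    push_cast
    ring
  rw [circleCoeff_apply]
  simp only [h1]
  by_cases h : m = k
  · subst h
    simp only [sub_self, Int.cast_zero, zero_mul, Complex.exp_zero, if_true]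
    rw [intervalIntegral.integral_const, sub_zero]
    simp only [Complex.real_smul, mul_one]
    push_cast
    field_simp
  · rw [if_neg h, integral_exp_mul_complex]
    · have h2 : Complex.exp (((k - m : ℤ) * Complex.I : ℂ) * (2 * Real.pi : ℝ)) = 1 := by
        rw [Complex.exp_eq_one_iff]
        exact ⟨k - m, by push_cast; ring⟩
      rw [h2]
      simp
    · have : ((k - m : ℤ) : ℂ) ≠ 0 := by exact_mod_cast sub_ne_zero.2 (Ne.symm h)
      exact mul_ne_zero this Complex.I_ne_zero

theorem isAntitransform_iff {c : ℤ → ℂ} (g : C(Circle, ℂ)) :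
    IsAntitransform c g ↔ ∀ m, circleCoeff m g = c m :=
  ⟨fun h m => h.2 m, fun h => ⟨g.continuous, h⟩⟩

/-- The rotation as a continuous map. -/
def circleRotMap (β : ℝ) : C(Circle, Circle) := ⟨circleRot β, continuous_circleRot β⟩

theorem circleMono_comp_rot (k : ℤ) (β : ℝ) : (circleMono k).comp (circleRotMap β) =
    Complex.exp (2 * Real.pi * Complex.I * β * k) • circleMono k := by
  ext z
  change ((circleRot β z ^ k : Circle) : ℂ) = _ * ((z ^ k : Circle) : ℂ)
  rw [circleRot, mul_zpow, Circle.coe_mul, Circle.coe_zpow, Circle.coe_exp, ← Complex.exp_int_mul]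
  congr 2
  push_cast
  ring

theorem circleCoeff_comp_rot (m : ℤ) (β : ℝ) (a : C(Circle, ℂ)) :
    circleCoeff m (a.comp (circleRotMap β)) =
      Complex.exp (2 * Real.pi * Complex.I * β * m) * circleCoeff m a := by
  have h : (circleCoeff m).comp (ContinuousMap.compCLM ℂ ℂ (circleRotMap β)) =
      Complex.exp (2 * Real.pi * Complex.I * β * m) • circleCoeff m := by
    refine continuousLinearMap_ext_circleMono fun k => ?_
    change circleCoeff m ((circleMono k).comp (circleRotMap β)) =
      Complex.exp (2 * Real.pi * Complex.I * β * m) • circleCoeff m (circleMono k)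
    rw [circleMono_comp_rot, map_smul, circleCoeff_circleMono]
    split_ifs with h
    · rw [h]
    · simp
  exact congrArg (fun L : C(Circle, ℂ) →L[ℂ] ℂ => L a) h

/-! ## Continuous functions of the generator `U` -/

namespace NCTorus

variable {α : ℝ}

theorem spectrum_U_subset : spectrum ℂ (U α : NCTorus α) ⊆ (Submonoid.unitSphere ℂ : Set ℂ) :=
  spectrum.subset_circle_of_unitary (U α).2

/-- The element `a(U)`, for a continuous function `a` on the circle. -/
def funU : C(Circle, ℂ) →⋆ₐ[ℂ] NCTorus α :=
  cfcHomSuperset (R := ℂ) (p := IsStarNormal) (a := (U α : NCTorus α))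
    (isStarNormal_of_mem_unitary (U α).2) spectrum_U_subset

theorem funU_circleMono_one : funU (circleMono 1) = (U α : NCTorus α) := by
  have h := cfcHomSuperset_id (R := ℂ) (p := IsStarNormal) (a := (U α : NCTorus α))
    (isStarNormal_of_mem_unitary (U α).2) spectrum_U_subset
  have h2 : circleMono 1 = (ContinuousMap.restrict (Submonoid.unitSphere ℂ : Set ℂ)
      (ContinuousMap.id ℂ) : C(Circle, ℂ)) := by
    ext z
    rw [circleMono_apply, zpow_one]
    rfl
  rw [h2]
  exact h

theorem norm_funU_le (a : C(Circle, ℂ)) : ‖(funU a : NCTorus α)‖ ≤ ‖a‖ :=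
  NonUnitalStarAlgHom.norm_apply_le (funU : C(Circle, ℂ) →⋆ₐ[ℂ] NCTorus α) a

/-- `funU` as a continuous linear map. -/
def funUCLM : C(Circle, ℂ) →L[ℂ] NCTorus α :=
  LinearMap.mkContinuous (funU (α := α)).toAlgHom.toLinearMap 1
    fun a => by rw [one_mul]; exact norm_funU_le a

/-- The coordinate function as a unitary. -/
def circleVar : unitary C(Circle, ℂ) :=
  ⟨circleMono 1, by
    rw [Unitary.mem_iff]
    constructor <;>
    · ext z
      have : (starRingEnd ℂ) (z : ℂ) * z = 1 := by
        rw [← Circle.coe_inv_eq_conj, ← Circle.coe_mul, inv_mul_cancel, Circle.coe_one]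
      simp [circleMono_apply, mul_comm (z : ℂ), this]⟩

theorem circleVar_zpow (k : ℤ) : ((circleVar ^ k : unitary C(Circle, ℂ)) : C(Circle, ℂ)) =
    circleMono k := by
  have key : ∀ n : ℕ, ((circleVar ^ n : unitary C(Circle, ℂ)) : C(Circle, ℂ)) = circleMono n := by
    intro n
    ext z
    rw [SubmonoidClass.coe_pow, ContinuousMap.pow_apply, circleMono_apply]
    simp [circleVar, circleMono_apply]
  obtain ⟨n, rfl | rfl⟩ := k.eq_nat_or_neg
  · rw [zpow_natCast, key]
  · rw [zpow_neg, zpow_natCast, ← Unitary.star_eq_inv, Unitary.coe_star, key]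
    ext z
    rw [ContinuousMap.star_apply, circleMono_apply, circleMono_apply, zpow_neg,
      Circle.coe_inv_eq_conj]
    rfl

theorem funU_circleMono (k : ℤ) :
    funU (circleMono k) = ((U α ^ k : unitary (NCTorus α)) : NCTorus α) := by
  let φ : C(Circle, ℂ) →⋆* NCTorus α := { funU (α := α) with }
  have h : Unitary.map φ circleVar = U α := Subtype.ext funU_circleMono_one
  rw [← h, ← map_zpow, ← circleVar_zpow]
  rfl

theorem regCoeff_funU_mul_V (a : C(Circle, ℂ)) (l m n : ℤ) :
    regCoeff (funU a * ((V α ^ l : unitary (NCTorus α)) : NCTorus α)) m n =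
      if n = l then circleCoeff m a else 0 := by
  let R : NCTorus α →L[ℂ] NCTorus α :=
    (ContinuousLinearMap.mul ℂ (NCTorus α)).flip ((V α ^ l : unitary (NCTorus α)) : NCTorus α)
  have h : (regCoeffCLM m n).comp (R.comp (funUCLM (α := α))) =
      (if n = l then (1 : ℂ) else 0) • circleCoeff m := by
    refine continuousLinearMap_ext_circleMono fun k => ?_
    change regCoeff (funU (circleMono k) * ((V α ^ l : unitary (NCTorus α)) : NCTorus α)) m n =
      (if n = l then (1 : ℂ) else 0) * circleCoeff m (circleMono k)
    rw [funU_circleMono, regCoeff_U_mul_V, circleCoeff_circleMono]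
    simp only [Prod.mk.injEq]
    split_ifs <;> simp_all
  have h2 := congrArg (fun L : C(Circle, ℂ) →L[ℂ] ℂ => L a) h
  change regCoeff (funU a * ((V α ^ l : unitary (NCTorus α)) : NCTorus α)) m n =
      (if n = l then (1 : ℂ) else 0) * circleCoeff m a at h2
  rw [h2]
  split_ifs <;> simp

theorem V_mul_U_zpow (k : ℤ) : (V α : NCTorus α) * ((U α ^ k : unitary (NCTorus α)) : NCTorus α) =
    Complex.exp (2 * Real.pi * Complex.I * (-(2 * α) : ℝ) * k) •
      (((U α ^ k : unitary (NCTorus α)) : NCTorus α) * (V α : NCTorus α)) := by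
  have h1 : (V α : NCTorus α) * (U α : NCTorus α) =
      Complex.exp (2 * Real.pi * Complex.I * (-(2 * α) : ℝ)) •
        ((U α : NCTorus α) * (V α : NCTorus α)) := by
    rw [U_mul_V, smul_smul, ← Complex.exp_add]
    have : 2 * Real.pi * Complex.I * (-(2 * α) : ℝ) + 4 * Real.pi * Complex.I * α = 0 := by
      push_cast; ring
    rw [this, Complex.exp_zero, one_smul]
  have key : ∀ n : ℕ, (V α : NCTorus α) * ((U α ^ n : unitary (NCTorus α)) : NCTorus α) =
      Complex.exp (2 * Real.pi * Complex.I * (-(2 * α) : ℝ) * n) •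
        (((U α ^ n : unitary (NCTorus α)) : NCTorus α) * (V α : NCTorus α)) := by
    intro n
    induction n with
    | zero => simp
    | succ n ih =>
      rw [pow_succ, Submonoid.coe_mul, ← mul_assoc, ih, smul_mul_assoc, mul_assoc _ _ (U α : NCTorus α), h1,
        mul_smul_comm, smul_smul, ← Complex.exp_add, ← mul_assoc]
      congr 2
      push_cast
      ring
  obtain ⟨n, rfl | rfl⟩ := k.eq_nat_or_neg
  · simpa using key n
  · have h2 := key n
    have h3 : ((U α ^ (-(n : ℤ)) : unitary (NCTorus α)) : NCTorus α) *
        ((U α ^ n : unitary (NCTorus α)) : NCTorus α) = 1 := by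
      rw [← Submonoid.coe_mul, zpow_neg, zpow_natCast, inv_mul_cancel, Submonoid.coe_one]
    have h4 : ((U α ^ n : unitary (NCTorus α)) : NCTorus α) *
        ((U α ^ (-(n : ℤ)) : unitary (NCTorus α)) : NCTorus α) = 1 := by
      rw [← Submonoid.coe_mul, zpow_neg, zpow_natCast, mul_inv_cancel, Submonoid.coe_one]
    generalize ((U α ^ (-(n : ℤ)) : unitary (NCTorus α)) : NCTorus α) = x at *
    generalize ((U α ^ n : unitary (NCTorus α)) : NCTorus α) = y at *
    have h5 : x * ((V α : NCTorus α) * y) * x = x * (V α : NCTorus α) := by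
      rw [mul_assoc, mul_assoc, h4, mul_one]
    rw [h2, mul_smul_comm, ← mul_assoc, h3, one_mul, smul_mul_assoc] at h5
    rw [← h5, smul_smul, ← Complex.exp_add]
    have : 2 * Real.pi * Complex.I * (-(2 * α) : ℝ) * ((-(n : ℤ) : ℤ) : ℂ) +
        2 * Real.pi * Complex.I * (-(2 * α) : ℝ) * n = 0 := by
      push_cast; ring
    rw [this, Complex.exp_zero, one_smul]

theorem V_mul_funU (a : C(Circle, ℂ)) : (V α : NCTorus α) * funU a =
    funU (a.comp (circleRotMap (-(2 * α)))) * (V α : NCTorus α) := by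
  let R : NCTorus α →L[ℂ] NCTorus α := (ContinuousLinearMap.mul ℂ (NCTorus α)).flip (V α)
  let L : NCTorus α →L[ℂ] NCTorus α := ContinuousLinearMap.mul ℂ (NCTorus α) (V α)
  have h : L.comp funUCLM =
      R.comp (funUCLM.comp (ContinuousMap.compCLM ℂ ℂ (circleRotMap (-(2 * α))))) := by
    refine continuousLinearMap_ext_circleMono fun k => ?_
    change (V α : NCTorus α) * funU (circleMono k) =
      funU ((circleMono k).comp (circleRotMap (-(2 * α)))) * (V α : NCTorus α)
    rw [circleMono_comp_rot, map_smul, funU_circleMono, V_mul_U_zpow, smul_mul_assoc]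
  exact congrArg (fun L : C(Circle, ℂ) →L[ℂ] NCTorus α => L a) h

theorem V_zpow_mul_funU (k : ℤ) (a : C(Circle, ℂ)) :
    ((V α ^ k : unitary (NCTorus α)) : NCTorus α) * funU a =
      funU (a.comp (circleRotMap (-(k * (2 * α))))) *
        ((V α ^ k : unitary (NCTorus α)) : NCTorus α) := by
  have hcomp : ∀ (β γ : ℝ) (a : C(Circle, ℂ)),
      (a.comp (circleRotMap β)).comp (circleRotMap γ) = a.comp (circleRotMap (β + γ)) := by
    intro β γ a
    ext z
    exact congrArg a (circleRot_add β γ z)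
  have h0 : ∀ a : C(Circle, ℂ), a.comp (circleRotMap 0) = a := by
    intro a
    ext z
    exact congrArg a (circleRot_zero z)
  have key : ∀ (n : ℕ) (a : C(Circle, ℂ)), ((V α ^ n : unitary (NCTorus α)) : NCTorus α) * funU a =
      funU (a.comp (circleRotMap (-(n * (2 * α))))) *
        ((V α ^ n : unitary (NCTorus α)) : NCTorus α) := by
    intro n
    induction n with
    | zero => intro a; simp [h0]
    | succ n ih =>
      intro a
      rw [pow_succ, Submonoid.coe_mul, mul_assoc, V_mul_funU, ← mul_assoc, ih, hcomp, mul_assoc]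
      congr 4
      push_cast
      ring
  obtain ⟨n, rfl | rfl⟩ := k.eq_nat_or_neg
  · simpa using key n a
  · have h2 := key n (a.comp (circleRotMap (n * (2 * α))))
    rw [hcomp, add_neg_cancel, h0] at h2
    have h3 : ((V α ^ (-(n : ℤ)) : unitary (NCTorus α)) : NCTorus α) *
        ((V α ^ n : unitary (NCTorus α)) : NCTorus α) = 1 := by
      rw [← Submonoid.coe_mul, zpow_neg, zpow_natCast, inv_mul_cancel, Submonoid.coe_one]
    have h4 : ((V α ^ n : unitary (NCTorus α)) : NCTorus α) *
        ((V α ^ (-(n : ℤ)) : unitary (NCTorus α)) : NCTorus α) = 1 := by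
      rw [← Submonoid.coe_mul, zpow_neg, zpow_natCast, mul_inv_cancel, Submonoid.coe_one]
    have e : -(((-(n : ℤ) : ℤ) : ℝ) * (2 * α)) = n * (2 * α) := by push_cast; ring
    rw [e]
    generalize ((V α ^ (-(n : ℤ)) : unitary (NCTorus α)) : NCTorus α) = x at *
    generalize ((V α ^ n : unitary (NCTorus α)) : NCTorus α) = y at *
    calc x * funU a = x * (funU a * y) * x := by rw [mul_assoc, mul_assoc, h4, mul_one]
      _ = _ := by rw [← h2, ← mul_assoc, h3, one_mul]

end NCTorus

/-! ## Rapidly decreasing sequences of functions on the circle -/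

/-- The polynomially weighted `ℓ¹`-norm of a sequence of continuous functions. -/
def qnorm (s : ℕ) (b : ℤ → C(Circle, ℂ)) : ℝ≥0∞ :=
  ∑' n : ℤ, ((n.natAbs : ℝ≥0∞) + 1) ^ s * ‖b n‖ₑ

theorem enorm_mul_le_circle (a b : C(Circle, ℂ)) : ‖a * b‖ₑ ≤ ‖a‖ₑ * ‖b‖ₑ := by
  simp only [enorm_eq_nnnorm]
  rw [← ENNReal.coe_mul]
  exact ENNReal.coe_le_coe.2 (nnnorm_mul_le a b)

theorem enorm_comp_le_circle (a : C(Circle, ℂ)) (f : C(Circle, Circle)) : ‖a.comp f‖ₑ ≤ ‖a‖ₑ := by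
  rw [enorm_le_iff_norm_le]
  exact (ContinuousMap.norm_le _ (norm_nonneg _)).2 fun z => a.norm_coe_le_norm _

theorem one_le_weight (n : ℤ) (s : ℕ) : 1 ≤ ((n.natAbs : ℝ≥0∞) + 1) ^ s :=
  one_le_pow₀ le_add_self

theorem enorm_le_qnorm (s : ℕ) (b : ℤ → C(Circle, ℂ)) (n : ℤ) : ‖b n‖ₑ ≤ qnorm s b :=
  (le_mul_of_one_le_left zero_le (one_le_weight n s)).trans
    (ENNReal.le_tsum (f := fun n : ℤ => ((n.natAbs : ℝ≥0∞) + 1) ^ s * ‖b n‖ₑ) n)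

theorem summable_norm_of_qnorm {s : ℕ} {b : ℤ → C(Circle, ℂ)} (h : qnorm s b < ⊤) :
    Summable fun n => ‖b n‖ := by
  rw [← tsum_enorm_ne_top_iff_summable_norm]
  refine (lt_of_le_of_lt (ENNReal.tsum_le_tsum fun n => ?_) h).ne
  exact le_mul_of_one_le_left zero_le (one_le_weight n s)

theorem qnorm_add_le (s : ℕ) (b c : ℤ → C(Circle, ℂ)) :
    qnorm s (fun n => b n + c n) ≤ qnorm s b + qnorm s c := by
  rw [qnorm, qnorm, qnorm, ← ENNReal.tsum_add]
  refine ENNReal.tsum_le_tsum fun n => ?_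
  rw [← mul_add]
  gcongr
  exact enorm_add_le _ _

theorem qnorm_smul_le (s : ℕ) (r : ℂ) (b : ℤ → C(Circle, ℂ)) :
    qnorm s (fun n => r • b n) ≤ ‖r‖ₑ * qnorm s b := by
  rw [qnorm, qnorm, ← ENNReal.tsum_mul_left]
  refine ENNReal.tsum_le_tsum fun n => ?_
  rw [mul_left_comm]
  gcongr
  exact (enorm_smul r (b n)).le

theorem qnorm_tsum_le (s : ℕ) (b : ℕ → ℤ → C(Circle, ℂ)) :
    qnorm s (fun n => ∑' r, b r n) ≤ ∑' r, qnorm s (b r) := by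
  simp only [qnorm]
  rw [ENNReal.tsum_comm]
  refine ENNReal.tsum_le_tsum fun n => ?_
  rw [ENNReal.tsum_mul_left]
  gcongr
  exact enorm_tsum_le_tsum_enorm

theorem qnorm_zero (s : ℕ) : qnorm s (fun _ => 0) = 0 := by
  simp [qnorm]

theorem qnorm_single (s : ℕ) (l : ℤ) (a : C(Circle, ℂ)) :
    qnorm s (fun n => if n = l then a else 0) = ((l.natAbs : ℝ≥0∞) + 1) ^ s * ‖a‖ₑ := by
  rw [qnorm, tsum_eq_single l]
  · simp
  · intro n hn
    simp [hn]

/-- Multiplication by a sequence of polynomial growth. -/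
theorem qnorm_mul_le (s t : ℕ) (K : ℝ≥0∞) (b e : ℤ → C(Circle, ℂ))
    (h : ∀ n, ‖e n‖ₑ ≤ K * ((n.natAbs : ℝ≥0∞) + 1) ^ t) :
    qnorm s (fun n => b n * e n) ≤ K * qnorm (s + t) b := by
  rw [qnorm, qnorm, ← ENNReal.tsum_mul_left]
  refine ENNReal.tsum_le_tsum fun n => ?_
  calc _ ≤ ((n.natAbs : ℝ≥0∞) + 1) ^ s * (‖b n‖ₑ * (K * ((n.natAbs : ℝ≥0∞) + 1) ^ t)) := by
        gcongr
        exact (enorm_mul_le_circle _ _).trans (by gcongr; exact h n)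
    _ = _ := by ring

theorem qnorm_star_comp_le (s : ℕ) (b : ℤ → C(Circle, ℂ)) (f : ℤ → C(Circle, Circle)) :
    qnorm s (fun n => (star (b (-n))).comp (f n)) ≤ qnorm s b := by
  have h1 : qnorm s b = ∑' n : ℤ, ((n.natAbs : ℝ≥0∞) + 1) ^ s * ‖b (-n)‖ₑ := by
    rw [qnorm, ← (Equiv.neg ℤ).tsum_eq]
    simp
  rw [h1, qnorm]
  refine ENNReal.tsum_le_tsum fun n => ?_
  gcongr
  refine (enorm_comp_le_circle _ _).trans ?_
  rw [enorm_le_iff_norm_le, norm_star]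

/-- Convolution twisted by a sequence of maps of the circle. -/
def twistedConv (ψ : ℤ → C(Circle, Circle)) (b c : ℤ → C(Circle, ℂ)) (n : ℤ) : C(Circle, ℂ) :=
  ∑' k, b k * (c (n - k)).comp (ψ k)

theorem weight_sub_le (n k : ℤ) (s : ℕ) : ((n.natAbs : ℝ≥0∞) + 1) ^ s ≤
    ((k.natAbs : ℝ≥0∞) + 1) ^ s * (((n - k).natAbs : ℝ≥0∞) + 1) ^ s := by
  rw [← mul_pow]
  gcongr
  have h : n.natAbs + 1 ≤ (k.natAbs + 1) * ((n - k).natAbs + 1) := by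
    have h1 : n.natAbs ≤ k.natAbs + (n - k).natAbs := by omega
    nlinarith [Nat.zero_le (k.natAbs * (n - k).natAbs)]
  exact_mod_cast h

/-- Composition with a circle map does not increase the supremum norm, so the twist is harmless
here; the rest is submultiplicativity of the weight (`weight_sub_le`). -/
theorem qnorm_twistedConv_le (s : ℕ) (ψ : ℤ → C(Circle, Circle)) (b c : ℤ → C(Circle, ℂ)) :
    qnorm s (twistedConv ψ b c) ≤ qnorm s b * qnorm s c := by
  calc qnorm s (twistedConv ψ b c)
      ≤ ∑' n : ℤ, ∑' k : ℤ, (((k.natAbs : ℝ≥0∞) + 1) ^ s * ‖b k‖ₑ) *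
          ((((n - k).natAbs : ℝ≥0∞) + 1) ^ s * ‖c (n - k)‖ₑ) := by
        refine ENNReal.tsum_le_tsum fun n => ?_
        refine (mul_le_mul_right enorm_tsum_le_tsum_enorm _).trans ?_
        rw [← ENNReal.tsum_mul_left]
        refine ENNReal.tsum_le_tsum fun k => ?_
        calc _ ≤ (((k.natAbs : ℝ≥0∞) + 1) ^ s * (((n - k).natAbs : ℝ≥0∞) + 1) ^ s) *
              (‖b k‖ₑ * ‖c (n - k)‖ₑ) := by
              refine mul_le_mul' (weight_sub_le n k s) ((enorm_mul_le_circle _ _).trans ?_)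
              gcongr
              exact enorm_comp_le_circle _ _
          _ = _ := by ring
    _ = ∑' k : ℤ, (((k.natAbs : ℝ≥0∞) + 1) ^ s * ‖b k‖ₑ) *
          ∑' n : ℤ, ((((n - k).natAbs : ℝ≥0∞) + 1) ^ s * ‖c (n - k)‖ₑ) := by
        rw [ENNReal.tsum_comm]
        simp only [ENNReal.tsum_mul_left]
    _ = ∑' k : ℤ, (((k.natAbs : ℝ≥0∞) + 1) ^ s * ‖b k‖ₑ) * qnorm s c := by
        refine tsum_congr fun k => ?_
        rw [qnorm, ← (Equiv.subRight k).tsum_eq (fun n : ℤ => ((n.natAbs : ℝ≥0∞) + 1) ^ s * ‖c n‖ₑ)]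
        simp
    _ = _ := by rw [ENNReal.tsum_mul_right, qnorm, qnorm]

theorem summable_norm_twistedConv (ψ : ℤ → C(Circle, Circle)) {b c : ℤ → C(Circle, ℂ)}
    (hb : qnorm 0 b < ⊤) (hc : qnorm 0 c < ⊤) (n : ℤ) :
    Summable fun k => ‖b k * (c (n - k)).comp (ψ k)‖ := by
  rw [← tsum_enorm_ne_top_iff_summable_norm]
  refine (lt_of_le_of_lt (b := qnorm 0 b * qnorm 0 c) ?_ (ENNReal.mul_lt_top hb hc)).ne
  calc _ ≤ ∑' k, ‖b k‖ₑ * qnorm 0 c := by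
        refine ENNReal.tsum_le_tsum fun k => (enorm_mul_le_circle _ _).trans ?_
        gcongr
        exact (enorm_comp_le_circle _ _).trans (enorm_le_qnorm 0 c _)
    _ = _ := by
        rw [ENNReal.tsum_mul_right]
        congr 1
        simp [qnorm]

/-! ### Derivatives -/

namespace HasAngleDeriv

theorem add {a b d e : C(Circle, ℂ)} (h1 : HasAngleDeriv a d) (h2 : HasAngleDeriv b e) :
    HasAngleDeriv (a + b : C(Circle, ℂ)) (d + e : C(Circle, ℂ)) :=
  fun θ => (h1 θ).add (h2 θ)

theorem smul (r : ℂ) {a d : C(Circle, ℂ)} (h : HasAngleDeriv a d) :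
    HasAngleDeriv (r • a : C(Circle, ℂ)) (r • d : C(Circle, ℂ)) :=
  fun θ => (h θ).const_smul r

theorem mul {a b d e : C(Circle, ℂ)} (h1 : HasAngleDeriv a d) (h2 : HasAngleDeriv b e) :
    HasAngleDeriv (a * b : C(Circle, ℂ)) (d * b + a * e : C(Circle, ℂ)) :=
  fun θ => (h1 θ).mul (h2 θ)

theorem star {a d : C(Circle, ℂ)} (h : HasAngleDeriv a d) :
    HasAngleDeriv (star a : C(Circle, ℂ)) (star d : C(Circle, ℂ)) :=
  fun θ => (h θ).star

theorem const (r : ℂ) : HasAngleDeriv (algebraMap ℂ C(Circle, ℂ) r) (0 : C(Circle, ℂ)) :=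
  fun θ => hasDerivAt_const θ r

theorem zero : HasAngleDeriv (0 : C(Circle, ℂ)) (0 : C(Circle, ℂ)) :=
  fun θ => hasDerivAt_const θ 0

theorem circleMono (k : ℤ) :
    HasAngleDeriv (circleMono k) ((Complex.I * k) • circleMono k : C(Circle, ℂ)) := by
  have h : ∀ θ : ℝ, _root_.circleMono k (Circle.exp θ) = Complex.exp (Complex.I * k * θ) := by
    intro θ
    rw [circleMono_apply, Circle.coe_zpow, Circle.coe_exp, ← Complex.exp_int_mul]
    congr 1
    ring
  intro θ
  have h1 : HasDerivAt (fun t : ℝ => Complex.I * k * (t : ℂ)) (Complex.I * k) θ := by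
    simpa using (Complex.ofRealCLM.hasDerivAt (x := θ)).const_mul (Complex.I * k)
  have h2 := h1.cexp
  simp only [h, ContinuousMap.smul_apply, smul_eq_mul]
  rw [mul_comm (Complex.exp _) (Complex.I * k)] at h2
  exact h2

theorem tsum {ι : Type*} {b d : ι → C(Circle, ℂ)} (h : ∀ i, HasAngleDeriv (b i) (d i))
    (hb : Summable fun i => ‖b i‖) (hd : Summable fun i => ‖d i‖) :
    HasAngleDeriv (∑' i, b i : C(Circle, ℂ)) (∑' i, d i : C(Circle, ℂ)) := by
  intro θ
  have hb' : Summable b := hb.of_norm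
  have hd' : Summable d := hd.of_norm
  simp only [← ContinuousMap.tsum_apply hb', ← ContinuousMap.tsum_apply hd']
  refine hasDerivAt_tsum (𝕜 := ℝ) (g := fun i t => b i (Circle.exp t))
    (g' := fun i t => d i (Circle.exp t)) hd (fun i t => h i t)
    (fun i t => (d i).norm_coe_le_norm _) (y₀ := 0) ?_ θ
  exact Summable.of_norm_bounded hb fun i => (b i).norm_coe_le_norm _

end HasAngleDeriv

/-- `d` is the sequence of derivatives of `b`, and both are rapidly decreasing. -/
structure IsSmoothSeq (b d : ℤ → C(Circle, ℂ)) : Prop where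
  hasDeriv : ∀ n, HasAngleDeriv (b n) (d n)
  left : ∀ s, qnorm s b < ⊤
  right : ∀ s, qnorm s d < ⊤

theorem IsSmoothSeq.add {b d b' d' : ℤ → C(Circle, ℂ)} (h : IsSmoothSeq b d)
    (h' : IsSmoothSeq b' d') : IsSmoothSeq (fun n => b n + b' n) (fun n => d n + d' n) where
  hasDeriv n := (h.hasDeriv n).add (h'.hasDeriv n)
  left s := (qnorm_add_le s b b').trans_lt (ENNReal.add_lt_top.2 ⟨h.left s, h'.left s⟩)
  right s := (qnorm_add_le s d d').trans_lt (ENNReal.add_lt_top.2 ⟨h.right s, h'.right s⟩)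

theorem IsSmoothSeq.single (l : ℤ) {a d : C(Circle, ℂ)} (h : HasAngleDeriv a d) :
    IsSmoothSeq (fun n => if n = l then a else 0) (fun n => if n = l then d else 0) where
  hasDeriv n := by
    by_cases hn : n = l
    · simpa only [hn, if_true] using h
    · simpa only [hn, if_false] using HasAngleDeriv.zero
  left s := by
    rw [qnorm_single]
    exact ENNReal.mul_lt_top (by finiteness) enorm_lt_top
  right s := by
    rw [qnorm_single]
    exact ENNReal.mul_lt_top (by finiteness) enorm_lt_top

/-- A sequence of maps of the circle with derivatives of polynomial growth. -/
structure IsTempered (ψ : ℤ → C(Circle, Circle)) (e : ℤ → C(Circle, ℂ)) (K : ℝ≥0∞) (t : ℕ) :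
    Prop where
  ne_top : K ≠ ⊤
  bound : ∀ n, ‖e n‖ₑ ≤ K * ((n.natAbs : ℝ≥0∞) + 1) ^ t
  hasDeriv : ∀ n (b d : C(Circle, ℂ)), HasAngleDeriv b d →
    HasAngleDeriv (b.comp (ψ n)) (e n * d.comp (ψ n) : C(Circle, ℂ))

/-- The derivative of a twisted convolution. -/
def twistedConvDeriv (ψ : ℤ → C(Circle, Circle)) (e b d c d' : ℤ → C(Circle, ℂ)) (n : ℤ) :
    C(Circle, ℂ) :=
  twistedConv ψ d c n + twistedConv ψ (fun k => b k * e k) d' n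

theorem qnorm_twistedConvDeriv_le (s : ℕ) (ψ : ℤ → C(Circle, Circle))
    (e b d c d' : ℤ → C(Circle, ℂ)) : qnorm s (twistedConvDeriv ψ e b d c d') ≤
      qnorm s d * qnorm s c + qnorm s (fun k => b k * e k) * qnorm s d' :=
  (qnorm_add_le s _ _).trans
    (add_le_add (qnorm_twistedConv_le s ψ d c) (qnorm_twistedConv_le s ψ _ d'))

namespace IsTempered

variable {ψ : ℤ → C(Circle, Circle)} {e : ℤ → C(Circle, ℂ)} {K : ℝ≥0∞} {t : ℕ}

theorem qnorm_mul_lt_top (hψ : IsTempered ψ e K t) {b : ℤ → C(Circle, ℂ)}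
    (hb : ∀ s, qnorm s b < ⊤) (s : ℕ) : qnorm s (fun k => b k * e k) < ⊤ :=
  (qnorm_mul_le s t K b e hψ.bound).trans_lt (ENNReal.mul_lt_top hψ.ne_top.lt_top (hb _))

/-- In the termwise derivative the chain rule factor `e k` depends on the index of the left factor
only and is attached to `b k`; its growth costs `t` powers of the weight, which `b` can spare. -/
theorem conv (hψ : IsTempered ψ e K t) {b d c d' : ℤ → C(Circle, ℂ)} (h : IsSmoothSeq b d)
    (h' : IsSmoothSeq c d') :
    IsSmoothSeq (twistedConv ψ b c) (twistedConvDeriv ψ e b d c d') where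
  hasDeriv n := by
    have h1 : ∀ k, HasAngleDeriv (b k * (c (n - k)).comp (ψ k) : C(Circle, ℂ))
        (d k * (c (n - k)).comp (ψ k) + b k * e k * (d' (n - k)).comp (ψ k) : C(Circle, ℂ)) := by
      intro k
      have := (h.hasDeriv k).mul (hψ.hasDeriv k _ _ (h'.hasDeriv (n - k)))
      rwa [← mul_assoc] at this
    have s1 := summable_norm_twistedConv ψ (h.left 0) (h'.left 0) n
    have s2 := summable_norm_twistedConv ψ (h.right 0) (h'.left 0) n
    have s3 := summable_norm_twistedConv ψ (hψ.qnorm_mul_lt_top h.left 0) (h'.right 0) n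
    have h2 := HasAngleDeriv.tsum h1 s1
      (Summable.of_nonneg_of_le (fun _ => norm_nonneg _) (fun _ => norm_add_le _ _) (s2.add s3))
    rw [Summable.tsum_add s2.of_norm s3.of_norm] at h2
    exact h2
  left s := (qnorm_twistedConv_le s ψ b c).trans_lt (ENNReal.mul_lt_top (h.left s) (h'.left s))
  right s := (qnorm_twistedConvDeriv_le s ψ e b d c d').trans_lt (ENNReal.add_lt_top.2
    ⟨ENNReal.mul_lt_top (h.right s) (h'.left s),
      ENNReal.mul_lt_top (hψ.qnorm_mul_lt_top h.left s) (h'.right s)⟩)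

theorem star (hψ : IsTempered ψ e K t) {b d : ℤ → C(Circle, ℂ)} (h : IsSmoothSeq b d) :
    IsSmoothSeq (fun n => (star (b (-n))).comp (ψ n))
      (fun n => (star (d (-n))).comp (ψ n) * e n) where
  hasDeriv n := by
    have := hψ.hasDeriv n _ _ (h.hasDeriv (-n)).star
    rwa [mul_comm] at this
  left s := (qnorm_star_comp_le s b ψ).trans_lt (h.left s)
  right s := hψ.qnorm_mul_lt_top (fun s => (qnorm_star_comp_le s d ψ).trans_lt (h.right s)) s

end IsTempered

/-! ### Power series -/

/-- The sequences that represent the powers of an element. -/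
def convPow (ψ : ℤ → C(Circle, Circle)) (b : ℤ → C(Circle, ℂ)) : ℕ → ℤ → C(Circle, ℂ)
  | 0 => fun n => if n = 0 then 1 else 0
  | r + 1 => twistedConv ψ b (convPow ψ b r)

/-- The derivatives of `convPow`. -/
def convPowDeriv (ψ : ℤ → C(Circle, Circle)) (e b d : ℤ → C(Circle, ℂ)) :
    ℕ → ℤ → C(Circle, ℂ)
  | 0 => fun _ => 0
  | r + 1 => twistedConvDeriv ψ e b d (convPow ψ b r) (convPowDeriv ψ e b d r)

theorem qnorm_convPow_le (s : ℕ) (ψ : ℤ → C(Circle, Circle)) (b : ℤ → C(Circle, ℂ)) (r : ℕ) :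
    qnorm s (convPow ψ b r) ≤ qnorm s b ^ r := by
  induction r with
  | zero => rw [convPow, qnorm_single]; simp
  | succ r ih =>
    rw [pow_succ']
    exact (qnorm_twistedConv_le s ψ b _).trans (by gcongr)

/-- The loss of weight does not accumulate: each step multiplies by `d` or by `b k * e k` from the
left, and both have norm at most the same `M`. The recursion gives `M * M ^ r + M * (r * M ^ r)`. -/
theorem qnorm_convPowDeriv_le (s : ℕ) (ψ : ℤ → C(Circle, Circle)) (e b d : ℤ → C(Circle, ℂ))
    (M : ℝ≥0∞) (h1 : qnorm s b ≤ M) (h2 : qnorm s d ≤ M) (h3 : qnorm s (fun k => b k * e k) ≤ M)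
    (r : ℕ) : qnorm s (convPowDeriv ψ e b d r) ≤ r * M ^ r := by
  induction r with
  | zero => simp [convPowDeriv, qnorm_zero]
  | succ r ih =>
    refine (qnorm_twistedConvDeriv_le s ψ e b d _ _).trans ?_
    calc _ ≤ M * M ^ r + M * (r * M ^ r) := by
          gcongr
          exact (qnorm_convPow_le s ψ b r).trans (by gcongr)
      _ = _ := by push_cast; ring

theorem IsTempered.convPow {ψ : ℤ → C(Circle, Circle)} {e : ℤ → C(Circle, ℂ)} {K : ℝ≥0∞} {t : ℕ}
    (hψ : IsTempered ψ e K t) {b d : ℤ → C(Circle, ℂ)} (h : IsSmoothSeq b d) (r : ℕ) :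
    IsSmoothSeq (convPow ψ b r) (convPowDeriv ψ e b d r) := by
  induction r with
  | zero =>
    have h1 : HasAngleDeriv (1 : C(Circle, ℂ)) (0 : C(Circle, ℂ)) := by
      simpa using HasAngleDeriv.const 1
    have h2 : convPowDeriv ψ e b d 0 = fun n : ℤ => if n = 0 then (0 : C(Circle, ℂ)) else 0 := by
      funext n
      rw [ite_self]
      rfl
    rw [h2]
    exact IsSmoothSeq.single 0 h1
  | succ r ih => exact hψ.conv h ih

theorem tsum_enorm_mul_pow_lt_top {F : ℂ → ℂ} (hF : Differentiable ℂ F) {M : ℝ≥0∞} (hM : M ≠ ⊤) :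
    ∑' r : ℕ, ‖(r.factorial : ℂ)⁻¹ * iteratedDeriv r F 0‖ₑ * M ^ r < ⊤ := by
  lift M to NNReal using hM
  have h1 := (Complex.hasSum_taylorSeries_of_entire hF 0 ((M : ℝ) : ℂ)).summable.norm
  have h2 := (tsum_enorm_ne_top_iff_summable_norm (f := fun r : ℕ =>
    (r.factorial : ℂ)⁻¹ • (((M : ℝ) : ℂ) - 0) ^ r • iteratedDeriv r F 0)).2 h1
  refine lt_of_le_of_lt (ENNReal.tsum_le_tsum fun r => ?_) h2.lt_top
  refine le_of_eq ?_
  rw [sub_zero]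
  simp only [smul_eq_mul, enorm_mul, enorm_pow]
  have : ‖((M : ℝ) : ℂ)‖ₑ = M := by
    rw [enorm_eq_nnnorm]; congr 1; ext; simp
  rw [this]
  ring

theorem IsTempered.entire {ψ : ℤ → C(Circle, Circle)} {e : ℤ → C(Circle, ℂ)} {K : ℝ≥0∞} {t : ℕ}
    (hψ : IsTempered ψ e K t) {b d : ℤ → C(Circle, ℂ)} (h : IsSmoothSeq b d) {F : ℂ → ℂ}
    (hF : Differentiable ℂ F) :
    (∀ n, Summable fun r => ‖((r.factorial : ℂ)⁻¹ * iteratedDeriv r F 0) • _root_.convPow ψ b r n‖) ∧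
    IsSmoothSeq
      (fun n => ∑' r, ((r.factorial : ℂ)⁻¹ * iteratedDeriv r F 0) • _root_.convPow ψ b r n)
      (fun n => ∑' r, ((r.factorial : ℂ)⁻¹ * iteratedDeriv r F 0) • convPowDeriv ψ e b d r n) := by
  set c : ℕ → ℂ := fun r => (r.factorial : ℂ)⁻¹ * iteratedDeriv r F 0 with hc
  have hb : ∀ s, ∑' r, qnorm s (fun n => c r • _root_.convPow ψ b r n) < ⊤ := by
    intro s
    refine lt_of_le_of_lt (ENNReal.tsum_le_tsum fun r => ?_)
      (tsum_enorm_mul_pow_lt_top hF (h.left s).ne)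
    exact (qnorm_smul_le s _ _).trans (by gcongr; exact qnorm_convPow_le s ψ b r)
  have hd : ∀ s, ∑' r, qnorm s (fun n => c r • convPowDeriv ψ e b d r n) < ⊤ := by
    intro s
    let M := qnorm s b + qnorm s d + qnorm s (fun k => b k * e k)
    have hM : M ≠ ⊤ := (ENNReal.add_lt_top.2 ⟨ENNReal.add_lt_top.2 ⟨h.left s, h.right s⟩,
      hψ.qnorm_mul_lt_top h.left s⟩).ne
    refine lt_of_le_of_lt (ENNReal.tsum_le_tsum fun r => ?_)
      -- The factor `r` from the derivative is absorbed by `2 ^ r`, so the Taylor series is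
      -- evaluated at `2 * M`.
      (tsum_enorm_mul_pow_lt_top hF (M := 2 * M) (ENNReal.mul_ne_top (by simp) hM))
    refine (qnorm_smul_le s _ _).trans ?_
    gcongr
    refine (qnorm_convPowDeriv_le s ψ e b d M ?_ ?_ ?_ r).trans ?_
    · exact le_add_right le_self_add
    · exact le_add_right le_add_self
    · exact le_add_self
    · rw [mul_pow]
      gcongr
      exact_mod_cast Nat.lt_two_pow_self.le
  have hsum : ∀ (x : ℕ → ℤ → C(Circle, ℂ)), ∑' r, qnorm 0 (x r) < ⊤ → ∀ n,
      Summable fun r => ‖x r n‖ := by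
    intro x hx n
    rw [← tsum_enorm_ne_top_iff_summable_norm]
    exact (lt_of_le_of_lt (ENNReal.tsum_le_tsum fun r => enorm_le_qnorm 0 (x r) n) hx).ne
  refine ⟨hsum _ (hb 0), ⟨fun n => ?_, fun s => ?_, fun s => ?_⟩⟩
  · exact HasAngleDeriv.tsum (fun r => ((hψ.convPow h r).hasDeriv n).smul (c r))
      (hsum _ (hb 0) n) (hsum _ (hd 0) n)
  · exact (qnorm_tsum_le s _).trans_lt (hb s)
  · exact (qnorm_tsum_le s _).trans_lt (hd s)

/-! ## Seminorms -/

theorem enorm_le_of_forall {a : C(Circle, ℂ)} {M : ℝ≥0∞} (h : ∀ z, ‖a z‖ₑ ≤ M) : ‖a‖ₑ ≤ M := by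
  rcases eq_or_ne M ⊤ with rfl | hM
  · exact le_top
  lift M to NNReal using hM
  simp only [enorm_eq_nnnorm, ENNReal.coe_le_coe] at h ⊢
  exact (ContinuousMap.norm_le _ M.2).2 h

theorem enorm_apply_le (a : C(Circle, ℂ)) (z : Circle) : ‖a z‖ₑ ≤ ‖a‖ₑ := by
  rw [enorm_le_iff_norm_le]
  exact a.norm_coe_le_norm z

theorem tsum_inv_weight_lt_top : ∑' n : ℤ, (((n.natAbs : ℝ≥0∞) + 1) ^ 2)⁻¹ < ⊤ := by
  have h1 : Summable fun n : ℕ => (((n : ℝ) + 1) ^ 2)⁻¹ := by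
    have := (summable_nat_add_iff 1).2 (Real.summable_nat_pow_inv.2 (by norm_num : 1 < 2))
    simpa using this
  have h2 : Summable fun n : ℤ => ‖(((n.natAbs : ℝ) + 1) ^ 2)⁻¹‖ := by
    refine Summable.norm (Summable.of_nat_of_neg ?_ ?_) <;> simpa using h1
  rw [← tsum_enorm_ne_top_iff_summable_norm] at h2
  refine lt_of_le_of_lt (le_of_eq (tsum_congr fun n => ?_)) h2.lt_top
  rw [Real.enorm_of_nonneg (by positivity), ENNReal.ofReal_inv_of_pos (by positivity),
    ENNReal.ofReal_pow (by positivity), ENNReal.ofReal_add (by positivity) zero_le_one,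
    ENNReal.ofReal_natCast, ENNReal.ofReal_one]

/-- Two extra powers of the weight pay for summability, so all weighted suprema are finite if and
only if all weighted sums are. -/
theorem qnorm_lt_top_of_bound {b : ℤ → C(Circle, ℂ)} {s : ℕ} {M : ℝ≥0∞} (hM : M < ⊤)
    (h : ∀ n, ((n.natAbs : ℝ≥0∞) + 1) ^ (s + 2) * ‖b n‖ₑ ≤ M) : qnorm s b < ⊤ := by
  refine lt_of_le_of_lt ?_ (ENNReal.mul_lt_top hM tsum_inv_weight_lt_top)
  rw [← ENNReal.tsum_mul_left, qnorm]
  refine ENNReal.tsum_le_tsum fun n => ?_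
  have h0 : ((n.natAbs : ℝ≥0∞) + 1) ^ 2 ≠ 0 := by simp
  have h1 : ((n.natAbs : ℝ≥0∞) + 1) ^ 2 ≠ ⊤ := by finiteness
  calc _ = ((n.natAbs : ℝ≥0∞) + 1) ^ s * ‖b n‖ₑ *
        (((n.natAbs : ℝ≥0∞) + 1) ^ 2 * (((n.natAbs : ℝ≥0∞) + 1) ^ 2)⁻¹) := by
        rw [ENNReal.mul_inv_cancel h0 h1, mul_one]
    _ = ((n.natAbs : ℝ≥0∞) + 1) ^ (s + 2) * ‖b n‖ₑ * (((n.natAbs : ℝ≥0∞) + 1) ^ 2)⁻¹ := by ring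
    _ ≤ _ := by gcongr; exact h n

theorem HasAngleDeriv.enorm_circleD {b d : Circle → ℂ} (h : HasAngleDeriv b d) (z : Circle) :
    ‖circleD b z‖ₑ = ‖d z‖ₑ := by
  rw [circleD, (h _).deriv, Circle.exp_arg, enorm_mul]
  have : ‖(Complex.I * (z : ℂ))⁻¹‖ₑ = 1 := by
    rw [← ofReal_norm, norm_inv, norm_mul, Circle.norm_coe]
    simp
  rw [this, one_mul]

theorem exists_hasAngleDeriv {b : Circle → ℂ} (h : CircleC1 b) :
    ∃ d : C(Circle, ℂ), HasAngleDeriv b d := by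
  have hper : Function.Periodic (fun θ : ℝ => b (Circle.exp θ)) (2 * Real.pi) := fun θ => by
    simp only [Circle.periodic_exp θ]
  obtain ⟨d, hd⟩ := exists_continuousMap_of_periodic (h.continuous_deriv le_rfl) fun θ => by
    rw [← deriv_comp_add_const]
    congr 1
    exact funext hper
  exact ⟨d, fun θ => by rw [hd]; exact (h.differentiable one_ne_zero θ).hasDerivAt⟩

theorem HasAngleDeriv.circleC1 {b : Circle → ℂ} {d : C(Circle, ℂ)} (h : HasAngleDeriv b d) :
    CircleC1 b := by
  rw [CircleC1, contDiff_one_iff_deriv]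
  refine ⟨fun θ => (h θ).differentiableAt, ?_⟩
  rw [show deriv (fun θ : ℝ => b (Circle.exp θ)) = fun θ => d (Circle.exp θ) from
    funext fun θ => (h θ).deriv]
  exact d.continuous.comp Circle.exp.continuous

namespace NCTorus

variable {α : ℝ} {h : Circle ≃ₜ Circle}

/-! ## Elements represented by a sequence of functions -/

/-- `A = ∑ (b n ∘ h)(U) V ^ n`, in the sense of Fourier coefficients. -/
def Rep (h : Circle ≃ₜ Circle) (A : NCTorus α) (b : ℤ → C(Circle, ℂ)) : Prop :=
  ∀ m n, regCoeff A m n = circleCoeff m ((b n).comp (h : C(Circle, Circle)))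

/-- The sequence `b n` is `straighten α h n (g n)`: composing with `h` leaves `g n ∘ R^{-n}`, whose
rotation phase cancels the one in `coeff_eq`. Since `|i z| = 1`, the seminorms see only the angular
derivative, and suprema and sums are exchanged at the loss of two powers. -/
theorem mem_smoothPart_iff {A : NCTorus α} :
    A ∈ smoothPart α h ↔ ∃ b d, Rep h A b ∧ IsSmoothSeq b d := by
  constructor
  · rintro ⟨g, hg1, hg2, hg3⟩
    have hc : ∀ n, Continuous (straighten α h n (g n)) := fun n =>
      (hg1 n).1.comp ((continuous_circleRot _).comp h.symm.continuous)
    let b : ℤ → C(Circle, ℂ) := fun n => ⟨straighten α h n (g n), hc n⟩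
    choose d hd using fun n => exists_hasAngleDeriv (hg2 n)
    refine ⟨b, d, fun m n => ?_, hd, fun s => ?_, fun s => ?_⟩
    · let g' : C(Circle, ℂ) := ⟨g n, (hg1 n).1⟩
      have h1 : (b n).comp (h : C(Circle, Circle)) = g'.comp (circleRotMap (-((n : ℝ) * α))) := by
        ext z
        change g n (circleRot _ (h.symm (h z))) = _
        rw [Homeomorph.symm_apply_apply]
        rfl
      rw [h1, circleCoeff_comp_rot, (isAntitransform_iff g').1 (hg1 n) m, coeff_eq, ← mul_assoc,
        ← Complex.exp_add]
      have h2 : 2 * Real.pi * Complex.I * (-((n : ℝ) * α) : ℝ) * m +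
          2 * Real.pi * Complex.I * α * m * n = 0 := by
        push_cast; ring
      rw [h2, Complex.exp_zero, one_mul]
    · refine qnorm_lt_top_of_bound (hg3 (s + 2) 0 zero_le_one) fun n => ?_
      refine le_trans ?_ (le_iSup _ n)
      gcongr
      exact enorm_le_of_forall fun z =>
        le_iSup (fun z => ‖circleD^[0] (straighten α h n (g n)) z‖ₑ) z
    · refine qnorm_lt_top_of_bound (hg3 (s + 2) 1 le_rfl) fun n => ?_
      refine le_trans ?_ (le_iSup _ n)
      gcongr
      refine enorm_le_of_forall fun z => ?_
      rw [← (hd n).enorm_circleD]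
      exact le_iSup (fun z => ‖circleD^[1] (straighten α h n (g n)) z‖ₑ) z
  · rintro ⟨b, d, hA, hb⟩
    let g : ℤ → C(Circle, ℂ) := fun n =>
      ((b n).comp (h : C(Circle, Circle))).comp (circleRotMap ((n : ℝ) * α))
    have hs : ∀ n, straighten α h n (g n) = b n := by
      intro n
      funext z
      change b n (h (circleRot _ (circleRot _ (h.symm z)))) = _
      rw [circleRot_add, add_neg_cancel, circleRot_zero, Homeomorph.apply_symm_apply]
    refine ⟨fun n => g n, fun n => ?_, fun n => ?_, fun k l hl => ?_⟩
    · rw [isAntitransform_iff]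
      intro m
      rw [circleCoeff_comp_rot, ← hA, coeff_eq]
      congr 2
      push_cast
      ring
    · rw [hs]
      exact (hb.hasDeriv n).circleC1
    · simp only [seminormRho, hs]
      obtain rfl | rfl : l = 0 ∨ l = 1 := by omega
      · refine lt_of_le_of_lt (iSup_le fun n => ?_) (hb.left k)
        refine le_trans ?_ (ENNReal.le_tsum n)
        gcongr
        exact iSup_le fun z => enorm_apply_le (b n) z
      · refine lt_of_le_of_lt (iSup_le fun n => ?_) (hb.right k)
        refine le_trans ?_ (ENNReal.le_tsum n)
        gcongr
        refine iSup_le fun z => ?_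
        rw [Function.iterate_one, (hb.hasDeriv n).enorm_circleD]
        exact enorm_apply_le (d n) z

/-- The summands of the element represented by `b`. -/
def repTerm (α : ℝ) (h : Circle ≃ₜ Circle) (b : ℤ → C(Circle, ℂ)) (n : ℤ) : NCTorus α :=
  funU ((b n).comp (h : C(Circle, Circle))) * ((V α ^ n : unitary (NCTorus α)) : NCTorus α)

theorem hasSum_regCoeff {ι : Type*} {f : ι → NCTorus α} {A : NCTorus α} (hf : HasSum f A)
    (m n : ℤ) : HasSum (fun i => regCoeff (f i) m n) (regCoeff A m n) :=
  (regCoeffCLM m n).hasSum hf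

theorem norm_repTerm_le (b : ℤ → C(Circle, ℂ)) (n : ℤ) : ‖repTerm α h b n‖ ≤ ‖b n‖ := by
  rw [repTerm, CStarRing.norm_mul_coe_unitary]
  exact (norm_funU_le _).trans
    ((ContinuousMap.norm_le _ (norm_nonneg _)).2 fun z => (b n).norm_coe_le_norm _)

theorem hasSum_repTerm {b : ℤ → C(Circle, ℂ)} (hb : qnorm 0 b < ⊤) :
    HasSum (repTerm α h b) (∑' n, repTerm α h b n) :=
  (Summable.of_norm_bounded (summable_norm_of_qnorm hb) (norm_repTerm_le b)).hasSum

theorem rep_tsum_repTerm {b : ℤ → C(Circle, ℂ)} (hb : qnorm 0 b < ⊤) :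
    Rep h (∑' n, repTerm α h b n) b := by
  intro m n
  rw [← (hasSum_regCoeff (hasSum_repTerm hb) m n).tsum_eq, tsum_eq_single n]
  · rw [repTerm, regCoeff_funU_mul_V, if_pos rfl]
  · intro l hl
    rw [repTerm, regCoeff_funU_mul_V, if_neg hl.symm]

namespace Rep

variable {A B : NCTorus α} {b c : ℤ → C(Circle, ℂ)}

theorem toReg_eq (hA : Rep h A b) (hb : qnorm 0 b < ⊤) :
    toReg A = toReg (∑' n, repTerm α h b n) :=
  toReg_eq_of_regCoeff_eq fun m n => by rw [hA m n, rep_tsum_repTerm hb m n]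

theorem add (hA : Rep h A b) (hB : Rep h B c) : Rep h (A + B) (fun n => b n + c n) := by
  intro m n
  have h1 : (b n + c n).comp (h : C(Circle, Circle)) =
      (b n).comp (h : C(Circle, Circle)) + (c n).comp (h : C(Circle, Circle)) := rfl
  rw [h1, map_add, ← hA, ← hB]
  exact map_add (regCoeffCLM m n) A B

theorem smul (r : ℂ) (hA : Rep h A b) : Rep h (r • A) (fun n => r • b n) := by
  intro m n
  have h1 : (r • b n).comp (h : C(Circle, Circle)) = r • (b n).comp (h : C(Circle, Circle)) := rfl
  rw [h1, map_smul, ← hA]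
  exact map_smul (regCoeffCLM m n) r A

theorem single (h : Circle ≃ₜ Circle) (a : C(Circle, ℂ)) (l : ℤ) :
    Rep h (funU (a.comp (h : C(Circle, Circle))) *
      ((V α ^ l : unitary (NCTorus α)) : NCTorus α)) (fun n => if n = l then a else 0) := by
  intro m n
  rw [regCoeff_funU_mul_V]
  by_cases hn : n = l
  · simp only [hn, if_true]
  · simp only [hn, if_false]
    exact (map_zero (circleCoeff m)).symm

theorem one (h : Circle ≃ₜ Circle) :
    Rep h (1 : NCTorus α) (fun n => if n = 0 then 1 else 0) := by
  have h1 := single (α := α) h 1 0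
  rw [show (1 : C(Circle, ℂ)).comp (h : C(Circle, Circle)) = 1 from rfl, map_one, zpow_zero,
    OneMemClass.coe_one, mul_one] at h1
  exact h1

theorem tsum {A : ℕ → NCTorus α} {B : NCTorus α} {b : ℕ → ℤ → C(Circle, ℂ)}
    (hA : ∀ r, Rep h (A r) (b r)) (hB : HasSum A B) (hb : ∀ n, Summable fun r => ‖b r n‖) :
    Rep h B (fun n => ∑' r, b r n) := by
  intro m n
  let L : C(Circle, ℂ) →L[ℂ] ℂ :=
    (circleCoeff m).comp (ContinuousMap.compCLM ℂ ℂ (h : C(Circle, Circle)))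
  have h1 := L.hasSum (hb n).of_norm.hasSum
  have h2 := hasSum_regCoeff hB m n
  simp only [hA _ m n] at h2
  exact h2.unique h1

theorem comp_conjRot (a : C(Circle, ℂ)) (k : ℤ) :
    (a.comp (h : C(Circle, Circle))).comp (circleRotMap (-(k * (2 * α)))) =
      (a.comp (conjRot (2 * α) h (-k))).comp (h : C(Circle, Circle)) := by
  ext z
  change a (h (circleRot _ z)) = a (h (circleRot _ (h.symm (h z))))
  rw [Homeomorph.symm_apply_apply]
  push_cast
  rw [neg_mul]

theorem repTerm_mul_repTerm (b c : ℤ → C(Circle, ℂ)) (k l : ℤ) :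
    repTerm α h b k * repTerm α h c l =
      funU ((b k * (c l).comp (conjRot (2 * α) h (-k))).comp (h : C(Circle, Circle))) *
        ((V α ^ (k + l) : unitary (NCTorus α)) : NCTorus α) := by
  have h1 : (b k * (c l).comp (conjRot (2 * α) h (-k))).comp (h : C(Circle, Circle)) =
      (b k).comp (h : C(Circle, Circle)) *
        ((c l).comp (conjRot (2 * α) h (-k))).comp (h : C(Circle, Circle)) := rfl
  rw [h1, map_mul, ← comp_conjRot, repTerm, repTerm, mul_assoc, ← mul_assoc _ (funU _),
    V_zpow_mul_funU, zpow_add, Submonoid.coe_mul]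
  simp only [mul_assoc]

theorem mul (hA : Rep h A b) (hB : Rep h B c) (hb : qnorm 0 b < ⊤) (hc : qnorm 0 c < ⊤) :
    Rep h (A * B) (twistedConv (fun k => conjRot (2 * α) h (-k)) b c) := by
  intro m n
  let L : C(Circle, ℂ) →L[ℂ] ℂ :=
    (circleCoeff m).comp (ContinuousMap.compCLM ℂ ℂ (h : C(Circle, Circle)))
  have h1 := L.hasSum (summable_norm_twistedConv (fun k => conjRot (2 * α) h (-k)) hb hc n
    ).of_norm.hasSum
  -- The series need not be known to equal `A` and `B`; they have the same images under `toReg`,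
  -- which is all that the coefficients of the product depend on.
  have h2 : regCoeff (A * B) m n =
      regCoeff ((∑' k, repTerm α h b k) * ∑' l, repTerm α h c l) m n := by
    rw [regCoeff, regCoeff, map_mul, map_mul, hA.toReg_eq hb, hB.toReg_eq hc]
  have h3 := hasSum_regCoeff ((hasSum_repTerm (α := α) (h := h) hb).mul_right
    (∑' l, repTerm α h c l)) m n
  rw [h2]
  refine h3.unique (h1.congr_fun fun k => ?_)
  rw [← (hasSum_regCoeff ((hasSum_repTerm (α := α) (h := h) hc).mul_left
    (repTerm α h b k)) m n).tsum_eq, tsum_eq_single (n - k)]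
  · rw [repTerm_mul_repTerm, regCoeff_funU_mul_V, if_pos (by ring)]
    rfl
  · intro l hl
    rw [repTerm_mul_repTerm, regCoeff_funU_mul_V, if_neg]
    rintro rfl
    exact hl (by ring)

theorem star_repTerm (b : ℤ → C(Circle, ℂ)) (n : ℤ) : star (repTerm α h b n) =
    funU (((star (b n)).comp (conjRot (2 * α) h n)).comp (h : C(Circle, Circle))) *
      ((V α ^ (-n) : unitary (NCTorus α)) : NCTorus α) := by
  have h1 : star ((b n).comp (h : C(Circle, Circle))) =
      (star (b n)).comp (h : C(Circle, Circle)) := rfl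
  have h2 := comp_conjRot (α := α) (h := h) (star (b n)) (-n)
  rw [neg_neg] at h2
  rw [repTerm, star_mul, ← map_star, h1, ← Unitary.coe_star, Unitary.star_eq_inv, ← zpow_neg,
    V_zpow_mul_funU, h2]

theorem star (hA : Rep h A b) (hb : qnorm 0 b < ⊤) :
    Rep h (star A) (fun n => (star (b (-n))).comp (conjRot (2 * α) h (-n))) := by
  intro m n
  have h2 : regCoeff (Star.star A) m n = regCoeff (Star.star (∑' k, repTerm α h b k)) m n := by
    rw [regCoeff, regCoeff, map_star, map_star, hA.toReg_eq hb]
  rw [h2, ← (hasSum_regCoeff (hasSum_repTerm (α := α) (h := h) hb).star m n).tsum_eq,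
    tsum_eq_single (-n)]
  · rw [star_repTerm, regCoeff_funU_mul_V, if_pos (neg_neg n).symm]
  · intro l hl
    rw [star_repTerm, regCoeff_funU_mul_V, if_neg]
    rintro rfl
    exact hl (neg_neg l).symm

theorem pow (hA : Rep h A b) (hb : qnorm 0 b < ⊤) (r : ℕ) :
    Rep h (A ^ r) (convPow (fun k => conjRot (2 * α) h (-k)) b r) := by
  induction r with
  | zero => rw [pow_zero]; exact one h
  | succ r ih =>
    rw [pow_succ']
    exact hA.mul ih hb ((qnorm_convPow_le 0 _ b r).trans_lt (ENNReal.pow_lt_top hb))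

end Rep

/-! ## The smooth algebra -/

variable {e : ℤ → C(Circle, ℂ)} {K : ℝ≥0∞} {t : ℕ}

/-- The smooth part as a star subalgebra. -/
def smoothSubalgebra (hψ : IsTempered (fun k => conjRot (2 * α) h (-k)) e K t) :
    StarSubalgebra ℂ (NCTorus α) where
  carrier := smoothPart α h
  mul_mem' := by
    simp only [mem_smoothPart_iff]
    rintro A B ⟨b, d, hA, hb⟩ ⟨c, d', hB, hc⟩
    exact ⟨_, _, hA.mul hB (hb.left 0) (hc.left 0), hψ.conv hb hc⟩
  add_mem' := by
    simp only [mem_smoothPart_iff]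
    rintro A B ⟨b, d, hA, hb⟩ ⟨c, d', hB, hc⟩
    exact ⟨_, _, hA.add hB, hb.add hc⟩
  algebraMap_mem' r := by
    rw [mem_smoothPart_iff, Algebra.algebraMap_eq_smul_one]
    have h1 := Rep.single (α := α) h (algebraMap ℂ C(Circle, ℂ) r) 0
    have h2 : (algebraMap ℂ C(Circle, ℂ) r).comp (h : C(Circle, Circle)) =
        algebraMap ℂ C(Circle, ℂ) r := rfl
    rw [h2, AlgHomClass.commutes, zpow_zero, OneMemClass.coe_one, mul_one,
      Algebra.algebraMap_eq_smul_one (A := NCTorus α)] at h1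
    exact ⟨_, _, h1, IsSmoothSeq.single 0 (HasAngleDeriv.const r)⟩
  star_mem' := by
    simp only [mem_smoothPart_iff]
    rintro A ⟨b, d, hA, hb⟩
    exact ⟨_, _, hA.star (hb.left 0), hψ.star hb⟩

theorem exists_hasAngleDeriv_of_mem_span {p : C(Circle, ℂ)}
    (hp : p ∈ Submodule.span ℂ (Set.range circleMono)) : ∃ d : C(Circle, ℂ), HasAngleDeriv p d := by
  induction hp using Submodule.span_induction with
  | mem x hx =>
    obtain ⟨k, rfl⟩ := hx
    exact ⟨_, HasAngleDeriv.circleMono k⟩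
  | zero => exact ⟨_, HasAngleDeriv.zero⟩
  | add x y _ _ hx hy =>
    obtain ⟨d, hd⟩ := hx
    obtain ⟨d', hd'⟩ := hy
    exact ⟨_, hd.add hd'⟩
  | smul r x _ hx =>
    obtain ⟨d, hd⟩ := hx
    exact ⟨_, hd.smul r⟩

theorem mem_smoothPart_single {a d : C(Circle, ℂ)} (ha : HasAngleDeriv a d) (l : ℤ) :
    funU (a.comp (h : C(Circle, Circle))) * ((V α ^ l : unitary (NCTorus α)) : NCTorus α) ∈
      smoothPart α h :=
  mem_smoothPart_iff.2 ⟨_, _, Rep.single h a l, IsSmoothSeq.single l ha⟩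

theorem V_mem_smoothPart : (V α : NCTorus α) ∈ smoothPart α h := by
  have h1 := mem_smoothPart_single (α := α) (h := h) (HasAngleDeriv.const 1) 1
  rw [map_one, show (1 : C(Circle, ℂ)).comp (h : C(Circle, Circle)) = 1 from rfl, map_one, one_mul,
    zpow_one] at h1
  exact h1

/-- Since `h⁻¹` is merely continuous, `U = (h⁻¹ ∘ h)(U)` need not be smooth, but uniform
approximation of `h⁻¹` by trigonometric polynomials `p` gives smooth elements `(p ∘ h)(U)`
converging to it. -/
theorem U_mem_closure_smoothPart : (U α : NCTorus α) ∈ closure (smoothPart α h) := by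
  let L : C(Circle, ℂ) →L[ℂ] NCTorus α :=
    funUCLM.comp (ContinuousMap.compCLM ℂ ℂ (h : C(Circle, Circle)))
  have h1 : L ((circleMono 1).comp (h.symm : C(Circle, Circle))) = U α := by
    rw [← funU_circleMono_one]
    change funU (((circleMono 1).comp (h.symm : C(Circle, Circle))).comp (h : C(Circle, Circle))) = _
    congr 1
    ext z
    change circleMono 1 (h.symm (h z)) = _
    rw [Homeomorph.symm_apply_apply]
  have h2 : ((circleMono 1).comp (h.symm : C(Circle, Circle))) ∈
      closure (Submodule.span ℂ (Set.range circleMono) : Set C(Circle, ℂ)) := by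
    rw [← Submodule.topologicalClosure_coe, span_circleMono_closure]
    trivial
  rw [← h1]
  refine map_mem_closure L.continuous h2 fun p hp => ?_
  obtain ⟨d, hd⟩ := exists_hasAngleDeriv_of_mem_span hp
  have h3 := mem_smoothPart_single (α := α) (h := h) hd 0
  rwa [zpow_zero, OneMemClass.coe_one, mul_one] at h3

theorem dense_smoothPart (hψ : IsTempered (fun k => conjRot (2 * α) h (-k)) e K t) :
    Dense (smoothPart α h) := by
  have h1 := dense_of_mem (smoothSubalgebra hψ).topologicalClosure
    (U_mem_closure_smoothPart (h := h)) (subset_closure V_mem_smoothPart)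
  exact dense_closure.1 h1

theorem exists_entire_mem_smoothPart (hψ : IsTempered (fun k => conjRot (2 * α) h (-k)) e K t)
    {F : ℂ → ℂ} (hF : Differentiable ℂ F) {A : NCTorus α} (hA : A ∈ smoothPart α h) :
    ∃ B ∈ smoothPart α h,
      HasSum (fun r : ℕ => ((r.factorial : ℂ)⁻¹ * iteratedDeriv r F 0) • A ^ r) B := by
  obtain ⟨b, d, hb, hs⟩ := mem_smoothPart_iff.1 hA
  -- Nontriviality gives `‖1‖ = 1`, so that `‖A ^ r‖ ≤ ‖A‖ ^ r` also for `r = 0`.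
  have : Nontrivial (NCTorus α) := (toReg (α := α)).toAlgHom.toRingHom.domain_nontrivial
  have h1 : Summable fun r : ℕ => ‖((r.factorial : ℂ)⁻¹ * iteratedDeriv r F 0) • A ^ r‖ := by
    rw [← tsum_enorm_ne_top_iff_summable_norm]
    refine (lt_of_le_of_lt (ENNReal.tsum_le_tsum fun r => ?_)
      (tsum_enorm_mul_pow_lt_top hF (M := ‖A‖ₑ) enorm_ne_top)).ne
    rw [enorm_smul]
    gcongr
    simp only [enorm_eq_nnnorm]
    exact_mod_cast nnnorm_pow_le A r
  obtain ⟨h2, h3⟩ := hψ.entire hs hF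
  refine ⟨_, mem_smoothPart_iff.2 ⟨_, _, ?_, h3⟩, h1.of_norm.hasSum⟩
  exact Rep.tsum (fun r => (hb.pow (hs.left 0) r).smul _) h1.of_norm.hasSum h2

theorem exists_isTempered (hα : Irrational α) (f : Circle ≃ₘ^∞⟮𝓡 1, 𝓡 1⟯ Circle)
    (hf : OrientationPreserving f) (h_conj : ∀ z : Circle, f z = h (circleRot (2 * α) (h.symm z))) :
    ∃ e K t, IsTempered (fun k => conjRot (2 * α) h (-k)) e K t := by
  have hβ : Irrational (2 * α) := by
    have := hα.natCast_mul (m := 2) two_ne_zero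
    exact_mod_cast this
  obtain ⟨e, K, t, hK, h1, h2⟩ := exists_conjRot_deriv hβ f hf h h_conj
  refine ⟨fun n => e (-n), ENNReal.ofReal K, t, ENNReal.ofReal_ne_top, fun n => ?_,
    fun n b d hb => h2 (-n) b d hb⟩
  have h3 := ENNReal.ofReal_le_ofReal (h1 (-n))
  rw [ofReal_norm, ENNReal.ofReal_mul hK.le, ENNReal.ofReal_pow (by positivity),
    ENNReal.ofReal_add (by positivity) zero_le_one, Int.natAbs_neg,
    ENNReal.ofReal_natCast, ENNReal.ofReal_one] at h3
  exact h3

end NCTorus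

end

theorem mainTheorem11 (α : ℝ) (hα : Irrational α) (hα0 : 0 < α) (hα1 : α < 1 / 2)
    (f : Circle ≃ₘ^∞⟮𝓡 1, 𝓡 1⟯ Circle) (hf : OrientationPreserving f)
    (h : Circle ≃ₜ Circle) (h_one : h 1 = 1)
    (h_conj : ∀ z : Circle, f z = h (circleRot (2 * α) (h.symm z))) :
    (∃ S : StarSubalgebra ℂ (NCTorus α), (S : Set (NCTorus α)) = smoothPart α h) ∧
    Dense (smoothPart α h) ∧
    ∀ F : ℂ → ℂ, Differentiable ℂ F → ∀ A ∈ smoothPart α h,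
      ∃ B ∈ smoothPart α h,
        HasSum (fun r : ℕ => ((r.factorial : ℂ)⁻¹ * iteratedDeriv r F 0) • A ^ r) B := by
  obtain ⟨e, K, t, hψ⟩ := NCTorus.exists_isTempered hα f hf h_conj
  exact ⟨⟨NCTorus.smoothSubalgebra hψ, rfl⟩, NCTorus.dense_smoothPart hψ,
    fun F hF A hA => NCTorus.exists_entire_mem_smoothPart hψ hF hA⟩
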